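/- **Theorem (Efficiency).** Let $k\ge 1$ be an integer and $\sigma$ a real number. There is a constant $C>0$, depending only on $k$ and $\sigma$, such that the following holds. Let $\Omega\subset\mathbb R^2$ be a polygonal domain (nonempty, bounded, open, connected, with boundary a finite union of nondegenerate segments), let $\gamma_1,\dots,\gamma_N\subset\Omega$ be nondegenerate closed line segments and let $g_l\in L^2(\gamma_l)$ (in particular $g_l\in H^{\beta_l}(\gamma_l)$ with $\beta_l\ge 0$ is allowed). Let $u\in H^1_0(\Omega)$ be the weak solution of $-\Delta u=\sum_{l=1}^N g_l\delta_{\gamma_l}$ in $\Omega$, $u=0$ on $\partial\Omega$, where $\langle g_l\delta_{\gamma_l},v\rangle=\int_{\gamma_l}g_l v\,ds$. Let $\mathcal T$ be a conforming triangulation of $\Omega$ such that every $T\in\mathcal T$ contains a disc whose radius $r>0$ satisfies $h_T\le\sigma r$, where $h_T$ is the diameter of $T$, and such that every $\gamma_l$ is a union of interior edges of $\mathcal T$. Let $S(\mathcal T)=\{v\in C^0(\Omega)\cap H^1_0(\Omega): v|_T\in P_k(T)\ \forall T\in\mathcal T\}$ and let $u_h\in S(\mathcal T)$ satisfy $$\int_\Omega\nabla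 u_h\cdot\nabla v_h\,dx=\sum_{l=1}^N\int_{\gamma_l}g_l v_h\,ds\qquad\forall v_h\in S(\mathcal T).$$ Let $\mathcal E_I$ be the set of interior edges. For $e\in\mathcal E_I$ put $f|_e=\sum_{l:\,e\subset\gamma_l}g_l|_e$ (so $f=g_l$ if $e$ lies in the single fracture $\gamma_l$, and $f=0$ if $e$ lies in no fracture), let $\overline f\in P_k(e)$ be the $L^2(e)$-projection of $f|_e$, let $h_e$ be the length of $e$, and let $\mathrm{osc}(e)^2=h_e\|f-\overline f\|_{L^2(e)}^2$. If $e$ is the common edge of $T_+$ and $T_-$, with outward unit normals $\mathbf n^\pm$ of $T_\pm$ on $e$, let $\omega_e=T_+\cup T_-$ and $[\partial_{\mathbf n}u_h]=\mathbf n^+\cdot\nabla u_h^++\mathbf n^-\cdot\nabla u_h^-$ on $e$, where $\nabla u_h^\pm$ are the traces of $\nabla u_h$ from $T_\pm$. For $T\in\mathcal T$ let $\omega_T=T\cup\bigcup_{e\in\partial T\cap\mathcal E_I}\omega_e$, $\mathrm{osc}(\partial T)^2=\sum_{e\in\partial T\cap\mathcal E_I}\mathrm{osc}(e)^2$ and $$\eta_T(u_h)^2=h_T^2\|\Delta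 u_h\|_{L^2(T)}^2+\frac12\sum_{e\in\partial T\cap\mathcal E_I}h_T\|f-[\partial_{\mathbf n}u_h]\|_{L^2(e)}^2 .$$ Then $$\eta_T(u_h)\le C\left(\|\nabla(u-u_h)\|_{L^2(\omega_T)}+\mathrm{osc}(\partial T)\right)\qquad\forall\,T\in\mathcal T .$$ -/

import Mathlib

open MeasureTheory Set Filter Topology
open scoped ContDiff

noncomputable section

/-- The Euclidean plane. -/
abbrev Plane : Type := EuclideanSpace ℝ (Fin 2)

/-! ### Domains, Sobolev spaces -/

/-- A polygonal domain: a nonempty bounded connected open subset of the plane whose boundary is a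
finite union of (nondegenerate) line segments. -/
structure IsPolygonalDomain (Ω : Set Plane) : Prop where
  isOpen : IsOpen Ω
  isConnected : IsConnected Ω
  isBounded : Bornology.IsBounded Ω
  frontier_eq : ∃ S : Finset (Plane × Plane), (∀ s ∈ S, s.1 ≠ s.2) ∧
    frontier Ω = ⋃ s ∈ S, segment ℝ s.1 s.2

/-- The `L²` norm of `f` with respect to the measure `μ`. -/
def l2Norm {F : Type*} [NormedAddCommGroup F] (μ : Measure Plane) (f : Plane → F) : ℝ :=
  √(∫ x, ‖f x‖ ^ 2 ∂μ)

/-- Test functions: the space `C_c^∞(Ω)`. -/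
def IsTestFunction (Ω : Set Plane) (φ : Plane → ℝ) : Prop :=
  ContDiff ℝ ∞ φ ∧ HasCompactSupport φ ∧ tsupport φ ⊆ Ω

/-- `G` is the weak (distributional) gradient of `v` on the open set `Ω`. -/
def HasWeakGradient (Ω : Set Plane) (v : Plane → ℝ) (G : Plane → Plane) : Prop :=
  LocallyIntegrableOn v Ω ∧ LocallyIntegrableOn G Ω ∧
    ∀ φ : Plane → ℝ, IsTestFunction Ω φ →
      ∫ x in Ω, φ x • G x = - ∫ x in Ω, v x • gradient φ x

open Classical in
/-- The weak gradient of `v` on `Ω` (unique almost everywhere on `Ω`; the value is `0` if there is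
no weak gradient). -/
def weakGrad (Ω : Set Plane) (v : Plane → ℝ) : Plane → Plane :=
  if h : ∃ G, HasWeakGradient Ω v G then h.choose else 0

/-- The Sobolev space `H¹(Ω)`. -/
def MemH1 (Ω : Set Plane) (v : Plane → ℝ) : Prop :=
  MemLp v 2 (volume.restrict Ω) ∧
    ∃ G, HasWeakGradient Ω v G ∧ MemLp G 2 (volume.restrict Ω)

/-- The Sobolev space `H¹₀(Ω)`: the closure of `C_c^∞(Ω)` in `H¹(Ω)`. -/
def MemH10 (Ω : Set Plane) (v : Plane → ℝ) : Prop :=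
  MemH1 Ω v ∧ ∀ ε > 0, ∃ φ, IsTestFunction Ω φ ∧
    l2Norm (volume.restrict Ω) (fun x => v x - φ x) < ε ∧
    l2Norm (volume.restrict Ω) (fun x => weakGrad Ω v x - gradient φ x) < ε

/-! ### Line fractures and the boundary value problem -/

/-- Arc length on the segment with endpoints `a` and `b`. -/
def segMeasure (a b : Plane) : Measure Plane :=
  (Measure.hausdorffMeasure 1 : Measure Plane).restrict (segment ℝ a b)

/-- The pairing `⟨∑ g_l δ_{γ_l}, v⟩ = ∑ ∫_{γ_l} g_l v ds`, where `γ_l` is the segment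
with endpoints `P l` and `Q l`. -/
def linePairing {N : ℕ} (P Q : Fin N → Plane) (g : Fin N → Plane → ℝ) (v : Plane → ℝ) : ℝ :=
  ∑ l, ∫ x, g l x * v x ∂(segMeasure (P l) (Q l))

/-- `u ∈ H¹₀(Ω)` solves `-Δu = ∑ g_l δ_{γ_l}` in `Ω`, `u = 0` on `∂Ω`; it is enough to test
against the dense subspace `C_c^∞(Ω)` of `H¹₀(Ω)`, both sides being continuous on `H¹₀(Ω)`. -/
def IsWeakSolution (Ω : Set Plane) {N : ℕ} (P Q : Fin N → Plane) (g : Fin N → Plane → ℝ)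
    (u : Plane → ℝ) : Prop :=
  MemH10 Ω u ∧ ∀ φ, IsTestFunction Ω φ →
    ∫ x in Ω, inner ℝ (weakGrad Ω u x) (gradient φ x) = linePairing P Q g φ

/-! ### Triangulations. A triangle or an edge is given by its finite set of vertices. -/

/-- The closed triangle or edge with the given vertices. -/
def hull (s : Finset Plane) : Set Plane := convexHull ℝ (s : Set Plane)

/-- The edges of the triangle `t`. -/
def edges (t : Finset Plane) : Finset (Finset Plane) := t.powersetCard 2

/-- The edge `e` is an interior edge: its relative interior lies in `Ω`. -/
def IsInteriorEdge (Ω : Set Plane) (e : Finset Plane) : Prop :=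
  ∀ a ∈ e, ∀ b ∈ e, a ≠ b → openSegment ℝ a b ⊆ Ω

/-- A (conforming) triangulation of `Ω`: finitely many nondegenerate closed triangles that cover
the closure of `Ω`, have their interiors in `Ω`, and meet pairwise in common vertices, edges, or
not at all; every edge is an interior edge or lies on the boundary. -/
structure IsTriangulation (Ω : Set Plane) (𝒯 : Finset (Finset Plane)) : Prop where
  card_eq : ∀ t ∈ 𝒯, t.card = 3
  affineIndependent : ∀ t ∈ 𝒯, AffineIndependent ℝ ((↑) : t → Plane)
  inter_subset : ∀ s ∈ 𝒯, ∀ t ∈ 𝒯,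
    hull s ∩ hull t ⊆ convexHull ℝ ((s : Set Plane) ∩ (t : Set Plane))
  iUnion_eq : ⋃ t ∈ 𝒯, hull t = closure Ω
  interior_subset : ∀ t ∈ 𝒯, interior (hull t) ⊆ Ω
  edge : ∀ t ∈ 𝒯, ∀ e ∈ edges t, IsInteriorEdge Ω e ∨ hull e ⊆ frontier Ω

/-- Shape regularity with parameter `σ`: every triangle contains a ball whose radius is at least
the diameter of the triangle divided by `σ`. -/
def IsShapeRegular (σ : ℝ) (𝒯 : Finset (Finset Plane)) : Prop :=
  ∀ t ∈ 𝒯, ∃ c : Plane, ∃ r : ℝ, 0 < r ∧ Metric.closedBall c r ⊆ hull t ∧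
    Metric.diam (hull t) ≤ σ * r

/-- The mesh conforms to the fractures: every fracture is a union of interior edges. -/
def ConformsToFractures (Ω : Set Plane) (𝒯 : Finset (Finset Plane)) {N : ℕ}
    (P Q : Fin N → Plane) : Prop :=
  ∀ l, ∃ S : Set (Finset Plane),
    (∀ e ∈ S, IsInteriorEdge Ω e ∧ ∃ t ∈ 𝒯, e ∈ edges t) ∧
    segment ℝ (P l) (Q l) = ⋃ e ∈ S, hull e

open Classical in
/-- The interior edges of the triangle `t`. -/
def interiorEdges (Ω : Set Plane) (t : Finset Plane) : Finset (Finset Plane) :=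
  (edges t).filter (IsInteriorEdge Ω)

open Classical in
/-- The triangles of the mesh that have `e` as an edge. -/
def adjacent (𝒯 : Finset (Finset Plane)) (e : Finset Plane) : Finset (Finset Plane) :=
  𝒯.filter (fun s => e ⊆ s)

/-- The patch `ω_T`: the triangle together with its neighbours across its interior edges. -/
def patch (Ω : Set Plane) (𝒯 : Finset (Finset Plane)) (t : Finset Plane) : Set Plane :=
  hull t ∪ ⋃ e ∈ interiorEdges Ω t, ⋃ s ∈ adjacent 𝒯 e, hull s

/-! ### The finite element method -/

/-- The value at `x` of a polynomial in the two coordinates. -/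
def polyEval (p : MvPolynomial (Fin 2) ℝ) (x : Plane) : ℝ := MvPolynomial.eval (fun i => x i) p

/-- The Lagrange finite element space of degree `k`. -/
def MemLagrange (Ω : Set Plane) (𝒯 : Finset (Finset Plane)) (k : ℕ) (v : Plane → ℝ) : Prop :=
  ContinuousOn v Ω ∧ MemH10 Ω v ∧
    ∀ t ∈ 𝒯, ∃ p : MvPolynomial (Fin 2) ℝ, p.totalDegree ≤ k ∧
      ∀ x ∈ hull t ∩ Ω, v x = polyEval p x

/-- `uh` is the finite element solution. -/
def IsFESolution (Ω : Set Plane) (𝒯 : Finset (Finset Plane)) (k : ℕ) {N : ℕ}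
    (P Q : Fin N → Plane) (g : Fin N → Plane → ℝ) (uh : Plane → ℝ) : Prop :=
  MemLagrange Ω 𝒯 k uh ∧ ∀ v, MemLagrange Ω 𝒯 k v →
    ∫ x in Ω, inner ℝ (weakGrad Ω uh x) (weakGrad Ω v x) = linePairing P Q g v

/-! ### The estimator and the oscillation -/

/-- Arc length on the edge `e`. -/
def edgeMeasure (e : Finset Plane) : Measure Plane :=
  (Measure.hausdorffMeasure 1 : Measure Plane).restrict (hull e)

open Classical in
/-- The prescribed flux jump `f` on the edge `e`: it is `g_l` if `e ⊆ γ_l` and `0` if `e` lies in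
no fracture (and the sum of the `g_l` concerned if fractures overlap along `e`). -/
def fluxData {N : ℕ} (P Q : Fin N → Plane) (g : Fin N → Plane → ℝ) (e : Finset Plane)
    (x : Plane) : ℝ :=
  ∑ l with hull e ⊆ segment ℝ (P l) (Q l), g l x

/-- `n` is the outward unit normal of the triangle `s` on its edge `e`. -/
def IsOutwardNormal (s e : Finset Plane) (n : Plane) : Prop :=
  ‖n‖ = 1 ∧ ∀ x ∈ hull e, ∀ y ∈ hull s, inner ℝ n (y - x) ≤ 0

open Classical in
/-- The outward unit normal of the triangle `s` on its edge `e` (it is unique). -/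
def outwardNormal (s e : Finset Plane) : Plane :=
  if h : ∃ n, IsOutwardNormal s e n then h.choose else 0

/-- The trace at `x` of the gradient of `v`, taken from inside the triangle `s`. -/
def gradTrace (v : Plane → ℝ) (s : Finset Plane) (x : Plane) : Plane :=
  limUnder (𝓝[interior (hull s)] x) (gradient v)

/-- The jump `[∂ₙ v] = n⁺ · ∇v⁺ + n⁻ · ∇v⁻` of the normal derivative across the edge `e`. -/
def normalJump (𝒯 : Finset (Finset Plane)) (v : Plane → ℝ) (e : Finset Plane) (x : Plane) : ℝ :=
  ∑ s ∈ adjacent 𝒯 e, inner ℝ (outwardNormal s e) (gradTrace v s x)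

/-- The local indicator `η_T(v)`. -/
def localIndicator (Ω : Set Plane) (𝒯 : Finset (Finset Plane)) {N : ℕ} (P Q : Fin N → Plane)
    (g : Fin N → Plane → ℝ) (v : Plane → ℝ) (t : Finset Plane) : ℝ :=
  √(Metric.diam (hull t) ^ 2 * l2Norm (volume.restrict (hull t)) (Laplacian.laplacian v) ^ 2 +
    1 / 2 * ∑ e ∈ interiorEdges Ω t, Metric.diam (hull t) *
      l2Norm (edgeMeasure e) (fun x => fluxData P Q g e x - normalJump 𝒯 v e x) ^ 2)

/-- The polynomial `p` of degree at most `k` represents the `L²(e)`-projection of `f` onto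
`P_k(e)`. -/
def IsL2Projection (k : ℕ) (e : Finset Plane) (f : Plane → ℝ) (p : MvPolynomial (Fin 2) ℝ) :
    Prop :=
  p.totalDegree ≤ k ∧ ∀ q : MvPolynomial (Fin 2) ℝ, q.totalDegree ≤ k →
    ∫ x, (f x - polyEval p x) * polyEval q x ∂(edgeMeasure e) = 0

open Classical in
/-- The `L²(e)`-projection of `f ∈ L²(e)` onto `P_k(e)`. -/
def l2Proj (k : ℕ) (e : Finset Plane) (f : Plane → ℝ) : Plane → ℝ :=
  if h : ∃ p, IsL2Projection k e f p then polyEval h.choose else 0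

/-- The oscillation `osc(∂T)`, with `osc(e)² = h_e ‖f - f̄‖²_{L²(e)}`. -/
def dataOsc (Ω : Set Plane) (k : ℕ) {N : ℕ} (P Q : Fin N → Plane)
    (g : Fin N → Plane → ℝ) (t : Finset Plane) : ℝ :=
  √(∑ e ∈ interiorEdges Ω t, Metric.diam (hull e) *
    l2Norm (edgeMeasure e)
      (fun x => fluxData P Q g e x - l2Proj k e (fluxData P Q g e) x) ^ 2)

end

noncomputable section

/-! ### The `L²` norm -/

/-! Write e = u - uh. For a test function φ the integral of ∇e · ∇φ equals the action of the line
sources on φ minus the integral of ∇uh · ∇φ (`residual`). As uh is a polynomial on each triangle,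
Green's formula turns this into element residuals Δuh and edge residuals f - [∂ₙuh]. The indicator
is a weighted norm of exactly these, so each of them is recovered by testing with a function dual to
it and supported where few other residuals act: the bubble function technique.

Element residual (`exists_element_bound`). Take φ to be a smooth bump times Δuh on the disc of
radius r inside T. No edge meets the support, so M = ∫ φ Δuh is the integral of ∇e · ∇φ. Polynomials
of degree at most k form a finite-dimensional space, so by compactness of the unit sphere
(`exists_le_mul_of_homogeneous`) and scaling, M controls both ‖Δuh‖² on T and r²‖∇φ‖².
Cauchy–Schwarz then gives h_T‖Δuh‖ ≤ C‖∇e‖ on T.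

Edge residual (`exists_edge_bound`). On e it splits as (f - f̄) + m, with m the restriction of a
polynomial of degree at most k. Take φ to be a bump times m along the middle half of e, times a
cut-off across e (`exists_testFunction_segment`). By `residual_edge`, testing produces the edge term
and the element residuals of the two neighbours. The latter are already bounded, the part f - f̄ is
the oscillation, and what remains bounds m.

Shape regularity supplies the disc inside T, and on both sides of an interior edge a box above the
middle half of e, of height h_e / (4σ²), inside the two triangles (`IsEdgeFrame`,
`exists_edge_configuration`). Supports stay away from the vertices, so smooth test functions
suffice; translation, rotation and dilation reduce everything to fixed reference sets, and the
constants depend on k and σ only. -/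

theorem l2Norm_nonneg {F : Type*} [NormedAddCommGroup F] (μ : Measure Plane) (f : Plane → F) :
    0 ≤ l2Norm μ f :=
  Real.sqrt_nonneg _

theorem l2Norm_sq {F : Type*} [NormedAddCommGroup F] (μ : Measure Plane) (f : Plane → F) :
    l2Norm μ f ^ 2 = ∫ x, ‖f x‖ ^ 2 ∂μ :=
  Real.sq_sqrt (integral_nonneg fun _ => by positivity)

theorem l2Norm_congr_ae {F : Type*} [NormedAddCommGroup F] {μ : Measure Plane} {f g : Plane → F}
    (h : f =ᵐ[μ] g) : l2Norm μ f = l2Norm μ g := by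
  unfold l2Norm
  congr 1
  exact integral_congr_ae (h.mono fun x hx => by simp only [hx])

theorem l2Norm_restrict_mono {F : Type*} [NormedAddCommGroup F] {μ : Measure Plane}
    {f : Plane → F} {S T : Set Plane} (hf : MemLp f 2 (μ.restrict T)) (hST : S ≤ᵐ[μ] T) :
    l2Norm (μ.restrict S) f ≤ l2Norm (μ.restrict T) f := by
  apply Real.sqrt_le_sqrt
  exact setIntegral_mono_set (f := fun x => ‖f x‖ ^ 2) hf.norm.integrable_sq
    (ae_of_all _ fun _ => by positivity) hST

/-- Cauchy–Schwarz in the Hilbert space `Lp F 2 μ`, transferred to representatives. -/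
theorem abs_integral_inner_le {F : Type*} [NormedAddCommGroup F] [InnerProductSpace ℝ F]
    {μ : Measure Plane} {f g : Plane → F} (hf : MemLp f 2 μ) (hg : MemLp g 2 μ) :
    |∫ x, inner ℝ (f x) (g x) ∂μ| ≤ l2Norm μ f * l2Norm μ g := by
  have h1 : ∫ x, inner ℝ (f x) (g x) ∂μ = inner ℝ (hf.toLp f) (hg.toLp g) := by
    rw [L2.inner_def]
    apply integral_congr_ae
    filter_upwards [hf.coeFn_toLp, hg.coeFn_toLp] with x h1 h2
    rw [h1, h2]
  have h2 : ∀ {k : Plane → F} (hk : MemLp k 2 μ), l2Norm μ k = ‖hk.toLp k‖ := by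
    intro k hk
    rw [l2Norm, @norm_eq_sqrt_re_inner ℝ, L2.inner_def]
    congr 1
    simp only [RCLike.re_to_real]
    apply integral_congr_ae
    filter_upwards [hk.coeFn_toLp] with x h1
    rw [h1, real_inner_self_eq_norm_sq]
  rw [h1, h2 hf, h2 hg]
  exact abs_real_inner_le_norm _ _

theorem abs_integral_mul_le {μ : Measure Plane} {f g : Plane → ℝ} (hf : MemLp f 2 μ)
    (hg : MemLp g 2 μ) : |∫ x, f x * g x ∂μ| ≤ l2Norm μ f * l2Norm μ g := by
  have := abs_integral_inner_le hf hg
  simpa [mul_comm] using this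

theorem l2Norm_add_sq_le {μ : Measure Plane} {f g : Plane → ℝ} (hf : MemLp f 2 μ)
    (hg : MemLp g 2 μ) :
    l2Norm μ (fun x => f x + g x) ^ 2 ≤ 2 * (l2Norm μ f ^ 2 + l2Norm μ g ^ 2) := by
  simp only [l2Norm_sq]
  rw [← integral_add hf.norm.integrable_sq hg.norm.integrable_sq, ← integral_const_mul]
  apply integral_mono (hf.add hg).norm.integrable_sq
  · exact (hf.norm.integrable_sq.add hg.norm.integrable_sq).const_mul 2
  · intro x
    simp only [Real.norm_eq_abs, sq_abs, Pi.add_apply]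
    nlinarith [sq_nonneg (f x - g x)]

/-! ### Gradients of test functions -/

theorem inner_gradient (f : Plane → ℝ) (x v : Plane) :
    inner ℝ (gradient f x) v = fderiv ℝ f x v := by
  simp [gradient]

theorem continuous_gradient {f : Plane → ℝ} (hf : ContDiff ℝ 1 f) : Continuous (gradient f) :=
  (InnerProductSpace.toDual ℝ Plane).symm.continuous.comp (hf.continuous_fderiv one_ne_zero)

theorem gradient_eq_zero_of_notMem_tsupport {f : Plane → ℝ} {x : Plane} (hx : x ∉ tsupport f) :
    gradient f x = 0 := by
  have : fderiv ℝ f x = 0 := by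
    by_contra h
    exact hx (support_fderiv_subset ℝ h)
  simp [gradient, this]

theorem hasCompactSupport_gradient {f : Plane → ℝ} (hf : HasCompactSupport f) :
    HasCompactSupport (gradient f) :=
  HasCompactSupport.intro hf fun _ hx => gradient_eq_zero_of_notMem_tsupport hx

theorem gradient_mul {f g : Plane → ℝ} {x : Plane} (hf : DifferentiableAt ℝ f x)
    (hg : DifferentiableAt ℝ g x) :
    gradient (fun y => f y * g y) x = f x • gradient g x + g x • gradient f x := by
  refine ext_inner_right ℝ fun v => ?_
  rw [inner_gradient, inner_add_left, inner_smul_left, inner_smul_left, inner_gradient,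
    inner_gradient, fderiv_fun_mul hf hg]
  simp

/-- Integration by parts against the constant 1. -/
theorem integral_fderiv_eq_zero {w : Plane → ℝ} (hw : ContDiff ℝ 1 w) (hc : HasCompactSupport w)
    (v : Plane) : ∫ x, fderiv ℝ w x v = 0 := by
  have h0 : Integrable (fun x => fderiv ℝ w x v) :=
    ((hw.continuous_fderiv one_ne_zero).clm_apply continuous_const).integrable_of_hasCompactSupport
      (hc.fderiv_apply ℝ v)
  have := integral_mul_fderiv_eq_neg_fderiv_mul_of_integrable (μ := volume) (𝕜 := ℝ)
    (f := fun _ : Plane => (1 : ℝ)) (g := w) (v := v) (by simp) (by simpa using h0)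
    (by simpa using hw.continuous.integrable_of_hasCompactSupport hc)
    (fun _ _ => differentiableAt_const _) (fun _ _ => hw.differentiable one_ne_zero _)
  simpa using this

theorem integral_gradient_eq_zero {w : Plane → ℝ} (hw : ContDiff ℝ 1 w)
    (hc : HasCompactSupport w) : ∫ x, gradient w x = 0 := by
  refine ext_inner_right ℝ fun v => ?_
  have hi : Integrable (gradient w) :=
    (continuous_gradient hw).integrable_of_hasCompactSupport (hasCompactSupport_gradient hc)
  rw [real_inner_comm, ← integral_inner hi v, inner_zero_left, ← integral_fderiv_eq_zero hw hc v]
  exact integral_congr_ae (ae_of_all _ fun x => by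
    simp only [← inner_gradient, real_inner_comm])

/-- Integration by parts against a compactly supported function. -/
theorem integral_smul_gradient {p φ : Plane → ℝ} (hp : ContDiff ℝ 1 p) (hφ : ContDiff ℝ 1 φ)
    (hc : HasCompactSupport φ) :
    ∫ x, φ x • gradient p x = - ∫ x, p x • gradient φ x := by
  have h := integral_gradient_eq_zero (hφ.mul hp) (hc.mul_right (f' := p))
  have e : ∀ x, gradient (fun y => φ y * p y) x = φ x • gradient p x + p x • gradient φ x :=
    fun x => gradient_mul (hφ.differentiable one_ne_zero x) (hp.differentiable one_ne_zero x)
  change ∫ x, gradient (fun y => φ y * p y) x = 0 at h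
  simp_rw [e] at h
  rw [integral_add] at h
  · exact eq_neg_of_add_eq_zero_left h
  · exact (hφ.continuous.smul (continuous_gradient hp)).integrable_of_hasCompactSupport
      (hc.smul_right)
  · exact (hp.continuous.smul (continuous_gradient hφ)).integrable_of_hasCompactSupport
      ((hasCompactSupport_gradient hc).smul_left)

/-! ### Weak gradients -/

theorem integrable_restrict_smul_of_locallyIntegrableOn {F : Type*} [NormedAddCommGroup F]
    [NormedSpace ℝ F] {U : Set Plane} {G : Plane → F}
    (hG : LocallyIntegrableOn G U) {φ : Plane → ℝ} (hφ : Continuous φ)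
    (hc : HasCompactSupport φ) (hs : tsupport φ ⊆ U) :
    Integrable (fun x => φ x • G x) (volume.restrict U) := by
  have h := (hG.integrableOn_compact_subset hs hc).continuousOn_smul hφ.continuousOn hc
  have h2 : IntegrableOn (fun x => φ x • G x) univ :=
    h.of_forall_sdiff_eq_zero MeasurableSet.univ fun x hx => by
      simp [image_eq_zero_of_notMem_tsupport hx.2]
  exact h2.mono_set (subset_univ U)

/-- The difference of two weak gradients annihilates every test function, so the fundamental lemma
of the calculus of variations applies. This is what makes the choice in `weakGrad` harmless. -/
theorem HasWeakGradient.ae_eq {U : Set Plane} (hU : IsOpen U) {v : Plane → ℝ}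
    {G₁ G₂ : Plane → Plane} (h₁ : HasWeakGradient U v G₁) (h₂ : HasWeakGradient U v G₂) :
    G₁ =ᵐ[volume.restrict U] G₂ := by
  have h : ∀ᵐ x ∂(volume : Measure Plane), x ∈ U → (G₁ - G₂) x = 0 := by
    refine hU.ae_eq_zero_of_integral_contDiff_smul_eq_zero (h₁.2.1.sub h₂.2.1) ?_
    intro φ hφ hc hs
    have e : ∫ x, φ x • (G₁ - G₂) x = ∫ x in U, φ x • (G₁ - G₂) x := by
      rw [setIntegral_eq_integral_of_forall_compl_eq_zero]
      intro x hx
      rw [image_eq_zero_of_notMem_tsupport (fun h => hx (hs h)), zero_smul]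
    rw [e]
    simp_rw [Pi.sub_apply, smul_sub]
    rw [integral_sub (integrable_restrict_smul_of_locallyIntegrableOn h₁.2.1 hφ.continuous hc hs)
      (integrable_restrict_smul_of_locallyIntegrableOn h₂.2.1 hφ.continuous hc hs), h₁.2.2 φ ⟨hφ, hc, hs⟩,
      h₂.2.2 φ ⟨hφ, hc, hs⟩, sub_self]
  filter_upwards [ae_restrict_of_ae h, ae_restrict_mem hU.measurableSet] with x hx hxU
  exact sub_eq_zero.1 (hx hxU)

theorem hasWeakGradient_weakGrad {U : Set Plane} {v : Plane → ℝ}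
    (h : ∃ G, HasWeakGradient U v G) : HasWeakGradient U v (weakGrad U v) := by
  unfold weakGrad
  rw [dif_pos h]
  exact h.choose_spec

theorem MemH1.hasWeakGradient {U : Set Plane} {v : Plane → ℝ} (h : MemH1 U v) :
    HasWeakGradient U v (weakGrad U v) :=
  hasWeakGradient_weakGrad (h.2.imp fun _ hG => hG.1)

theorem MemH1.memLp_weakGrad {U : Set Plane} (hU : IsOpen U) {v : Plane → ℝ} (h : MemH1 U v) :
    MemLp (weakGrad U v) 2 (volume.restrict U) := by
  obtain ⟨G, hG, hL⟩ := h.2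
  exact (memLp_congr_ae (h.hasWeakGradient.ae_eq hU hG)).2 hL

theorem HasWeakGradient.sub {U : Set Plane} {u v : Plane → ℝ}
    {G H : Plane → Plane} (hu : HasWeakGradient U u G) (hv : HasWeakGradient U v H) :
    HasWeakGradient U (fun x => u x - v x) (fun x => G x - H x) := by
  refine ⟨hu.1.sub hv.1, hu.2.1.sub hv.2.1, fun φ hφ => ?_⟩
  have hi : ∀ {w : Plane → ℝ}, LocallyIntegrableOn w U →
      Integrable (fun x => w x • gradient φ x) (volume.restrict U) := by
    intro w hw
    have h := (hw.integrableOn_compact_subset hφ.2.2 hφ.2.1).smul_continuousOn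
      (continuous_gradient (hφ.1.of_le (by simp))).continuousOn hφ.2.1
    have h2 : IntegrableOn (fun x => w x • gradient φ x) univ :=
      h.of_forall_sdiff_eq_zero MeasurableSet.univ fun x hx => by
        simp [gradient_eq_zero_of_notMem_tsupport hx.2]
    exact h2.mono_set (subset_univ U)
  simp_rw [smul_sub, sub_smul]
  rw [integral_sub (integrable_restrict_smul_of_locallyIntegrableOn hu.2.1 hφ.1.continuous hφ.2.1 hφ.2.2)
      (integrable_restrict_smul_of_locallyIntegrableOn hv.2.1 hφ.1.continuous hφ.2.1 hφ.2.2),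
    integral_sub (hi hu.1) (hi hv.1), hu.2.2 φ hφ, hv.2.2 φ hφ]
  abel

theorem weakGrad_sub_ae {U : Set Plane} (hU : IsOpen U) {u v : Plane → ℝ} (hu : MemH1 U u)
    (hv : MemH1 U v) :
    weakGrad U (fun x => u x - v x) =ᵐ[volume.restrict U]
      fun x => weakGrad U u x - weakGrad U v x := by
  have h := hu.hasWeakGradient.sub hv.hasWeakGradient
  exact (hasWeakGradient_weakGrad ⟨_, h⟩).ae_eq hU h

/-- A test function on the smaller set is one on the larger set, and the integrals only see its
support. -/
theorem HasWeakGradient.restrict {Ω U : Set Plane} (hUΩ : U ⊆ Ω)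
    {v : Plane → ℝ} {G : Plane → Plane} (h : HasWeakGradient Ω v G) : HasWeakGradient U v G := by
  refine ⟨h.1.mono_set hUΩ, h.2.1.mono_set hUΩ, fun φ hφ => ?_⟩
  have h1 := h.2.2 φ ⟨hφ.1, hφ.2.1, hφ.2.2.trans hUΩ⟩
  have hz : ∀ x, x ∉ U → x ∉ tsupport φ := fun x hx h => hx (hφ.2.2 h)
  have e1 : ∀ {V : Set Plane}, U ⊆ V → ∫ x in V, φ x • G x = ∫ x, φ x • G x := fun hV =>
    setIntegral_eq_integral_of_forall_compl_eq_zero fun x hx => by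
      simp [image_eq_zero_of_notMem_tsupport (hz x fun h => hx (hV h))]
  have e2 : ∀ {V : Set Plane}, U ⊆ V →
      ∫ x in V, v x • gradient φ x = ∫ x, v x • gradient φ x := fun hV =>
    setIntegral_eq_integral_of_forall_compl_eq_zero fun x hx => by
      simp [gradient_eq_zero_of_notMem_tsupport (hz x fun h => hx (hV h))]
  rw [e1 subset_rfl, e2 subset_rfl]
  rwa [e1 hUΩ, e2 hUΩ] at h1

theorem hasWeakGradient_of_contDiff {U : Set Plane} (hU : IsOpen U) {v p : Plane → ℝ}
    (hp : ContDiff ℝ 1 p) (hv : EqOn v p U) : HasWeakGradient U v (gradient p) := by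
  refine ⟨?_, (continuous_gradient hp).locallyIntegrable.locallyIntegrableOn U, fun φ hφ => ?_⟩
  · exact (hp.continuous.continuousOn.congr hv).locallyIntegrableOn hU.measurableSet
  · have hz : ∀ x, x ∉ U → x ∉ tsupport φ := fun x hx h => hx (hφ.2.2 h)
    have e : ∫ x in U, v x • gradient φ x = ∫ x in U, p x • gradient φ x :=
      setIntegral_congr_fun hU.measurableSet fun x hx => by simp only [hv hx]
    rw [e, setIntegral_eq_integral_of_forall_compl_eq_zero,
      setIntegral_eq_integral_of_forall_compl_eq_zero,
      integral_smul_gradient hp (hφ.1.of_le (by simp)) hφ.2.1]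
    · intro x hx
      simp [gradient_eq_zero_of_notMem_tsupport (hz x hx)]
    · intro x hx
      simp [image_eq_zero_of_notMem_tsupport (hz x hx)]

/-- Weak gradients are local: they agree with classical gradients where these exist. -/
theorem weakGrad_ae_eq_gradient {Ω U : Set Plane} (hU : IsOpen U) (hUΩ : U ⊆ Ω)
    {v p : Plane → ℝ} (hv : MemH1 Ω v) (hp : ContDiff ℝ 1 p) (hvp : EqOn v p U) :
    weakGrad Ω v =ᵐ[volume.restrict U] gradient p :=
  (hv.hasWeakGradient.restrict hUΩ).ae_eq hU (hasWeakGradient_of_contDiff hU hp hvp)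

/-! ### Polynomial functions -/

theorem contDiff_polyEval (p : MvPolynomial (Fin 2) ℝ) {n : WithTop ℕ∞} :
    ContDiff ℝ n (polyEval p) := by
  induction p using MvPolynomial.induction_on with
  | C a =>
    have : polyEval (MvPolynomial.C a) = fun _ => a := by ext; simp [polyEval]
    rw [this]
    exact contDiff_const
  | add p q hp hq =>
    have : polyEval (p + q) = fun x => polyEval p x + polyEval q x := by ext; simp [polyEval]
    rw [this]
    exact hp.add hq
  | mul_X p i hp =>
    have : polyEval (p * MvPolynomial.X i) = fun x => polyEval p x * x i := by
      ext; simp [polyEval]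
    rw [this]
    exact hp.mul (by fun_prop)

theorem fderiv_polyEval (p : MvPolynomial (Fin 2) ℝ) (x v : Plane) :
    fderiv ℝ (polyEval p) x v = ∑ i, v i * polyEval (MvPolynomial.pderiv i p) x := by
  induction p using MvPolynomial.induction_on with
  | C a =>
    have : polyEval (MvPolynomial.C a) = fun _ => a := by ext; simp [polyEval]
    simp [this, polyEval]
  | add p q hp hq =>
    have : polyEval (p + q) = fun x => polyEval p x + polyEval q x := by ext; simp [polyEval]
    rw [this, fderiv_fun_add ((contDiff_polyEval p (n := 1)).differentiable one_ne_zero x)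
      ((contDiff_polyEval q (n := 1)).differentiable one_ne_zero x), add_apply, hp, hq]
    simp [polyEval]
    ring
  | mul_X p j hp =>
    have : polyEval (p * MvPolynomial.X j) = fun x => polyEval p x * x j := by
      ext; simp [polyEval]
    have hj : HasFDerivAt (fun x : Plane => x j) (EuclideanSpace.proj j : Plane →L[ℝ] ℝ) x :=
      (EuclideanSpace.proj j : Plane →L[ℝ] ℝ).hasFDerivAt
    rw [this, fderiv_fun_mul ((contDiff_polyEval p (n := 1)).differentiable one_ne_zero x)
      hj.differentiableAt, hj.fderiv]
    simp only [add_apply, smul_apply, hp, PiLp.proj_apply, smul_eq_mul, polyEval,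
      Derivation.leibniz, MvPolynomial.pderiv_X, Fin.sum_univ_two, map_add, map_mul,
      MvPolynomial.eval_X]
    fin_cases j <;> simp <;> ring

theorem totalDegree_pderiv_le (i : Fin 2) (p : MvPolynomial (Fin 2) ℝ) :
    (MvPolynomial.pderiv i p).totalDegree ≤ p.totalDegree := by
  conv_lhs => rw [p.as_sum, map_sum]
  refine MvPolynomial.totalDegree_finsetSum_le fun m hm => ?_
  rw [MvPolynomial.pderiv_monomial]
  refine (MvPolynomial.totalDegree_monomial_le _ _).trans (le_trans ?_
    (MvPolynomial.le_totalDegree hm))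
  rw [Finsupp.sum_fintype _ _ (by simp), Finsupp.sum_fintype _ _ (by simp)]
  exact Finset.sum_le_sum fun j _ => by simp

theorem polyEval_add (p q : MvPolynomial (Fin 2) ℝ) (x : Plane) :
    polyEval (p + q) x = polyEval p x + polyEval q x := by simp [polyEval]

/-- Directional derivatives of a polynomial are polynomials of no larger degree. -/
theorem exists_polyEval_eq_inner_gradient {k : ℕ} {p : MvPolynomial (Fin 2) ℝ}
    (hp : p.totalDegree ≤ k) (n : Plane) :
    ∃ q : MvPolynomial (Fin 2) ℝ, q.totalDegree ≤ k ∧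
      ∀ x, polyEval q x = inner ℝ n (gradient (polyEval p) x) := by
  refine ⟨∑ i, MvPolynomial.C (n i) * MvPolynomial.pderiv i p, ?_, fun x => ?_⟩
  · refine MvPolynomial.totalDegree_finsetSum_le fun i _ => ?_
    refine (MvPolynomial.totalDegree_mul _ _).trans ?_
    rw [MvPolynomial.totalDegree_C, zero_add]
    exact (totalDegree_pderiv_le i p).trans hp
  · rw [real_inner_comm, inner_gradient, fderiv_polyEval]
    simp [polyEval]

theorem laplacian_eq_sum_fderiv {f : Plane → ℝ} (hf : ContDiff ℝ 2 f)
    (b : OrthonormalBasis (Fin 2) ℝ Plane) (x : Plane) :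
    Laplacian.laplacian f x = ∑ i, fderiv ℝ (fun y => fderiv ℝ f y (b i)) x (b i) := by
  rw [InnerProductSpace.laplacian_eq_iteratedFDeriv_orthonormalBasis f b]
  refine Finset.sum_congr rfl fun i _ => ?_
  rw [iteratedFDeriv_two_apply, fderiv_clm_apply]
  · simp
  · exact (hf.fderiv_right (m := 1) (by norm_num)).differentiable one_ne_zero x
  · fun_prop

/-- The Laplacian of a polynomial is a polynomial of no larger degree. -/
theorem exists_polyEval_eq_laplacian {k : ℕ} {p : MvPolynomial (Fin 2) ℝ}
    (hp : p.totalDegree ≤ k) :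
    ∃ q : MvPolynomial (Fin 2) ℝ, q.totalDegree ≤ k ∧
      polyEval q = Laplacian.laplacian (polyEval p) := by
  refine ⟨∑ i, MvPolynomial.pderiv i (MvPolynomial.pderiv i p), ?_, ?_⟩
  · exact MvPolynomial.totalDegree_finsetSum_le fun i _ =>
      ((totalDegree_pderiv_le i _).trans (totalDegree_pderiv_le i p)).trans hp
  · ext x
    rw [laplacian_eq_sum_fderiv (contDiff_polyEval p) (EuclideanSpace.basisFun (Fin 2) ℝ)]
    have h : ∀ i, (fun y => fderiv ℝ (polyEval p) y (EuclideanSpace.basisFun (Fin 2) ℝ i)) =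
        polyEval (MvPolynomial.pderiv i p) := by
      intro i
      ext y
      rw [fderiv_polyEval]
      simp
    simp_rw [h, fderiv_polyEval]
    simp [polyEval]

/-- Substituting polynomials of degree at most one does not raise the degree. It moves a polynomial
from an arbitrary disc to the unit disc. -/
theorem exists_polyEval_comp {k : ℕ} {p : MvPolynomial (Fin 2) ℝ} (hp : p.totalDegree ≤ k)
    (c : Plane) (r : ℝ) : ∃ q : MvPolynomial (Fin 2) ℝ, q.totalDegree ≤ k ∧
      ∀ x, polyEval q x = polyEval p (c + r • x) := by
  refine ⟨MvPolynomial.aeval (fun i => MvPolynomial.C (c i) +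
    MvPolynomial.C r * MvPolynomial.X i) p, ?_, fun x => ?_⟩
  · rw [MvPolynomial.aeval_def, MvPolynomial.eval₂]
    refine (MvPolynomial.totalDegree_finsetSum_le fun d hd => ?_)
    refine (MvPolynomial.totalDegree_mul _ _).trans ?_
    rw [MvPolynomial.algebraMap_eq, MvPolynomial.totalDegree_C, zero_add]
    refine (MvPolynomial.totalDegree_finsetProd _ _).trans (le_trans ?_
      ((MvPolynomial.le_totalDegree hd).trans hp))
    refine Finset.sum_le_sum fun i _ => (MvPolynomial.totalDegree_pow _ _).trans ?_
    refine (Nat.mul_le_mul_left _ (?_ : _ ≤ 1)).trans (mul_one _).le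
    refine (MvPolynomial.totalDegree_add _ _).trans (max_le (by simp) ?_)
    refine (MvPolynomial.totalDegree_mul _ _).trans ?_
    simp
  · unfold polyEval
    rw [MvPolynomial.aeval_def, ← MvPolynomial.coe_eval₂Hom]
    have : (MvPolynomial.eval fun i => x i).comp (MvPolynomial.eval₂Hom
        (algebraMap ℝ (MvPolynomial (Fin 2) ℝ)) fun i => MvPolynomial.C (c i) +
          MvPolynomial.C r * MvPolynomial.X i) = MvPolynomial.eval fun i => (c + r • x) i := by
      apply MvPolynomial.ringHom_ext <;> simp
    exact congrArg (fun φ => φ p) this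

/-- The restriction of a polynomial to a line, as a polynomial in the parameter. -/
theorem exists_eval_eq_polyEval_line {k : ℕ} {p : MvPolynomial (Fin 2) ℝ}
    (hp : p.totalDegree ≤ k) (a w : Plane) : ∃ q : Polynomial ℝ, q.natDegree ≤ k ∧
      ∀ x : ℝ, q.eval x = polyEval p (a + x • w) := by
  refine ⟨MvPolynomial.aeval (fun i => Polynomial.C (a i) + Polynomial.X * Polynomial.C (w i)) p,
    ?_, fun x => ?_⟩
  · refine (MvPolynomial.aeval_natDegree_le p hp _ (n := 1) fun i => ?_).trans (mul_one k).le
    refine Polynomial.natDegree_add_le_of_degree_le (by simp) ?_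
    exact Polynomial.natDegree_mul_le.trans (by simp)
  · unfold polyEval
    rw [MvPolynomial.aeval_def, ← MvPolynomial.coe_eval₂Hom]
    have : (Polynomial.evalRingHom x).comp (MvPolynomial.eval₂Hom
        (algebraMap ℝ (Polynomial ℝ)) fun i => Polynomial.C (a i) +
          Polynomial.X * Polynomial.C (w i)) = MvPolynomial.eval fun i => (a + x • w) i := by
      apply MvPolynomial.ringHom_ext
      · simp
      · intro i
        simp [mul_comm x]
    exact congrArg (fun φ => φ p) this

/-! ### Comparison of quadratic functionals on finite-dimensional spaces -/

/-- On the compact unit sphere the quotient `Q₂ / Q₁` is continuous, hence bounded; homogeneity of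
degree two carries the bound to all vectors. The inverse inequalities for polynomials rest on this.
-/
theorem exists_le_mul_of_homogeneous {E : Type*} [NormedAddCommGroup E] [NormedSpace ℝ E]
    [FiniteDimensional ℝ E] {Q₁ Q₂ : E → ℝ} (h₁ : Continuous Q₁) (h₂ : Continuous Q₂)
    (s₁ : ∀ (c : ℝ) v, Q₁ (c • v) = c ^ 2 * Q₁ v) (s₂ : ∀ (c : ℝ) v, Q₂ (c • v) = c ^ 2 * Q₂ v)
    (hpos : ∀ v ≠ 0, 0 < Q₁ v) : ∃ C : ℝ, 0 < C ∧ ∀ v, Q₂ v ≤ C * Q₁ v := by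
  have hK : IsCompact (Metric.sphere (0 : E) 1) := isCompact_sphere 0 1
  have hc : ContinuousOn (fun v => Q₂ v / Q₁ v) (Metric.sphere (0 : E) 1) :=
    h₂.continuousOn.div h₁.continuousOn fun v hv =>
      (hpos v (ne_zero_of_mem_unit_sphere ⟨v, hv⟩)).ne'
  obtain ⟨B, hB⟩ := hK.bddAbove_image hc
  refine ⟨max B 1, by positivity, fun v => ?_⟩
  by_cases hv : v = 0
  · subst hv
    have e₁ := s₁ 0 0
    have e₂ := s₂ 0 0
    simp only [smul_zero, ne_eq, OfNat.ofNat_ne_zero, not_false_eq_true, zero_pow, zero_mul]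
      at e₁ e₂
    rw [e₁, e₂, mul_zero]
  · have hn : ‖v‖ ≠ 0 := norm_ne_zero_iff.2 hv
    set u := ‖v‖⁻¹ • v with hu
    have hus : u ∈ Metric.sphere (0 : E) 1 := by
      rw [mem_sphere_zero_iff_norm, hu, norm_smul, norm_inv, norm_norm, inv_mul_cancel₀ hn]
    have hvu : v = ‖v‖ • u := by rw [hu, smul_smul, mul_inv_cancel₀ hn, one_smul]
    have hle : Q₂ u ≤ max B 1 * Q₁ u := by
      have h := hB (mem_image_of_mem _ hus)
      have hp := hpos u (ne_zero_of_mem_unit_sphere ⟨u, hus⟩)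
      exact ((div_le_iff₀ hp).1 h).trans (mul_le_mul_of_nonneg_right (le_max_left _ _) hp.le)
    rw [hvu, s₁, s₂]
    nlinarith [sq_nonneg ‖v‖]

/-- In coordinates with respect to a basis both sides are continuous quadratic functionals on a
finite-dimensional space. The weight `w` will be a bump, so that the integral on the right is the
pairing of `S v` with the test function `w * S v`. -/
theorem exists_setIntegral_norm_sq_le {V X F : Type*} [AddCommGroup V] [Module ℝ V]
    [Module.Finite ℝ V] [TopologicalSpace X] [SecondCountableTopology X] [MeasurableSpace X]
    [OpensMeasurableSpace X] (μ : Measure X) [IsLocallyFiniteMeasure μ]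
    [NormedAddCommGroup F] [NormedSpace ℝ F] (S : V →ₗ[ℝ] X → ℝ) (T : V →ₗ[ℝ] X → F)
    (hS : ∀ v, Continuous (S v)) (hT : ∀ v, Continuous (T v)) {K₁ K₂ : Set X}
    (hK₁ : IsCompact K₁) (hK₂ : IsCompact K₂) {w : X → ℝ} (hw : Continuous w) (hw0 : ∀ x, 0 ≤ w x)
    (hpos : ∀ v, ∫ x in K₁, w x * S v x ^ 2 ∂μ = 0 → v = 0) :
    ∃ C : ℝ, 0 < C ∧ ∀ v, ∫ x in K₂, ‖T v x‖ ^ 2 ∂μ ≤ C * ∫ x in K₁, w x * S v x ^ 2 ∂μ := by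
  obtain ⟨n, ⟨b⟩⟩ : ∃ n, Nonempty (Module.Basis (Fin n) ℝ V) :=
    ⟨_, ⟨Module.finBasis ℝ V⟩⟩
  set e := b.equivFun.symm with he
  have hSe : ∀ c x, S (e c) x = ∑ i, c i * S (b i) x := by
    intro c x
    simp [he, Module.Basis.equivFun_symm_apply, map_sum, Finset.sum_apply]
  have hTe : ∀ c x, T (e c) x = ∑ i, c i • T (b i) x := by
    intro c x
    simp [he, Module.Basis.equivFun_symm_apply, map_sum, Finset.sum_apply]
  have hS' : Continuous fun z : (Fin n → ℝ) × X => S (e z.1) z.2 := by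
    simp_rw [hSe]
    exact continuous_finsetSum _ fun i _ =>
      ((continuous_apply i).comp continuous_fst).mul ((hS _).comp continuous_snd)
  have hT' : Continuous fun z : (Fin n → ℝ) × X => T (e z.1) z.2 := by
    simp_rw [hTe]
    exact continuous_finsetSum _ fun i _ =>
      ((continuous_apply i).comp continuous_fst).smul ((hT _).comp continuous_snd)
  obtain ⟨C, hC, h⟩ := exists_le_mul_of_homogeneous
    (Q₁ := fun c => ∫ x in K₁, w x * S (e c) x ^ 2 ∂μ)
    (Q₂ := fun c => ∫ x in K₂, ‖T (e c) x‖ ^ 2 ∂μ)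
    (continuous_parametric_integral_of_continuous
      ((hw.comp continuous_snd).mul (hS'.pow 2)) hK₁)
    (continuous_parametric_integral_of_continuous (hT'.norm.pow 2) hK₂)
    (fun c v => by
      simp only [map_smul, Pi.smul_apply, smul_eq_mul]
      rw [← integral_const_mul]
      congr 1
      ext x
      ring)
    (fun c v => by
      simp only [map_smul, Pi.smul_apply, norm_smul, mul_pow, Real.norm_eq_abs, sq_abs]
      rw [← integral_const_mul])
    (fun c hc => lt_of_le_of_ne
      (integral_nonneg fun x => mul_nonneg (hw0 x) (sq_nonneg _)) fun h0 =>
        hc (e.map_eq_zero_iff.1 (hpos _ h0.symm)))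
  refine ⟨C, hC, fun v => ?_⟩
  have := h (e.symm v)
  simpa only [LinearEquiv.apply_symm_apply] using this

/-! ### Orthonormal coordinates and integration by parts on a half-plane -/

theorem eq_add_orthonormal_coords (b : OrthonormalBasis (Fin 2) ℝ Plane) (a x : Plane) :
    x = a + inner ℝ (b 0) (x - a) • b 0 + inner ℝ (b 1) (x - a) • b 1 := by
  have h := b.sum_repr' (x - a)
  rw [Fin.sum_univ_two] at h
  rw [add_assoc, h]
  abel

/-- Cartesian coordinates with origin `a` and axes `b`. -/
def planeChart (a : Plane) (b : OrthonormalBasis (Fin 2) ℝ Plane) : ℝ × ℝ ≃ₜ Plane where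
  toFun z := a + z.1 • b 0 + z.2 • b 1
  invFun x := (inner ℝ (b 0) (x - a), inner ℝ (b 1) (x - a))
  left_inv z := by
    have h : a + z.1 • b 0 + z.2 • b 1 - a = z.1 • b 0 + z.2 • b 1 := by abel
    ext <;> simp [h, inner_add_right, inner_smul_right]
  right_inv x := (eq_add_orthonormal_coords b a x).symm
  continuous_toFun := by fun_prop
  continuous_invFun := by fun_prop

theorem planeChart_apply (a : Plane) (b : OrthonormalBasis (Fin 2) ℝ Plane) (z : ℝ × ℝ) :
    planeChart a b z = a + z.1 • b 0 + z.2 • b 1 := rfl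

theorem inner_planeChart_sub (a : Plane) (b : OrthonormalBasis (Fin 2) ℝ Plane) (z : ℝ × ℝ) :
    inner ℝ (b 0) (planeChart a b z - a) = z.1 ∧ inner ℝ (b 1) (planeChart a b z - a) = z.2 :=
  Prod.ext_iff.1 ((planeChart a b).left_inv z)

theorem measurePreserving_planeChart (a : Plane) (b : OrthonormalBasis (Fin 2) ℝ Plane) :
    MeasurePreserving (planeChart a b) volume volume := by
  have h := (measurePreserving_add_left (volume : Measure Plane) a).comp
    (b.measurePreserving_repr_symm.comp ((PiLp.volume_preserving_toLp (Fin 2)).comp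
      (volume_preserving_finTwoArrow ℝ).symm))
  convert h using 1
  ext1 z
  simp only [Function.comp_apply, planeChart_apply, add_assoc]
  congr 1
  have := b.sum_repr_symm (WithLp.toLp 2 ![z.1, z.2])
  rw [Fin.sum_univ_two] at this
  simpa using this

theorem integral_planeChart {E : Type*} [NormedAddCommGroup E] [NormedSpace ℝ E] (a : Plane)
    (b : OrthonormalBasis (Fin 2) ℝ Plane) (f : Plane → E) :
    ∫ z, f (planeChart a b z) = ∫ x, f x :=
  (measurePreserving_planeChart a b).integral_comp (planeChart a b).measurableEmbedding f

/-- The open half-plane through `a` with inner normal `n`. -/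
def halfPlane (a n : Plane) : Set Plane := {x | 0 < inner ℝ n (x - a)}

theorem isOpen_halfPlane (a n : Plane) : IsOpen (halfPlane a n) :=
  isOpen_lt continuous_const (by fun_prop)

theorem setIntegral_halfPlane {E : Type*} [NormedAddCommGroup E] [NormedSpace ℝ E] (a : Plane)
    (b : OrthonormalBasis (Fin 2) ℝ Plane) (f : Plane → E) :
    ∫ x in halfPlane a (b 1), f x = ∫ z in univ ×ˢ Ioi (0 : ℝ), f (planeChart a b z) := by
  rw [← (measurePreserving_planeChart a b).setIntegral_preimage_emb
    (planeChart a b).measurableEmbedding f]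
  congr 2
  ext z
  simp [halfPlane, (inner_planeChart_sub a b z).2]

theorem hasCompactSupport_comp_line {w : Plane → ℝ} (hc : HasCompactSupport w) (a : Plane)
    {n : Plane} (hn : ‖n‖ = 1) : HasCompactSupport fun x : ℝ => w (a + x • n) := by
  have h : Isometry fun x : ℝ => a + x • n := by
    refine Isometry.of_dist_eq fun x y => ?_
    rw [dist_add_left, dist_eq_norm, ← sub_smul, norm_smul, hn, mul_one, Real.dist_eq,
      Real.norm_eq_abs]
  exact hc.comp_isClosedEmbedding h.isClosedEmbedding

theorem hasDerivAt_comp_line {w : Plane → ℝ} (hw : ContDiff ℝ 1 w) (a n : Plane) (x : ℝ) :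
    HasDerivAt (fun x : ℝ => w (a + x • n)) (fderiv ℝ w (a + x • n) n) x := by
  have h1 : HasDerivAt (fun x : ℝ => a + x • n) n x := by
    simpa using ((hasDerivAt_id x).smul_const n).const_add a
  exact (hw.differentiable one_ne_zero _).hasFDerivAt.comp_hasDerivAt x h1

theorem contDiff_comp_line {w : Plane → ℝ} (hw : ContDiff ℝ 1 w) (a n : Plane) :
    ContDiff ℝ 1 fun x : ℝ => w (a + x • n) :=
  hw.comp (by fun_prop)

theorem integrable_fderiv {w : Plane → ℝ} (hw : ContDiff ℝ 1 w) (hc : HasCompactSupport w)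
    (v : Plane) : Integrable fun x => fderiv ℝ w x v :=
  ((hw.continuous_fderiv one_ne_zero).clm_apply continuous_const).integrable_of_hasCompactSupport
    (hc.fderiv_apply ℝ v)

theorem integrable_fderiv_comp_planeChart {w : Plane → ℝ} (hw : ContDiff ℝ 1 w)
    (hc : HasCompactSupport w) (a : Plane) (b : OrthonormalBasis (Fin 2) ℝ Plane) (v : Plane) :
    Integrable fun z => fderiv ℝ w (planeChart a b z) v := by
  exact ((measurePreserving_planeChart a b).integrable_comp_emb
    (planeChart a b).measurableEmbedding).2 (integrable_fderiv hw hc v)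

/-- Fubini with the normal variable innermost: each inner integral is evaluated by the fundamental
theorem of calculus on a half-line. -/
theorem setIntegral_halfPlane_fderiv_normal {w : Plane → ℝ} (hw : ContDiff ℝ 1 w)
    (hc : HasCompactSupport w) (a : Plane) (b : OrthonormalBasis (Fin 2) ℝ Plane) :
    ∫ x in halfPlane a (b 1), fderiv ℝ w x (b 1) = - ∫ x : ℝ, w (a + x • b 0) := by
  rw [setIntegral_halfPlane, Measure.volume_eq_prod,
    setIntegral_prod _ (integrable_fderiv_comp_planeChart hw hc a b (b 1)).integrableOn,
    Measure.restrict_univ, ← integral_neg]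
  refine integral_congr_ae (ae_of_all _ fun x => ?_)
  have h := (hasCompactSupport_comp_line hc (a + x • b 0) (b.norm_eq_one 1)).integral_Ioi_deriv_eq
    (contDiff_comp_line hw _ _) 0
  simp only [(hasDerivAt_comp_line hw (a + x • b 0) (b 1) _).deriv, zero_smul, add_zero] at h
  exact h

/-- Fubini in the other order: each inner integral is that of a derivative over a whole line, where
the function has compact support. -/
theorem setIntegral_halfPlane_fderiv_tangent {w : Plane → ℝ} (hw : ContDiff ℝ 1 w)
    (hc : HasCompactSupport w) (a : Plane) (b : OrthonormalBasis (Fin 2) ℝ Plane) :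
    ∫ x in halfPlane a (b 1), fderiv ℝ w x (b 0) = 0 := by
  have hi := (integrable_fderiv_comp_planeChart hw hc a b (b 0)).integrableOn
    (s := univ ×ˢ Ioi (0 : ℝ))
  rw [IntegrableOn, Measure.volume_eq_prod, ← Measure.prod_restrict] at hi
  rw [setIntegral_halfPlane, Measure.volume_eq_prod, ← Measure.prod_restrict,
    integral_prod_symm _ hi, Measure.restrict_univ]
  refine integral_eq_zero_of_ae (ae_of_all _ fun y => ?_)
  have hs := hasCompactSupport_comp_line hc (a + y • b 1) (b.norm_eq_one 0)
  have hd := hasDerivAt_comp_line hw (a + y • b 1) (b 0)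
  have hcd := contDiff_comp_line hw (a + y • b 1) (b 0)
  have h := integral_eq_zero_of_hasDerivAt_of_integrable hd
    (by
      have : deriv (fun x : ℝ => w (a + y • b 1 + x • b 0)) =
          fun x => fderiv ℝ w (a + y • b 1 + x • b 0) (b 0) := funext fun x => (hd x).deriv
      rw [← this]
      exact (hcd.continuous_deriv le_rfl).integrable_of_hasCompactSupport hs.deriv)
    (hcd.continuous.integrable_of_hasCompactSupport hs)
  rw [Pi.zero_apply, ← h]
  exact integral_congr_ae (ae_of_all _ fun x => by
    simp only [planeChart_apply, add_right_comm])

/-- The product rule div(v∇p) = ∇v · ∇p + vΔp, with the divergence written in the frame `b` so that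
it can be integrated one direction at a time. -/
theorem inner_gradient_eq_divergence_sub {p v : Plane → ℝ} (hp : ContDiff ℝ 2 p)
    (hv : ContDiff ℝ 1 v) (b : OrthonormalBasis (Fin 2) ℝ Plane) (x : Plane) :
    inner ℝ (gradient p x) (gradient v x) =
      fderiv ℝ (fun y => v y * fderiv ℝ p y (b 0)) x (b 0) +
        fderiv ℝ (fun y => v y * fderiv ℝ p y (b 1)) x (b 1) - v x * Laplacian.laplacian p x := by
  have hWf : ∀ i, fderiv ℝ (fun y => v y * fderiv ℝ p y (b i)) x (b i) =
      v x * fderiv ℝ (fun y => fderiv ℝ p y (b i)) x (b i) +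
        fderiv ℝ p x (b i) * fderiv ℝ v x (b i) := by
    intro i
    rw [fderiv_fun_mul (hv.differentiable one_ne_zero x)
      (((hp.fderiv_right (m := 1) (by norm_num)).clm_apply contDiff_const).differentiable
        one_ne_zero x)]
    simp
  rw [hWf, hWf, laplacian_eq_sum_fderiv hp b x, ← b.sum_inner_mul_inner, Fin.sum_univ_two,
    Fin.sum_univ_two, real_inner_comm (gradient v x) (b 0), real_inner_comm (gradient v x) (b 1)]
  simp only [inner_gradient]
  ring

theorem continuous_laplacian {p : Plane → ℝ} (hp : ContDiff ℝ 2 p) :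
    Continuous (Laplacian.laplacian p) := by
  have : Laplacian.laplacian p = fun x => ∑ i, fderiv ℝ (fun y => fderiv ℝ p y
      (EuclideanSpace.basisFun (Fin 2) ℝ i)) x (EuclideanSpace.basisFun (Fin 2) ℝ i) :=
    funext (laplacian_eq_sum_fderiv hp _)
  rw [this]
  exact continuous_finsetSum _ fun i _ =>
    (((hp.fderiv_right (m := 1) (by norm_num)).clm_apply contDiff_const).continuous_fderiv
      one_ne_zero).clm_apply continuous_const

/-- Green's formula on a half-plane. -/
theorem setIntegral_halfPlane_inner_gradient {p v : Plane → ℝ} (hp : ContDiff ℝ 2 p)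
    (hv : ContDiff ℝ 1 v) (hc : HasCompactSupport v) (a : Plane)
    (b : OrthonormalBasis (Fin 2) ℝ Plane) :
    ∫ x in halfPlane a (b 1), inner ℝ (gradient p x) (gradient v x) =
      - (∫ x in halfPlane a (b 1), v x * Laplacian.laplacian p x) -
        ∫ x : ℝ, v (a + x • b 0) * inner ℝ (b 1) (gradient p (a + x • b 0)) := by
  have hWd : ∀ i, ContDiff ℝ 1 fun y => v y * fderiv ℝ p y (b i) := fun i =>
    hv.mul ((hp.fderiv_right (m := 1) (by norm_num)).clm_apply contDiff_const)
  have hWc : ∀ i, HasCompactSupport fun y => v y * fderiv ℝ p y (b i) := fun i => hc.mul_right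
  have hi := fun i => (integrable_fderiv (hWd i) (hWc i) (b i)).integrableOn
    (s := halfPlane a (b 1))
  have hvL : Integrable (fun x => v x * Laplacian.laplacian p x) :=
    (hv.continuous.mul (continuous_laplacian hp)).integrable_of_hasCompactSupport hc.mul_right
  simp_rw [inner_gradient_eq_divergence_sub hp hv b]
  rw [integral_sub _ hvL.integrableOn, integral_add (hi 0) (hi 1),
    setIntegral_halfPlane_fderiv_tangent (hWd 0) (hWc 0),
    setIntegral_halfPlane_fderiv_normal (hWd 1) (hWc 1)]
  · simp only [real_inner_comm (gradient p _), inner_gradient]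
    ring
  · exact (hi 0).add (hi 1)

/-- Green's formula on the whole plane. -/
theorem integral_inner_gradient {p v : Plane → ℝ} (hp : ContDiff ℝ 2 p)
    (hv : ContDiff ℝ 1 v) (hc : HasCompactSupport v) :
    ∫ x, inner ℝ (gradient p x) (gradient v x) = - ∫ x, v x * Laplacian.laplacian p x := by
  set b := EuclideanSpace.basisFun (Fin 2) ℝ
  have hWd : ∀ i, ContDiff ℝ 1 fun y => v y * fderiv ℝ p y (b i) := fun i =>
    hv.mul ((hp.fderiv_right (m := 1) (by norm_num)).clm_apply contDiff_const)
  have hWc : ∀ i, HasCompactSupport fun y => v y * fderiv ℝ p y (b i) := fun i => hc.mul_right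
  have hi := fun i => integrable_fderiv (hWd i) (hWc i) (b i)
  have hvL : Integrable (fun x => v x * Laplacian.laplacian p x) :=
    (hv.continuous.mul (continuous_laplacian hp)).integrable_of_hasCompactSupport hc.mul_right
  simp_rw [inner_gradient_eq_divergence_sub hp hv b]
  rw [integral_sub _ hvL, integral_add (hi 0) (hi 1), integral_fderiv_eq_zero (hWd 0) (hWc 0),
    integral_fderiv_eq_zero (hWd 1) (hWc 1)]
  · ring
  · exact (hi 0).add (hi 1)

/-! ### Test functions adapted to a triangle and to an edge -/

/-- A nonnegative continuous integrand with zero integral vanishes everywhere, and the bump is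
positive on its open ball. This gives the definiteness required by `exists_setIntegral_norm_sq_le`.
-/
theorem eq_zero_of_setIntegral_bump_eq_zero {X : Type*} [NormedAddCommGroup X] [NormedSpace ℝ X]
    [HasContDiffBump X] [MeasurableSpace X] [BorelSpace X] [FiniteDimensional ℝ X] (μ : Measure X)
    [μ.IsOpenPosMeasure] [IsLocallyFiniteMeasure μ] {c : X} (ψ : ContDiffBump c) {K : Set X}
    (hψ : tsupport ψ ⊆ K) {f : X → ℝ} (hf : Continuous f)
    (h : ∫ x in K, ψ x * f x ^ 2 ∂μ = 0) : ∀ x ∈ Metric.ball c ψ.rOut, f x = 0 := by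
  have hc : Continuous fun x => ψ x * f x ^ 2 := ψ.continuous.mul (hf.pow 2)
  have hs : HasCompactSupport fun x => ψ x * f x ^ 2 := ψ.hasCompactSupport.mul_right
  rw [setIntegral_eq_integral_of_forall_compl_eq_zero] at h
  · have h0 := (hc.ae_eq_iff_eq μ continuous_zero).1 ((integral_eq_zero_iff_of_nonneg
      (fun x => mul_nonneg ψ.nonneg (sq_nonneg _)) (hc.integrable_of_hasCompactSupport hs)).1 h)
    intro x hx
    have h1 : ψ x * f x ^ 2 = 0 := congrFun h0 x
    rcases mul_eq_zero.1 h1 with h2 | h2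
    · exact absurd h2 (ψ.pos_of_mem_ball hx).ne'
    · exact pow_eq_zero_iff two_ne_zero |>.1 h2
  · intro x hx
    rw [image_eq_zero_of_notMem_tsupport fun h => hx (hψ h), zero_mul]

/-- The ball contains an open square, and a polynomial vanishing on a product of infinite sets is
zero. -/
theorem eq_zero_of_polyEval_eq_zero_on_ball {p : MvPolynomial (Fin 2) ℝ} {c : Plane} {r : ℝ}
    (hr : 0 < r) (h : ∀ x ∈ Metric.ball c r, polyEval p x = 0) : p = 0 := by
  refine MvPolynomial.funext_set (fun i => Metric.ball (c i) (r / 2))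
    (fun i => ?_) fun x hx => ?_
  · rw [Real.ball_eq_Ioo]
    exact Ioo_infinite (by linarith)
  · rw [map_zero]
    refine h (WithLp.toLp 2 x) ?_
    rw [Metric.mem_ball, EuclideanSpace.dist_eq, Real.sqrt_lt' hr, Fin.sum_univ_two]
    have h0 : dist (x 0) (c 0) < r / 2 := hx 0 trivial
    have h1 : dist (x 1) (c 1) < r / 2 := hx 1 trivial
    have := dist_nonneg (x := x 0) (y := c 0)
    have := dist_nonneg (x := x 1) (y := c 1)
    simp only
    nlinarith

/-- The evaluation of polynomials of degree at most `k`, as a linear map. -/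
def polyEvalLinear (k : ℕ) :
    MvPolynomial.restrictTotalDegree (Fin 2) ℝ k →ₗ[ℝ] Plane → ℝ where
  toFun p := polyEval p
  map_add' p q := by ext; simp [polyEval]
  map_smul' c p := by ext; simp [polyEval]

/-- A fixed smooth bump function supported in the ball of radius `1 / 2`. -/
def planeBump : ContDiffBump (0 : Plane) := ⟨1 / 4, 1 / 2, by norm_num, by norm_num⟩

theorem tsupport_planeBump : tsupport planeBump = Metric.closedBall 0 (1 / 2) :=
  planeBump.tsupport_eq

/-- Multiplication by the bump function, followed by the gradient. -/
def bumpGradLinear (k : ℕ) :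
    MvPolynomial.restrictTotalDegree (Fin 2) ℝ k →ₗ[ℝ] Plane → Plane where
  toFun p := gradient fun x => planeBump x * polyEval p x
  map_add' p q := by
    have hd : ∀ p : MvPolynomial (Fin 2) ℝ,
        Differentiable ℝ fun x => planeBump x * polyEval p x := fun p =>
      (planeBump.contDiff (n := 1) |>.mul (contDiff_polyEval p)).differentiable one_ne_zero
    ext1 x
    refine ext_inner_right ℝ fun v => ?_
    rw [Pi.add_apply, inner_add_left]
    simp only [inner_gradient]
    rw [← add_apply, ← fderiv_fun_add (hd _ x) (hd _ x)]
    simp [polyEval, mul_add]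
  map_smul' c p := by
    have hd : Differentiable ℝ fun x => planeBump x * polyEval p x :=
      (planeBump.contDiff (n := 1) |>.mul (contDiff_polyEval p)).differentiable one_ne_zero
    ext1 x
    refine ext_inner_right ℝ fun v => ?_
    rw [Pi.smul_apply, inner_smul_left]
    simp only [inner_gradient]
    rw [RingHom.id_apply, conj_trivial, ← smul_eq_mul, ← smul_apply, ← fderiv_const_smul (hd x) c]
    simp [polyEval, mul_left_comm, Pi.smul_def]

/-- The reference inequalities on the unit disc. A polynomial is determined by its values near the
centre, so the bump-weighted integral controls it on a ball of any fixed radius `R`. -/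
theorem exists_bump_polyEval_bound (k : ℕ) (R : ℝ) : ∃ C : ℝ, 0 < C ∧
    ∀ q : MvPolynomial (Fin 2) ℝ, q.totalDegree ≤ k →
      ∫ x in Metric.closedBall (0 : Plane) R, polyEval q x ^ 2 ≤
          C * ∫ x, planeBump x * polyEval q x ^ 2 ∧
        ∫ x, ‖gradient (fun y => planeBump y * polyEval q y) x‖ ^ 2 ≤
          C * ∫ x, planeBump x * polyEval q x ^ 2 := by
  have hK := isCompact_closedBall (0 : Plane) (1 / 2)
  have hS : ∀ p, Continuous (polyEvalLinear k p) := fun p =>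
    (contDiff_polyEval (p : MvPolynomial (Fin 2) ℝ) (n := 0)).continuous
  have hT : ∀ p, Continuous (bumpGradLinear k p) := fun p =>
    continuous_gradient (planeBump.contDiff.mul (contDiff_polyEval _))
  have hpos : ∀ p, ∫ x in Metric.closedBall (0 : Plane) (1 / 2),
      planeBump x * polyEvalLinear k p x ^ 2 = 0 → p = 0 := by
    intro p hp
    have := eq_zero_of_setIntegral_bump_eq_zero volume planeBump
      tsupport_planeBump.subset (hS p) hp
    exact Subtype.ext (eq_zero_of_polyEval_eq_zero_on_ball planeBump.rOut_pos this)
  obtain ⟨C₁, hC₁, h₁⟩ := exists_setIntegral_norm_sq_le volume (polyEvalLinear k)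
    (polyEvalLinear k) hS hS hK (isCompact_closedBall (0 : Plane) R) planeBump.continuous
    (fun _ => planeBump.nonneg) hpos
  obtain ⟨C₂, hC₂, h₂⟩ := exists_setIntegral_norm_sq_le volume (polyEvalLinear k)
    (bumpGradLinear k) hS hT hK hK planeBump.continuous (fun _ => planeBump.nonneg) hpos
  refine ⟨max C₁ C₂, lt_max_of_lt_left hC₁, fun q hq => ?_⟩
  set v : MvPolynomial.restrictTotalDegree (Fin 2) ℝ k :=
    ⟨q, (MvPolynomial.mem_restrictTotalDegree _ _ _).2 hq⟩ with hv
  have e1 : ∫ x in Metric.closedBall (0 : Plane) (1 / 2), planeBump x * polyEvalLinear k v x ^ 2 =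
      ∫ x, planeBump x * polyEval q x ^ 2 := by
    refine setIntegral_eq_integral_of_forall_compl_eq_zero fun x hx => ?_
    rw [← tsupport_planeBump] at hx
    rw [image_eq_zero_of_notMem_tsupport hx, zero_mul]
  have e2 : ∫ x in Metric.closedBall (0 : Plane) (1 / 2), ‖bumpGradLinear k v x‖ ^ 2 =
      ∫ x, ‖gradient (fun y => planeBump y * polyEval q y) x‖ ^ 2 := by
    refine setIntegral_eq_integral_of_forall_compl_eq_zero fun x hx => ?_
    rw [← tsupport_planeBump] at hx
    have : bumpGradLinear k v x = 0 :=
      gradient_eq_zero_of_notMem_tsupport fun h => hx (tsupport_mul_subset_left h)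
    simp [this]
  have hM : 0 ≤ ∫ x, planeBump x * polyEval q x ^ 2 :=
    integral_nonneg fun x => mul_nonneg planeBump.nonneg (sq_nonneg _)
  have h1 := h₁ v
  have h2 := h₂ v
  rw [e1] at h1
  rw [e1, e2] at h2
  constructor
  · refine le_trans (le_of_eq ?_) (h1.trans (mul_le_mul_of_nonneg_right (le_max_left _ _) hM))
    simp only [Real.norm_eq_abs, sq_abs]
    rfl
  · exact h2.trans (mul_le_mul_of_nonneg_right (le_max_right _ _) hM)

theorem integral_add_smul {E : Type*} [NormedAddCommGroup E] [NormedSpace ℝ E] (f : Plane → E)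
    (c : Plane) {r : ℝ} (hr : 0 < r) : ∫ x, f x = r ^ 2 • ∫ y, f (c + r • y) := by
  rw [Measure.integral_comp_smul volume (fun y => f (c + y)), integral_add_left_eq_self f c,
    finrank_euclideanSpace_fin, abs_of_pos (by positivity), smul_smul,
    mul_inv_cancel₀ (by positivity), one_smul]

theorem gradient_comp_affine {f : Plane → ℝ} (hf : Differentiable ℝ f) (c : Plane) (s : ℝ)
    (x : Plane) : gradient (fun y => f (s • (y - c))) x = s • gradient f (s • (x - c)) := by
  refine ext_inner_right ℝ fun v => ?_
  rw [inner_smul_left, inner_gradient, inner_gradient]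
  have h1 : HasFDerivAt (fun y : Plane => s • (y - c)) (s • ContinuousLinearMap.id ℝ Plane) x :=
    ((hasFDerivAt_id x).sub_const c).const_smul s
  have h2 := ((hf _).hasFDerivAt.comp x h1).fderiv
  rw [Function.comp_def] at h2
  rw [h2]
  simp

/-- For every polynomial `q` and every disc there is a test function supported in the disc which is
dual to `q`. -/
theorem exists_testFunction_disc (k : ℕ) (R : ℝ) : ∃ C : ℝ, 0 < C ∧
    ∀ q : MvPolynomial (Fin 2) ℝ, q.totalDegree ≤ k → ∀ (c : Plane) (r : ℝ), 0 < r →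
      ∃ v : Plane → ℝ, ContDiff ℝ ∞ v ∧ HasCompactSupport v ∧ tsupport v ⊆ Metric.ball c r ∧
        ∫ x in Metric.closedBall c (R * r), polyEval q x ^ 2 ≤ C * ∫ x, v x * polyEval q x ∧
        r ^ 2 * ∫ x, ‖gradient v x‖ ^ 2 ≤ C * ∫ x, v x * polyEval q x := by
  obtain ⟨C, hC, h⟩ := exists_bump_polyEval_bound k R
  refine ⟨C, hC, fun q hq c r hr => ?_⟩
  obtain ⟨q', hq', hqq⟩ := exists_polyEval_comp hq c r
  obtain ⟨h1, h2⟩ := h q' hq'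
  set V : Plane → ℝ := fun y => planeBump y * polyEval q' y with hV
  have hVd : ContDiff ℝ ∞ V := planeBump.contDiff.mul (contDiff_polyEval q')
  have hVz : ∀ y, y ∉ Metric.closedBall (0 : Plane) (1 / 2) → V y = 0 := fun y hy => by
    rw [← tsupport_planeBump] at hy
    rw [hV]
    simp [image_eq_zero_of_notMem_tsupport hy]
  have hsub : ∀ y : Plane, r⁻¹ • (c + r • y - c) = y := fun y => by
    rw [add_sub_cancel_left, smul_smul, inv_mul_cancel₀ hr.ne', one_smul]
  have hts : tsupport (fun x => V (r⁻¹ • (x - c))) ⊆ Metric.closedBall c (r / 2) := by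
    refine closure_minimal (fun x hx => ?_) Metric.isClosed_closedBall
    by_contra hx'
    refine hx (hVz _ fun hb => hx' ?_)
    rw [mem_closedBall_zero_iff, norm_smul, norm_inv, Real.norm_of_nonneg hr.le,
      inv_mul_le_iff₀ hr] at hb
    rw [mem_closedBall_iff_norm]
    linarith
  have eM : ∫ x, V (r⁻¹ • (x - c)) * polyEval q x =
      r ^ 2 * ∫ y, planeBump y * polyEval q' y ^ 2 := by
    rw [integral_add_smul _ c hr, smul_eq_mul]
    simp_rw [hsub, ← hqq, hV]
    congr 2
    ext y
    ring
  refine ⟨fun x => V (r⁻¹ • (x - c)), hVd.comp (by fun_prop), ?_, ?_, ?_, ?_⟩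
  · exact (isCompact_closedBall c (r / 2)).of_isClosed_subset (isClosed_tsupport _) hts
  · exact hts.trans (Metric.closedBall_subset_ball (by linarith))
  · rw [eM, mul_left_comm, ← integral_indicator Metric.isClosed_closedBall.measurableSet,
      integral_add_smul _ c hr, smul_eq_mul]
    refine mul_le_mul_of_nonneg_left (le_trans (le_of_eq ?_) h1) (by positivity)
    rw [← integral_indicator Metric.isClosed_closedBall.measurableSet]
    congr 1
    ext y
    have : c + r • y ∈ Metric.closedBall c (R * r) ↔ y ∈ Metric.closedBall (0 : Plane) R := by
      rw [mem_closedBall_iff_norm, add_sub_cancel_left, norm_smul, Real.norm_of_nonneg hr.le,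
        mem_closedBall_zero_iff, mul_comm, mul_le_mul_iff_left₀ hr]
    by_cases hy : y ∈ Metric.closedBall (0 : Plane) R
    · simp only [indicator, if_pos hy, if_pos (this.2 hy), hqq]
    · simp only [indicator, if_neg hy, if_neg fun h => hy (this.1 h)]
  · rw [eM, mul_left_comm]
    refine mul_le_mul_of_nonneg_left (le_trans (le_of_eq ?_) h2) (by positivity)
    rw [integral_add_smul _ c hr, smul_eq_mul, ← integral_const_mul]
    congr 1
    ext y
    rw [gradient_comp_affine (hVd.differentiable (by simp)), hsub, norm_smul, norm_inv,
      Real.norm_of_nonneg hr.le]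
    field_simp

/-- A fixed smooth bump function supported in `[1/4, 3/4]`. -/
def lineBump : ContDiffBump (1 / 2 : ℝ) := ⟨1 / 8, 1 / 4, by norm_num, by norm_num⟩

theorem tsupport_lineBump : tsupport lineBump = Icc (1 / 4) (3 / 4) := by
  rw [lineBump.tsupport_eq, Real.closedBall_eq_Icc]
  norm_num [lineBump]

/-- The evaluation of univariate polynomials of degree at most `k`, as a linear map. -/
def evalLinear (k : ℕ) : Polynomial.degreeLE ℝ (k : WithBot ℕ) →ₗ[ℝ] ℝ → ℝ where
  toFun p x := (p : Polynomial ℝ).eval x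
  map_add' p q := by ext; simp
  map_smul' c p := by ext; simp

/-- Multiplication by the bump function. -/
def bumpMulLinear (k : ℕ) : Polynomial.degreeLE ℝ (k : WithBot ℕ) →ₗ[ℝ] ℝ → ℝ where
  toFun p x := lineBump x * (p : Polynomial ℝ).eval x
  map_add' p q := by ext; simp [mul_add]
  map_smul' c p := by ext; simp [mul_left_comm]

theorem contDiff_bumpMul (p : Polynomial ℝ) {n : ℕ∞} :
    ContDiff ℝ n fun x => lineBump x * p.eval x :=
  by
  simpa using lineBump.contDiff.mul (p.contDiff_aeval n)

/-- Multiplication by the bump function, followed by the derivative. -/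
def bumpDerivLinear (k : ℕ) : Polynomial.degreeLE ℝ (k : WithBot ℕ) →ₗ[ℝ] ℝ → ℝ where
  toFun p := deriv fun x => lineBump x * (p : Polynomial ℝ).eval x
  map_add' p q := by
    ext x
    have hd := fun p : Polynomial ℝ =>
      (contDiff_bumpMul p (n := 1)).differentiable one_ne_zero x
    rw [Pi.add_apply, ← deriv_fun_add (hd _) (hd _)]
    simp [mul_add]
  map_smul' c p := by
    ext x
    have hd := (contDiff_bumpMul (p : Polynomial ℝ) (n := 1)).differentiable one_ne_zero x
    rw [Pi.smul_apply, RingHom.id_apply, smul_eq_mul, ← deriv_const_mul c hd]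
    simp [mul_left_comm]

/-- For every polynomial `q` there is a test function on the unit interval dual to `q`. -/
theorem exists_testFunction_interval (k : ℕ) : ∃ C : ℝ, 0 < C ∧
    ∀ q : Polynomial ℝ, q.natDegree ≤ k →
      ∃ A : ℝ → ℝ, ContDiff ℝ ∞ A ∧ tsupport A ⊆ Icc (1 / 4) (3 / 4) ∧
        ∫ x in Icc (0 : ℝ) 1, q.eval x ^ 2 ≤ C * ∫ x, A x * q.eval x ∧
        ∫ x, A x ^ 2 ≤ C * ∫ x, A x * q.eval x ∧
        ∫ x, deriv A x ^ 2 ≤ C * ∫ x, A x * q.eval x := by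
  have hK := isCompact_Icc (a := (1 / 4 : ℝ)) (b := 3 / 4)
  have : Module.Finite ℝ (Polynomial.degreeLE ℝ (k : WithBot ℕ)) := by
    rw [← Polynomial.degreeLT_succ_eq_degreeLE]
    infer_instance
  have hS : ∀ p, Continuous (evalLinear k p) := fun p => (p : Polynomial ℝ).continuous
  have hT : ∀ p, Continuous (bumpMulLinear k p) := fun p =>
    (contDiff_bumpMul (p : Polynomial ℝ) (n := 0)).continuous
  have hT' : ∀ p, Continuous (bumpDerivLinear k p) := fun p =>
    (contDiff_bumpMul (p : Polynomial ℝ) (n := 1)).continuous_deriv le_rfl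
  have hpos : ∀ p, ∫ x in Icc (1 / 4 : ℝ) (3 / 4), lineBump x * evalLinear k p x ^ 2 = 0 →
      p = 0 := by
    intro p hp
    have h := eq_zero_of_setIntegral_bump_eq_zero volume lineBump
      tsupport_lineBump.subset (hS p) hp
    refine Subtype.ext (Polynomial.eq_zero_of_infinite_isRoot _ (Set.Infinite.mono h ?_))
    rw [Real.ball_eq_Ioo]
    exact Ioo_infinite (by linarith [lineBump.rOut_pos])
  have est := fun T hT K hK' => exists_setIntegral_norm_sq_le volume (evalLinear k) (F := ℝ) T hS hT
    hK (K₂ := K) hK' lineBump.continuous (fun _ => lineBump.nonneg) hpos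
  obtain ⟨C₁, hC₁, h₁⟩ := est _ hS (Icc 0 1) isCompact_Icc
  obtain ⟨C₂, hC₂, h₂⟩ := est _ hT _ hK
  obtain ⟨C₃, hC₃, h₃⟩ := est _ hT' _ hK
  refine ⟨max C₁ (max C₂ C₃), lt_max_of_lt_left hC₁, fun q hq => ?_⟩
  set v : Polynomial.degreeLE ℝ (k : WithBot ℕ) :=
    ⟨q, Polynomial.mem_degreeLE.2 (Polynomial.natDegree_le_iff_degree_le.1 hq)⟩
  have hA : ∀ x, x ∉ Icc (1 / 4 : ℝ) (3 / 4) → x ∉ tsupport lineBump := fun x hx => by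
    rwa [tsupport_lineBump]
  have hM : ∫ x in Icc (1 / 4 : ℝ) (3 / 4), lineBump x * evalLinear k v x ^ 2 =
      ∫ x, lineBump x * q.eval x * q.eval x := by
    rw [setIntegral_eq_integral_of_forall_compl_eq_zero fun x hx => by
      rw [image_eq_zero_of_notMem_tsupport (hA x hx), zero_mul]]
    exact integral_congr_ae (ae_of_all _ fun x => by
      change lineBump x * q.eval x ^ 2 = lineBump x * q.eval x * q.eval x
      ring)
  have hM0 : 0 ≤ ∫ x, lineBump x * q.eval x * q.eval x := by
    rw [← hM]
    exact integral_nonneg fun x => mul_nonneg lineBump.nonneg (sq_nonneg _)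
  have h₁ := h₁ v
  have h₂ := h₂ v
  have h₃ := h₃ v
  simp only [Real.norm_eq_abs, sq_abs] at h₁ h₂ h₃
  rw [hM] at h₁ h₂ h₃
  refine ⟨fun x => lineBump x * q.eval x, contDiff_bumpMul q, ?_, ?_, ?_, ?_⟩
  · exact tsupport_mul_subset_left.trans tsupport_lineBump.subset
  · exact h₁.trans (mul_le_mul_of_nonneg_right (le_max_left _ _) hM0)
  · refine le_trans (le_of_eq ?_) (h₂.trans (mul_le_mul_of_nonneg_right
      ((le_max_left _ _).trans (le_max_right _ _)) hM0))
    refine (setIntegral_eq_integral_of_forall_compl_eq_zero fun x hx => ?_).symm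
    change (lineBump x * q.eval x) ^ 2 = 0
    rw [image_eq_zero_of_notMem_tsupport (hA x hx), zero_mul, zero_pow two_ne_zero]
  · refine le_trans (le_of_eq ?_) (h₃.trans (mul_le_mul_of_nonneg_right
      ((le_max_right _ _).trans (le_max_right _ _)) hM0))
    refine (setIntegral_eq_integral_of_forall_compl_eq_zero fun x hx => ?_).symm
    change deriv (fun x => lineBump x * q.eval x) x ^ 2 = 0
    have : x ∉ tsupport (deriv fun x => lineBump x * q.eval x) := fun h =>
      hA x hx (tsupport_mul_subset_left (tsupport_deriv_subset h))
    rw [image_eq_zero_of_notMem_tsupport this, zero_pow two_ne_zero]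

theorem integral_planeChart_smul {E : Type*} [NormedAddCommGroup E] [NormedSpace ℝ E] (f : Plane → E)
    (a : Plane) (b : OrthonormalBasis (Fin 2) ℝ Plane) {h : ℝ} (hh : 0 < h) :
    ∫ x, f x = h ^ 2 • ∫ z, f (planeChart a b (h • z)) := by
  rw [Measure.integral_comp_smul volume (fun z => f (planeChart a b z)), integral_planeChart,
    Module.finrank_prod, Module.finrank_self, abs_of_pos (by positivity), smul_smul,
    mul_inv_cancel₀ (by positivity), one_smul]

theorem integrable_sq_of_hasCompactSupport {f : ℝ → ℝ} (hf : Continuous f)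
    (hc : HasCompactSupport f) : Integrable fun x => f x ^ 2 :=
  (hf.pow 2).integrable_of_hasCompactSupport <|
    HasCompactSupport.intro hc fun x hx => by simp [image_eq_zero_of_notMem_tsupport hx]

/-- For every polynomial `q` on the segment from `a` to `a + h • b 0`, there is a test function
supported near the middle half of the segment which is dual to `q`. -/
theorem exists_testFunction_segment (k : ℕ) {δ : ℝ} (hδ : 0 < δ) : ∃ C : ℝ, 0 < C ∧
    ∀ q : Polynomial ℝ, q.natDegree ≤ k → ∀ (a : Plane) (b : OrthonormalBasis (Fin 2) ℝ Plane)
      (h : ℝ), 0 < h →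
      ∃ v : Plane → ℝ, ContDiff ℝ ∞ v ∧ HasCompactSupport v ∧
        (∀ x ∈ tsupport v, ∃ s ∈ Icc (1 / 4 : ℝ) (3 / 4), ∃ t ∈ Icc (-δ) δ,
          x = a + (h * s) • b 0 + (h * t) • b 1) ∧
        ∫ x in Icc (0 : ℝ) 1, q.eval x ^ 2 ≤ C * ∫ x, v (a + (h * x) • b 0) * q.eval x ∧
        ∫ x, v (a + (h * x) • b 0) ^ 2 ≤ C * ∫ x, v (a + (h * x) • b 0) * q.eval x ∧
        ∫ x, v x ^ 2 ≤ C * h ^ 2 * ∫ x, v (a + (h * x) • b 0) * q.eval x ∧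
        ∫ x, ‖gradient v x‖ ^ 2 ≤ C * ∫ x, v (a + (h * x) • b 0) * q.eval x := by
  obtain ⟨C, hC, hA⟩ := exists_testFunction_interval k
  -- The cut-off across the segment: it equals 1 on the segment, so that the trace of `v` there is
  -- `A`, and its support gives the bound δ on the transversal coordinate.
  set B : ContDiffBump (0 : ℝ) := ⟨δ / 2, δ, by linarith, by linarith⟩ with hB
  have hBts : tsupport B = Icc (-δ) δ := by
    rw [B.tsupport_eq, Real.closedBall_eq_Icc]
    simp [hB]
  have hB0 : B 0 = 1 := B.one_of_mem_closedBall (Metric.mem_closedBall_self B.rIn_pos.le)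
  set I₀ := ∫ x, B x ^ 2
  set I₁ := ∫ x, deriv B x ^ 2
  have hI₀ : 0 ≤ I₀ := integral_nonneg fun _ => sq_nonneg _
  have hI₁ : 0 ≤ I₁ := integral_nonneg fun _ => sq_nonneg _
  -- The test function is a product, so its integrals factor; `I₀` and `I₁` are the transversal
  -- factors and depend on the cut-off only.
  refine ⟨C * (1 + I₀ + I₁), by positivity, fun q hq a b h hh => ?_⟩
  obtain ⟨A, hAd, hAts, hA1, hA2, hA3⟩ := hA q hq
  set v : Plane → ℝ := fun x => A (h⁻¹ * inner ℝ (b 0) (x - a)) * B (h⁻¹ * inner ℝ (b 1) (x - a))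
    with hv
  set M := ∫ x, A x * q.eval x with hM
  have hM0 : 0 ≤ M := by
    have : 0 ≤ C * M := (integral_nonneg fun _ => sq_nonneg _).trans hA2
    exact nonneg_of_mul_nonneg_right this hC
  have hvc : ∀ z : ℝ × ℝ, v (planeChart a b (h • z)) = A z.1 * B z.2 := by
    intro z
    rw [hv]
    simp only [(inner_planeChart_sub a b _).1, (inner_planeChart_sub a b _).2, Prod.smul_fst,
      Prod.smul_snd, smul_eq_mul, inv_mul_cancel_left₀ hh.ne']
  have hvl : ∀ x : ℝ, v (a + (h * x) • b 0) = A x := by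
    intro x
    have := hvc (x, 0)
    rw [hB0, mul_one] at this
    rw [← this, planeChart_apply]
    simp
  have hAcs : HasCompactSupport A := isCompact_Icc.of_isClosed_subset (isClosed_tsupport _) hAts
  have hvd : ContDiff ℝ ∞ v := by
    rw [hv]
    have hl : ∀ i, ContDiff ℝ ∞ fun x : Plane => h⁻¹ * inner ℝ (b i) (x - a) := fun i =>
      contDiff_const.mul (contDiff_const.inner ℝ (contDiff_id.sub contDiff_const))
    exact (hAd.comp (hl 0)).mul (B.contDiff.comp (hl 1))
  have hsupp : ∀ x ∈ tsupport v, h⁻¹ * inner ℝ (b 0) (x - a) ∈ Icc (1 / 4 : ℝ) (3 / 4) ∧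
      h⁻¹ * inner ℝ (b 1) (x - a) ∈ Icc (-δ) δ := by
    have : tsupport v ⊆ {x | h⁻¹ * inner ℝ (b 0) (x - a) ∈ Icc (1 / 4 : ℝ) (3 / 4) ∧
      h⁻¹ * inner ℝ (b 1) (x - a) ∈ Icc (-δ) δ} := by
      refine closure_minimal (fun x hx => ⟨?_, ?_⟩) ?_
      · by_contra hn
        exact hx (by simp [hv, image_eq_zero_of_notMem_tsupport fun h => hn (hAts h)])
      · by_contra hn
        exact hx (by simp [hv, image_eq_zero_of_notMem_tsupport fun h => hn (hBts.subset h)])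
      · exact (isClosed_Icc.preimage (by fun_prop)).inter (isClosed_Icc.preimage (by fun_prop))
    exact this
  have hsupp' : ∀ x ∈ tsupport v, ∃ s ∈ Icc (1 / 4 : ℝ) (3 / 4), ∃ t ∈ Icc (-δ) δ,
      x = a + (h * s) • b 0 + (h * t) • b 1 := by
    intro x hx
    refine ⟨_, (hsupp x hx).1, _, (hsupp x hx).2, ?_⟩
    rw [mul_inv_cancel_left₀ hh.ne', mul_inv_cancel_left₀ hh.ne']
    exact eq_add_orthonormal_coords b a x
  have hvcs : HasCompactSupport v := by
    have hc : IsCompact ((fun z : ℝ × ℝ => a + (h * z.1) • b 0 + (h * z.2) • b 1) ''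
        (Icc (1 / 4 : ℝ) (3 / 4) ×ˢ Icc (-δ) δ)) :=
      (isCompact_Icc.prod isCompact_Icc).image (by fun_prop)
    refine hc.of_isClosed_subset (isClosed_tsupport _) fun x hx => ?_
    obtain ⟨s, hs, t, ht, rfl⟩ := hsupp' x hx
    exact ⟨(s, t), ⟨hs, ht⟩, rfl⟩
  -- The two partial derivatives are read off on lines parallel to the axes. The factor `(h ^ 2)⁻¹`
  -- cancels the Jacobian: in the plane the Dirichlet integral is scale invariant.
  have hgrad : ∀ z : ℝ × ℝ, ‖gradient v (planeChart a b (h • z))‖ ^ 2 =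
      (h ^ 2)⁻¹ * (deriv A z.1 ^ 2 * B z.2 ^ 2 + A z.1 ^ 2 * deriv B z.2 ^ 2) := by
    intro z
    have hd0 := hasDerivAt_comp_line (hvd.of_le (by simp)) (planeChart a b (h • z)) (b 0) 0
    have hd1 := hasDerivAt_comp_line (hvd.of_le (by simp)) (planeChart a b (h • z)) (b 1) 0
    have e0 : (fun x : ℝ => v (planeChart a b (h • z) + x • b 0)) =
        fun x => A (z.1 + h⁻¹ * x) * B z.2 := by
      ext x
      rw [← hvc (z.1 + h⁻¹ * x, z.2)]
      congr 1
      simp only [planeChart_apply, Prod.smul_mk, Prod.smul_fst, Prod.smul_snd, smul_eq_mul, mul_add,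
        mul_inv_cancel_left₀ hh.ne', add_smul]
      abel
    have e1 : (fun x : ℝ => v (planeChart a b (h • z) + x • b 1)) =
        fun x => A z.1 * B (z.2 + h⁻¹ * x) := by
      ext x
      rw [← hvc (z.1, z.2 + h⁻¹ * x)]
      congr 1
      simp only [planeChart_apply, Prod.smul_mk, Prod.smul_fst, Prod.smul_snd, smul_eq_mul, mul_add,
        mul_inv_cancel_left₀ hh.ne', add_smul]
      abel
    have hl : ∀ y : ℝ, HasDerivAt (fun x : ℝ => y + h⁻¹ * x) h⁻¹ 0 := fun y => by
      simpa using ((hasDerivAt_id (0 : ℝ)).const_mul h⁻¹).const_add y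
    have f0 : HasDerivAt (fun x => A (z.1 + h⁻¹ * x) * B z.2) (deriv A z.1 * h⁻¹ * B z.2) 0 := by
      have hA' : HasDerivAt A (deriv A z.1) (z.1 + h⁻¹ * 0) := by
        simpa using (hAd.differentiable (by simp) z.1).hasDerivAt
      exact (hA'.comp (0 : ℝ) (hl z.1)).mul_const _
    have f1 : HasDerivAt (fun x => A z.1 * B (z.2 + h⁻¹ * x)) (A z.1 * (deriv B z.2 * h⁻¹)) 0 := by
      have hB' : HasDerivAt B (deriv B z.2) (z.2 + h⁻¹ * 0) := by
        simpa using ((B.contDiff (n := 1)).differentiable one_ne_zero z.2).hasDerivAt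
      exact (hB'.comp (0 : ℝ) (hl z.2)).const_mul _
    rw [e0, zero_smul, add_zero] at hd0
    rw [e1, zero_smul, add_zero] at hd1
    rw [← b.sum_sq_norm_inner_left, Fin.sum_univ_two, inner_gradient, inner_gradient, hd0.unique f0,
      hd1.unique f1, Real.norm_eq_abs, Real.norm_eq_abs, sq_abs, sq_abs]
    field_simp
  refine ⟨v, hvd, hvcs, hsupp', ?_⟩
  simp_rw [hvl]
  refine ⟨?_, ?_, ?_, ?_⟩
  · refine hA1.trans (mul_le_mul_of_nonneg_right ?_ hM0)
    nlinarith
  · refine hA2.trans (mul_le_mul_of_nonneg_right ?_ hM0)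
    nlinarith
  · rw [integral_planeChart_smul _ a b hh]
    simp_rw [hvc, mul_pow]
    rw [Measure.volume_eq_prod, integral_prod_mul (fun x => A x ^ 2) (fun x => B x ^ 2), smul_eq_mul]
    have h1 : (∫ x, A x ^ 2) * I₀ ≤ C * M * I₀ := mul_le_mul_of_nonneg_right hA2 hI₀
    have h2 : C * M * I₀ ≤ C * M * (1 + I₀ + I₁) :=
      mul_le_mul_of_nonneg_left (by linarith) (by positivity)
    calc h ^ 2 * ((∫ x, A x ^ 2) * I₀) ≤ h ^ 2 * (C * M * (1 + I₀ + I₁)) :=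
          mul_le_mul_of_nonneg_left (h1.trans h2) (by positivity)
      _ = _ := by ring
  · rw [integral_planeChart_smul _ a b hh]
    simp_rw [hgrad]
    have hAi := integrable_sq_of_hasCompactSupport hAd.continuous hAcs
    have hAi' := integrable_sq_of_hasCompactSupport (hAd.continuous_deriv (by simp)) hAcs.deriv
    have hBi := integrable_sq_of_hasCompactSupport B.continuous B.hasCompactSupport
    have hBi' := integrable_sq_of_hasCompactSupport
      ((B.contDiff (n := 1)).continuous_deriv le_rfl) B.hasCompactSupport.deriv
    rw [integral_const_mul, Measure.volume_eq_prod, integral_add (hAi'.mul_prod hBi)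
      (hAi.mul_prod hBi'), integral_prod_mul (fun x => deriv A x ^ 2) (fun x => B x ^ 2),
      integral_prod_mul (fun x => A x ^ 2) (fun x => deriv B x ^ 2), smul_eq_mul,
      mul_inv_cancel_left₀ (by positivity)]
    have h1 : (∫ x, deriv A x ^ 2) * I₀ ≤ C * M * I₀ := mul_le_mul_of_nonneg_right hA3 hI₀
    have h2 : (∫ x, A x ^ 2) * I₁ ≤ C * M * I₁ := mul_le_mul_of_nonneg_right hA2 hI₁
    have h3 : 0 ≤ C * M := by positivity
    calc _ ≤ C * M * I₀ + C * M * I₁ := add_le_add h1 h2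
      _ ≤ C * (1 + I₀ + I₁) * M := by linarith

/-! ### Geometry of triangulations -/

theorem convexHull_subset_preimage_zero {S : Set Plane} (f : Plane →ᵃ[ℝ] ℝ)
    (h : ∀ x ∈ S, f x = 0) {x : Plane} (hx : x ∈ convexHull ℝ S) : f x = 0 :=
  (convexHull_min (t := f ⁻¹' {0}) h ((convex_singleton (0 : ℝ)).affine_preimage f)) hx

/-- The barycentric coordinates of a triangle. -/
theorem exists_barycentric {t : Finset Plane} (hc : t.card = 3)
    (ht : AffineIndependent ℝ ((↑) : t → Plane)) :
    ∃ β : Plane → Plane →ᵃ[ℝ] ℝ,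
      (∀ y ∈ t, ∀ z ∈ t, β y z = if y = z then 1 else 0) ∧
      interior (hull t) = {x | ∀ y ∈ t, 0 < β y x} := by
  classical
  have hspan : affineSpan ℝ (Set.range ((↑) : t → Plane)) = ⊤ := by
    rw [ht.affineSpan_eq_top_iff_card_eq_finrank_add_one]
    simp [hc]
  let B : AffineBasis t ℝ Plane := ⟨(↑), ht, hspan⟩
  have hBv : ∀ i : t, B i = (i : Plane) := fun i => rfl
  have hr : Set.range B = (t : Set Plane) := by
    ext x
    simp [hBv]
  refine ⟨fun y => if h : y ∈ t then B.coord ⟨y, h⟩ else AffineMap.const ℝ Plane 0, ?_, ?_⟩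
  · intro y hy z hz
    have := B.coord_apply ⟨y, hy⟩ ⟨z, hz⟩
    rw [hBv] at this
    simp only [dif_pos hy, this, Subtype.mk.injEq]
  · rw [hull, ← hr, B.interior_convexHull]
    ext x
    constructor
    · intro h y hy
      simpa [hy] using h ⟨y, hy⟩
    · intro h i
      simpa using h i i.2

/-- The barycentric coordinate of `y` is positive at interior points and zero on the hull of the
other vertices. -/
theorem notMem_convexHull_diff_of_mem_interior {t : Finset Plane} (hc : t.card = 3)
    (ht : AffineIndependent ℝ ((↑) : t → Plane)) {x y : Plane} (hx : x ∈ interior (hull t))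
    (hy : y ∈ t) : x ∉ convexHull ℝ ((t : Set Plane) \ {y}) := by
  obtain ⟨β, h1, h2⟩ := exists_barycentric hc ht
  intro h
  rw [h2] at hx
  refine (hx y hy).ne' (convexHull_subset_preimage_zero (β y) (fun z hz => ?_) h)
  rw [h1 y hy z hz.1, if_neg fun h => hz.2 h.symm]

theorem affineMap_combination (f : Plane →ᵃ[ℝ] ℝ) {α β γ : ℝ} (h : α + β + γ = 1)
    (x y z : Plane) : f (α • x + β • y + γ • z) = α * f x + β * f y + γ * f z := by
  have hf : ∀ w, f w = f.linear w + f 0 := fun w => congrFun f.decomp w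
  simp only [hf x, hf y, hf z, hf (α • x + β • y + γ • z), map_add, map_smul, smul_eq_mul]
  linear_combination (-f 0) * h

theorem notMem_convexHull_diff_of_mem_openSegment {t : Finset Plane} (hc : t.card = 3)
    (ht : AffineIndependent ℝ ((↑) : t → Plane)) {a b x : Plane} (ha : a ∈ t) (hb : b ∈ t)
    (hab : a ≠ b) (hx : x ∈ openSegment ℝ a b) : x ∉ convexHull ℝ ((t : Set Plane) \ {a}) := by
  obtain ⟨β, h1, -⟩ := exists_barycentric hc ht
  intro h
  obtain ⟨p, q, hp, hq, hpq, rfl⟩ := hx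
  have h0 := convexHull_subset_preimage_zero (β a) (fun z hz => by
    rw [h1 a ha z hz.1, if_neg fun h => hz.2 h.symm]) h
  have := affineMap_combination (β a) (α := p) (β := q) (γ := 0) (by linarith) a b a
  rw [zero_smul, add_zero, h0, h1 a ha a ha, h1 a ha b hb, if_pos rfl, if_neg hab] at this
  linarith

/-- Conformity puts `x` in the hull of `s ∩ t`, and affine independence of `s` then puts it in the
hull of `e ∩ t`. If `y` were not in `e`, this would be part of the hull of `t` without `y`. All
incidence statements below follow by choosing points that need certain vertices. -/
theorem IsTriangulation.mem_of_notMem_convexHull_diff {Ω : Set Plane}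
    {𝒯 : Finset (Finset Plane)} (hT : IsTriangulation Ω 𝒯) {s t e : Finset Plane} (hs : s ∈ 𝒯)
    (ht : t ∈ 𝒯) (he : e ⊆ s) {x y : Plane} (hxt : x ∈ hull t) (hxe : x ∈ hull e)
    (hy : x ∉ convexHull ℝ ((t : Set Plane) \ {y})) : y ∈ e := by
  classical
  by_contra hye
  have hxs : x ∈ hull s := convexHull_mono (Finset.coe_subset.2 he) hxe
  have h1 : x ∈ convexHull ℝ (((s ∩ t : Finset Plane) : Set Plane)) := by
    rw [Finset.coe_inter]
    exact hT.inter_subset s hs t ht ⟨hxs, hxt⟩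
  have h2 := (hT.affineIndependent s hs).convexHull_inter he
    (Finset.inter_subset_left (s₂ := t))
  have h3 : x ∈ convexHull ℝ ((e : Set Plane) ∩ ((s ∩ t : Finset Plane) : Set Plane)) := by
    rw [h2]
    exact ⟨hxe, h1⟩
  refine hy (convexHull_mono ?_ h3)
  rintro z ⟨hze, hzst⟩
  rw [Finset.coe_inter] at hzst
  exact ⟨hzst.2, fun h => hye (by rw [mem_singleton_iff] at h; exact h ▸ hze)⟩

/-- An interior point of `t` needs all three vertices of `t`, but `e` has only two. -/
theorem IsTriangulation.notMem_hull_edge_of_mem_interior {Ω : Set Plane}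
    {𝒯 : Finset (Finset Plane)} (hT : IsTriangulation Ω 𝒯) {s t e : Finset Plane} (hs : s ∈ 𝒯)
    (ht : t ∈ 𝒯) (he : e ∈ edges s) {x : Plane} (hx : x ∈ interior (hull t)) : x ∉ hull e := by
  intro hxe
  obtain ⟨he1, he2⟩ := Finset.mem_powersetCard.1 he
  have : t ⊆ e := fun y hy => hT.mem_of_notMem_convexHull_diff hs ht he1 (_root_.interior_subset hx) hxe
    (notMem_convexHull_diff_of_mem_interior (hT.card_eq t ht) (hT.affineIndependent t ht) hx hy)
  have := Finset.card_le_card this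
  rw [hT.card_eq t ht, he2] at this
  omega

theorem openSegment_subset_hull_pair (a b : Plane) :
    openSegment ℝ a b ⊆ hull {a, b} := by
  rw [hull, Finset.coe_pair, convexHull_pair]
  exact openSegment_subset_segment ℝ a b

/-- A relative interior point of an edge needs both endpoints. With `e` an edge this says that no
other edge passes through the point; with `e = s` it says that a triangle containing the point has
the whole edge. -/
theorem IsTriangulation.subset_of_mem_openSegment {Ω : Set Plane}
    {𝒯 : Finset (Finset Plane)} (hT : IsTriangulation Ω 𝒯) {s t e : Finset Plane} (hs : s ∈ 𝒯)
    (ht : t ∈ 𝒯) (he : e ⊆ s) {a b x : Plane} (hab : a ≠ b) (habt : {a, b} ⊆ t)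
    (hx : x ∈ openSegment ℝ a b) (hxe : x ∈ hull e) : {a, b} ⊆ e := by
  have ha : a ∈ t := habt (by simp)
  have hb : b ∈ t := habt (by simp)
  have hxt : x ∈ hull t := convexHull_mono (Finset.coe_subset.2 habt)
    (openSegment_subset_hull_pair a b hx)
  intro y hy
  rw [Finset.mem_insert, Finset.mem_singleton] at hy
  rcases hy with rfl | rfl
  · exact hT.mem_of_notMem_convexHull_diff hs ht he hxt hxe
      (notMem_convexHull_diff_of_mem_openSegment (hT.card_eq t ht) (hT.affineIndependent t ht)
        ha hb hab hx)
  · exact hT.mem_of_notMem_convexHull_diff hs ht he hxt hxe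
      (notMem_convexHull_diff_of_mem_openSegment (hT.card_eq t ht) (hT.affineIndependent t ht)
        hb ha hab.symm (by rwa [openSegment_symm]))

theorem mem_hull_triple {a b c x : Plane} :
    x ∈ hull {a, b, c} ↔
      ∃ α β γ : ℝ, 0 ≤ α ∧ 0 ≤ β ∧ 0 ≤ γ ∧ α + β + γ = 1 ∧ x = α • a + β • b + γ • c := by
  constructor
  · intro hx
    refine (convexHull_min (t := {x | ∃ α β γ : ℝ, 0 ≤ α ∧ 0 ≤ β ∧ 0 ≤ γ ∧ α + β + γ = 1 ∧
      x = α • a + β • b + γ • c}) ?_ ?_) hx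
    · intro y hy
      simp only [Finset.coe_insert, Finset.coe_singleton, mem_insert_iff, mem_singleton_iff] at hy
      rcases hy with rfl | rfl | rfl
      · exact ⟨1, 0, 0, by simp⟩
      · exact ⟨0, 1, 0, by simp⟩
      · exact ⟨0, 0, 1, by simp⟩
    · rintro _ ⟨α, β, γ, h1, h2, h3, h4, rfl⟩ _ ⟨α', β', γ', h1', h2', h3', h4', rfl⟩ p q hp hq hpq
      refine ⟨p * α + q * α', p * β + q * β', p * γ + q * γ', by positivity, by positivity,
        by positivity, ?_, ?_⟩
      · linear_combination p * h4 + q * h4' + hpq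
      · module
  · rintro ⟨α, β, γ, h1, h2, h3, h4, rfl⟩
    have hm : ∀ y ∈ ({a, b, c} : Finset Plane), y ∈ hull {a, b, c} := fun y hy =>
      subset_convexHull ℝ _ (Finset.mem_coe.2 hy)
    have := (convex_convexHull ℝ ((({a, b, c} : Finset Plane)) : Set Plane)).sum_mem
      (t := Finset.univ) (w := ![α, β, γ]) (z := ![a, b, c]) (fun i _ => by
        fin_cases i <;> simpa) (by simp [Fin.sum_univ_three, h4]) (fun i _ => by
        fin_cases i <;> exact hm _ (by simp))
    simpa [Fin.sum_univ_three, hull] using this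

theorem isCompact_hull (t : Finset Plane) : IsCompact (hull t) :=
  t.finite_toSet.isCompact_convexHull ℝ

/-! ### Orthonormal frames along an edge -/

theorem exists_orthonormalBasis_pair {τ ν : Plane} (hτ : ‖τ‖ = 1) (hν : ‖ν‖ = 1)
    (h : inner ℝ τ ν = 0) : ∃ b : OrthonormalBasis (Fin 2) ℝ Plane, b 0 = τ ∧ b 1 = ν := by
  have ho : Orthonormal ℝ ![τ, ν] := by
    constructor
    · intro i
      fin_cases i <;> simpa
    · intro i j hij
      fin_cases i <;> fin_cases j
      · exact absurd rfl hij
      · exact h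
      · exact (real_inner_comm _ _).trans h
      · exact absurd rfl hij
  have ho := ho.comp (fun i : ↥(Set.univ : Set (Fin 2)) => (i : Fin 2)) Subtype.val_injective
  obtain ⟨b, hb⟩ := ho.exists_orthonormalBasis_extension_of_card_eq (by simp)
  exact ⟨b, hb 0 trivial, hb 1 trivial⟩

/-- The triangle across an edge has the same tangent and the opposite normal, so both sides fit the
same kind of frame. -/
theorem exists_orthonormalBasis_neg (b : OrthonormalBasis (Fin 2) ℝ Plane) :
    ∃ b' : OrthonormalBasis (Fin 2) ℝ Plane, b' 0 = b 0 ∧ b' 1 = -b 1 :=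
  exists_orthonormalBasis_pair (b.norm_eq_one 0) (by rw [norm_neg, b.norm_eq_one])
    (by rw [inner_neg_right, b.inner_eq_zero (by decide), neg_zero])

theorem exists_orthonormalBasis_of_norm_eq_one {τ : Plane} (hτ : ‖τ‖ = 1) :
    ∃ b : OrthonormalBasis (Fin 2) ℝ Plane, b 0 = τ := by
  refine (exists_orthonormalBasis_pair hτ (ν := !₂[-τ 1, τ 0]) ?_ ?_).imp fun b hb => hb.1
  · rw [← hτ, EuclideanSpace.norm_eq, EuclideanSpace.norm_eq]
    simp [Fin.sum_univ_two, add_comm]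
  · simp [PiLp.inner_apply, Fin.sum_univ_two]
    ring

/-- Coordinates adapted to the edge `e` of the triangle `t`: the edge lies on the first axis, the
triangle in the upper half-plane, and a box above the middle half of the edge in the triangle. -/
structure IsEdgeFrame (σ : ℝ) (t e : Finset Plane) (a : Plane)
    (b : OrthonormalBasis (Fin 2) ℝ Plane) (h : ℝ) : Prop where
  pos : 0 < h
  subset : e ⊆ t
  hull_eq : hull e = segment ℝ a (a + h • b 0)
  nonneg : ∀ x ∈ hull t, 0 ≤ inner ℝ (b 1) (x - a)
  mem_interior : ∀ s ∈ Icc (1 / 4 : ℝ) (3 / 4), ∀ y ∈ Ioc 0 (1 / (4 * σ ^ 2)),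
    a + (h * s) • b 0 + (h * y) • b 1 ∈ interior (hull t)
  le_diam : h ≤ Metric.diam (hull t)
  diam_le : Metric.diam (hull t) ≤ σ * h

theorem inner_frame (b : OrthonormalBasis (Fin 2) ℝ Plane) (x y : ℝ) :
    inner ℝ (b 0) (x • b 0 + y • b 1) = x ∧ inner ℝ (b 1) (x • b 0 + y • b 1) = y := by
  constructor <;> simp [inner_add_right, inner_smul_right]

/-- The disc inside the triangle forces base and height to be at least 2r, while all distances are
at most σr. So the triangle is not flat, and barycentric coordinates stay positive on a box whose
height is a fixed fraction of the base. -/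
theorem isEdgeFrame_of_triple {σ : ℝ} (hσ : 1 ≤ σ) {a c : Plane}
    {b : OrthonormalBasis (Fin 2) ℝ Plane} {h : ℝ} (hh : 0 < h) {t : Finset Plane}
    (ht : t = {a, a + h • b 0, c}) (hcard : t.card = 3)
    (hai : AffineIndependent ℝ ((↑) : t → Plane)) (hc : 0 ≤ inner ℝ (b 1) (c - a))
    {z : Plane} {r : ℝ} (hr : 0 < r) (hz : Metric.closedBall z r ⊆ hull t)
    (hd : Metric.diam (hull t) ≤ σ * r) :
    0 < inner ℝ (b 1) (c - a) ∧ IsEdgeFrame σ t {a, a + h • b 0} a b h := by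
  set p := inner ℝ (b 0) (c - a) with hp
  set q := inner ℝ (b 1) (c - a) with hq
  have hcpq : c = a + p • b 0 + q • b 1 := eq_add_orthonormal_coords b a c
  have hcoord : ∀ α β γ : ℝ, α + β + γ = 1 →
      α • a + β • (a + h • b 0) + γ • c - a = (β * h + γ * p) • b 0 + (γ * q) • b 1 := by
    intro α β γ h1
    obtain rfl : α = 1 - β - γ := by linarith
    rw [hcpq]
    module
  have hmem : ∀ x ∈ hull t, ∃ β γ : ℝ, 0 ≤ β ∧ 0 ≤ γ ∧ β + γ ≤ 1 ∧
      inner ℝ (b 0) (x - a) = β * h + γ * p ∧ inner ℝ (b 1) (x - a) = γ * q := by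
    intro x hx
    rw [ht, mem_hull_triple] at hx
    obtain ⟨α, β, γ, h1, h2, h3, h4, rfl⟩ := hx
    refine ⟨β, γ, h2, h3, by linarith, ?_⟩
    rw [hcoord α β γ h4]
    exact inner_frame b _ _
  have hball : ∀ w : Plane, ‖w‖ = 1 → z + r • w ∈ hull t := fun w hw => hz (by
    rw [mem_closedBall_iff_norm, add_sub_cancel_left, norm_smul, hw, Real.norm_of_nonneg hr.le,
      mul_one])
  have hin : ∀ (i : Fin 2) (w : Plane), inner ℝ (b i) (z + r • w - a) =
      inner ℝ (b i) (z - a) + r * inner ℝ (b i) w := by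
    intro i w
    rw [← real_inner_smul_right, ← inner_add_right]
    congr 1
    abel
  -- The lowest and highest points of the disc lie in the strip of height `q` that contains the
  -- triangle.
  have hq2 : 2 * r ≤ q := by
    obtain ⟨β, γ, h1, h2, h3, -, h5⟩ := hmem _ (hball (b 1) (b.norm_eq_one 1))
    obtain ⟨β', γ', h1', h2', h3', -, h5'⟩ := hmem _ (hball (-b 1) (by
      rw [norm_neg, b.norm_eq_one]))
    rw [hin] at h5 h5'
    rw [inner_neg_right] at h5'
    rw [real_inner_self_eq_norm_sq, b.norm_eq_one] at h5 h5'
    nlinarith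
  have hq0 : 0 < q := by linarith
  -- The two horizontal extremes of the disc have the same height, hence the same coordinate `γ`,
  -- and a horizontal chord of the triangle is no longer than its base.
  have hh2 : 2 * r ≤ h := by
    obtain ⟨β, γ, h1, h2, h3, h4, h5⟩ := hmem _ (hball (b 0) (b.norm_eq_one 0))
    obtain ⟨β', γ', h1', h2', h3', h4', h5'⟩ := hmem _ (hball (-b 0) (by
      rw [norm_neg, b.norm_eq_one]))
    rw [hin] at h4 h4' h5 h5'
    rw [inner_neg_right] at h4' h5'
    rw [real_inner_self_eq_norm_sq, b.norm_eq_one] at h4 h4'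
    rw [b.inner_eq_zero (by decide)] at h5 h5'
    have : γ = γ' := mul_right_cancel₀ hq0.ne' (by linarith)
    subst this
    nlinarith
  have hvert : ∀ y ∈ t, y ∈ hull t := fun y hy => subset_convexHull ℝ _ (Finset.mem_coe.2 hy)
  have hdist : ∀ x ∈ t, ∀ y ∈ t, dist x y ≤ Metric.diam (hull t) := fun x hx y hy =>
    Metric.dist_le_diam_of_mem (isCompact_hull t).isBounded (hvert x hx) (hvert y hy)
  have hhd : h ≤ Metric.diam (hull t) := by
    have := hdist (a + h • b 0) (by simp [ht]) a (by simp [ht])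
    rwa [dist_eq_norm, add_sub_cancel_left, norm_smul, b.norm_eq_one, mul_one,
      Real.norm_of_nonneg hh.le] at this
  have hpd : |p| ≤ Metric.diam (hull t) := by
    refine le_trans ?_ (hdist c (by simp [ht]) a (by simp [ht]))
    rw [dist_eq_norm]
    refine (abs_real_inner_le_norm _ _).trans ?_
    rw [b.norm_eq_one, one_mul]
  refine ⟨hq0, hh, ?_, ?_, ?_, ?_, hhd, ?_⟩
  · rw [ht]
    intro y hy
    simp only [Finset.mem_insert, Finset.mem_singleton] at hy ⊢
    tauto
  · rw [hull, Finset.coe_pair, convexHull_pair]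
  · intro x hx
    obtain ⟨β, γ, h1, h2, h3, -, h5⟩ := hmem x hx
    rw [h5]
    positivity
  · rintro s ⟨hs1, hs2⟩ y ⟨hy0, hy1⟩
    -- `γ` and `β` are the barycentric coordinates of the point at `c` and at `a + h • b 0`. From q
    -- ≥ 2r and |p|, h ≤ σr follows γ ≤ σy/2 and |γp/h| ≤ σ²y/4 ≤ 1/16, so `β` stays above 1/4 -
    -- 1/16; as γ ≤ 1/8, the third coordinate is positive too.
    set γ := h * y / q with hγ
    set β := s - γ * p / h with hβ
    have hσ0 : 0 < σ := by linarith
    rw [le_div_iff₀ (by positivity)] at hy1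
    have hy2 : y * (4 * σ) ≤ 1 := by nlinarith [mul_nonneg hy0.le hσ0.le]
    have hγ0 : 0 < γ := by positivity
    have hγσ : γ ≤ σ * y / 2 := by
      rw [hγ, div_le_iff₀ hq0]
      nlinarith [mul_pos hy0 hσ0]
    have hγp : |γ * p / h| ≤ 1 / 16 := by
      rw [abs_div, abs_mul, abs_of_pos hγ0, abs_of_pos hh, div_le_iff₀ hh]
      calc γ * |p| ≤ (σ * y / 2) * (σ * (h / 2)) := by
            gcongr
            exact hpd.trans (hd.trans (by gcongr; linarith))
        _ = (y * (4 * σ ^ 2)) * (h / 16) := by ring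
        _ ≤ 1 * (h / 16) := by gcongr
        _ = _ := by ring
    obtain ⟨hγp1, hγp2⟩ := abs_le.1 hγp
    have hβ0 : 0 < β := by linarith
    have hα0 : 0 < 1 - β - γ := by nlinarith
    obtain ⟨B, hB1, hB2⟩ := exists_barycentric hcard hai
    have hx : a + (h * s) • b 0 + (h * y) • b 1 =
        (1 - β - γ) • a + β • (a + h • b 0) + γ • c := by
      have := hcoord (1 - β - γ) β γ (by ring)
      have e1 : β * h + γ * p = h * s := by
        rw [hβ]
        field_simp
        ring
      have e2 : γ * q = h * y := by
        rw [hγ]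
        field_simp
      rw [e1, e2, sub_eq_iff_eq_add] at this
      rw [this]
      abel
    have hne : a ≠ a + h • b 0 ∧ a ≠ c ∧ a + h • b 0 ≠ c := by
      refine ⟨fun e0 => ?_, fun e0 => hq0.ne' ?_, fun e0 => hq0.ne' ?_⟩
      · rw [left_eq_add, smul_eq_zero] at e0
        exact e0.elim hh.ne' (b.orthonormal.ne_zero 0)
      · rw [hq, ← e0, sub_self, inner_zero_right]
      · rw [hq, ← e0, add_sub_cancel_left, real_inner_smul_right, b.inner_eq_zero (by decide),
          mul_zero]
    rw [hB2, hx]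
    intro w hw
    have hwt := hw
    rw [affineMap_combination (B w) (by ring)]
    rw [hB1 w hwt a (by simp [ht]), hB1 w hwt _ (by simp [ht] : a + h • b 0 ∈ t),
      hB1 w hwt c (by simp [ht])]
    rw [ht, Finset.mem_insert, Finset.mem_insert, Finset.mem_singleton] at hw
    rcases hw with rfl | rfl | rfl
    · simp only [if_true, if_neg hne.1, if_neg hne.2.1]
      linarith
    · simp only [if_true, if_neg hne.1.symm, if_neg hne.2.2]
      linarith
    · simp only [if_true, if_neg hne.2.1.symm, if_neg hne.2.2.symm]
      linarith
  · nlinarith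

/-- `outwardNormal` is a choice, so every admissible `n` has to be identified. Comparing the two
endpoints of the edge kills the tangential component, unit length leaves `b 1` or `-b 1`, and an
interior point of the triangle excludes `b 1`. -/
theorem IsEdgeFrame.outwardNormal_eq {σ : ℝ} (hσ : 1 ≤ σ) {t e : Finset Plane} {a : Plane}
    {b : OrthonormalBasis (Fin 2) ℝ Plane} {h : ℝ} (hf : IsEdgeFrame σ t e a b h) :
    outwardNormal t e = -b 1 := by
  have hcoord : ∀ x ∈ hull e, inner ℝ (b 1) (x - a) = 0 := by
    intro x hx
    rw [hf.hull_eq, segment_eq_image'] at hx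
    obtain ⟨s, -, rfl⟩ := hx
    simp [inner_smul_right]
  have hex : IsOutwardNormal t e (-b 1) := by
    refine ⟨by rw [norm_neg, b.norm_eq_one], fun x hx y hy => ?_⟩
    have h1 := hf.nonneg y hy
    have h2 := hcoord x hx
    rw [← sub_sub_sub_cancel_right y x a, inner_sub_right, inner_neg_left, inner_neg_left, h2]
    linarith
  have hex' : ∃ n, IsOutwardNormal t e n := ⟨_, hex⟩
  rw [outwardNormal, dif_pos hex']
  generalize hn : hex'.choose = n
  obtain ⟨hn1, hn2⟩ : IsOutwardNormal t e n := hn ▸ hex'.choose_spec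
  have hae : a ∈ hull e := hf.hull_eq ▸ left_mem_segment ℝ _ _
  have hbe : a + h • b 0 ∈ hull e := hf.hull_eq ▸ right_mem_segment ℝ _ _
  have het : hull e ⊆ hull t := convexHull_mono (Finset.coe_subset.2 hf.subset)
  have h0 : inner ℝ (b 0) n = 0 := by
    have h1 := hn2 a hae _ (het hbe)
    have h2 := hn2 _ hbe a (het hae)
    rw [add_sub_cancel_left, real_inner_smul_right] at h1
    rw [sub_add_cancel_left, inner_neg_right, real_inner_smul_right] at h2
    rw [real_inner_comm]
    have := hf.pos
    nlinarith
  have hrep := eq_add_orthonormal_coords b 0 n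
  rw [sub_zero, h0, zero_smul, add_zero, zero_add] at hrep
  have hx := hf.mem_interior (1 / 2) ⟨by norm_num, by norm_num⟩ (1 / (4 * σ ^ 2))
    ⟨by positivity, le_rfl⟩
  have h3 := hn2 a hae _ (interior_subset hx)
  set y := 1 / (4 * σ ^ 2) with hy
  have hy0 : 0 < y := by positivity
  have hsub : a + (h * (1 / 2)) • b 0 + (h * y) • b 1 - a =
      (h * (1 / 2)) • b 0 + (h * y) • b 1 := by abel
  rw [hsub, hrep, real_inner_smul_left, (inner_frame b _ _).2] at h3
  have hle : inner ℝ (b 1) n ≤ 0 := by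
    by_contra hlt
    push Not at hlt
    have := mul_pos hlt (mul_pos hf.pos hy0)
    linarith
  have habs : |inner ℝ (b 1) n| = 1 := by
    have := congrArg norm hrep
    rwa [norm_smul, b.norm_eq_one, mul_one, hn1, Real.norm_eq_abs, eq_comm] at this
  rw [abs_of_nonpos hle] at habs
  rw [hrep, show inner ℝ (b 1) n = -1 by linarith, neg_one_smul]

/-- Two triangles on the same side of an edge both contain the box in their interiors, and triangles
sharing an interior point coincide. -/
theorem IsEdgeFrame.eq_of_mem {Ω : Set Plane} {𝒯 : Finset (Finset Plane)}
    (hT : IsTriangulation Ω 𝒯) {σ : ℝ} (hσ : 1 ≤ σ) {t t' e : Finset Plane} {a : Plane}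
    {b : OrthonormalBasis (Fin 2) ℝ Plane} {h : ℝ} (ht : t ∈ 𝒯) (ht' : t' ∈ 𝒯)
    (hf : IsEdgeFrame σ t e a b h) (hf' : IsEdgeFrame σ t' e a b h) : t = t' := by
  have hs : (1 / 2 : ℝ) ∈ Icc (1 / 4 : ℝ) (3 / 4) := ⟨by norm_num, by norm_num⟩
  have hy : 1 / (4 * σ ^ 2) ∈ Ioc 0 (1 / (4 * σ ^ 2)) := ⟨by positivity, le_rfl⟩
  have hx := hf.mem_interior _ hs _ hy
  have hx' := hf'.mem_interior _ hs _ hy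
  refine Finset.eq_of_subset_of_card_le (fun y hy => ?_) ?_
  · exact hT.mem_of_notMem_convexHull_diff ht' ht subset_rfl (interior_subset hx)
      (interior_subset hx') (notMem_convexHull_diff_of_mem_interior (hT.card_eq t ht)
        (hT.affineIndependent t ht) hx hy)
  · rw [hT.card_eq t ht, hT.card_eq t' ht']

theorem exists_eq_triple {t : Finset Plane} (ht : t.card = 3) {p q : Plane} (hpq : p ≠ q)
    (h : {p, q} ⊆ t) : ∃ c, t = {p, q, c} := by
  have h1 : (t \ {p, q}).card = 1 := by
    rw [Finset.card_sdiff_of_subset h, ht, Finset.card_pair hpq]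
  obtain ⟨c, hc⟩ := Finset.card_eq_one.1 h1
  refine ⟨c, ?_⟩
  rw [← Finset.sdiff_union_of_subset h, hc]
  ext x
  simp only [Finset.mem_union, Finset.mem_insert, Finset.mem_singleton]
  tauto

theorem IsShapeRegular.isEdgeFrame {σ : ℝ} (hσ : 1 ≤ σ) {Ω : Set Plane} {𝒯 : Finset (Finset Plane)}
    (hT : IsTriangulation Ω 𝒯) (hS : IsShapeRegular σ 𝒯) {t : Finset Plane} (ht : t ∈ 𝒯)
    {a c : Plane} {b : OrthonormalBasis (Fin 2) ℝ Plane} {h : ℝ} (hh : 0 < h)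
    (htc : t = {a, a + h • b 0, c}) (hc : 0 ≤ inner ℝ (b 1) (c - a)) :
    IsEdgeFrame σ t {a, a + h • b 0} a b h := by
  obtain ⟨z, r, hr, hz, hd⟩ := hS t ht
  exact (isEdgeFrame_of_triple hσ hh htc (hT.card_eq t ht) (hT.affineIndependent t ht) hc hr hz
    hd).2

/-- Every interior edge is shared by exactly two triangles, which lie on different sides. -/
theorem exists_edge_configuration {σ : ℝ} (hσ : 1 ≤ σ) {Ω : Set Plane} (hΩ : IsOpen Ω)
    {𝒯 : Finset (Finset Plane)} (hT : IsTriangulation Ω 𝒯) (hS : IsShapeRegular σ 𝒯)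
    {t e : Finset Plane} (ht : t ∈ 𝒯) (he : e ∈ interiorEdges Ω t) :
    ∃ (a : Plane) (b b' : OrthonormalBasis (Fin 2) ℝ Plane) (h : ℝ) (s : Finset Plane),
      s ∈ 𝒯 ∧ t ≠ s ∧ (∀ r, r ∈ adjacent 𝒯 e ↔ r = t ∨ r = s) ∧ b' 0 = b 0 ∧ b' 1 = -b 1 ∧
      IsEdgeFrame σ t e a b h ∧ IsEdgeFrame σ s e a b' h ∧ e = {a, a + h • b 0} ∧
      openSegment ℝ a (a + h • b 0) ⊆ Ω := by
  classical
  obtain ⟨he1, he2⟩ := Finset.mem_filter.1 he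
  obtain ⟨het, hecard⟩ := Finset.mem_powersetCard.1 he1
  obtain ⟨a, a', haa, rfl⟩ := Finset.card_eq_two.1 hecard
  obtain ⟨c, hc⟩ := exists_eq_triple (hT.card_eq t ht) haa het
  have hpos : 0 < ‖a' - a‖ := norm_pos_iff.2 (sub_ne_zero.2 haa.symm)
  obtain ⟨h, hh, b, hb, hcb⟩ : ∃ h : ℝ, 0 < h ∧ ∃ b : OrthonormalBasis (Fin 2) ℝ Plane,
      a' = a + h • b 0 ∧ 0 ≤ inner ℝ (b 1) (c - a) := by
    obtain ⟨b, hb⟩ := exists_orthonormalBasis_of_norm_eq_one (τ := ‖a' - a‖⁻¹ • (a' - a)) (by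
      rw [norm_smul, norm_inv, norm_norm, inv_mul_cancel₀ hpos.ne'])
    have hb' : a' = a + ‖a' - a‖ • b 0 := by
      rw [hb, smul_smul, mul_inv_cancel₀ hpos.ne', one_smul, add_sub_cancel]
    -- The normal is chosen to point to the side of the third vertex of `t`.
    rcases le_total 0 (inner ℝ (b 1) (c - a)) with h0 | h0
    · exact ⟨_, hpos, b, hb', h0⟩
    · obtain ⟨b', h1, h2⟩ := exists_orthonormalBasis_neg b
      exact ⟨_, hpos, b', h1 ▸ hb', by rw [h2, inner_neg_left]; linarith⟩
  obtain ⟨b', hb0, hb1⟩ := exists_orthonormalBasis_neg b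
  have hseg : openSegment ℝ a a' ⊆ Ω := he2 a (by simp) a' (by simp) haa
  subst hb
  have hft := IsShapeRegular.isEdgeFrame hσ hT hS ht hh hc hcb
  -- A triangle on this edge either lies on the side of `t`, and then it is `t`, or has a frame with
  -- the opposite normal.
  have hside : ∀ s ∈ 𝒯, {a, a + h • b 0} ⊆ s → ∃ d, s = {a, a + h • b 0, d} ∧
      (0 < inner ℝ (b 1) (d - a) ∧ s = t ∨
        inner ℝ (b 1) (d - a) ≤ 0 ∧ IsEdgeFrame σ s {a, a + h • b 0} a b' h) := by
    intro s hs hes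
    obtain ⟨d, hd⟩ := exists_eq_triple (hT.card_eq s hs) haa hes
    refine ⟨d, hd, ?_⟩
    rcases lt_or_ge 0 (inner ℝ (b 1) (d - a)) with h0 | h0
    · exact Or.inl ⟨h0, (IsShapeRegular.isEdgeFrame hσ hT hS hs hh hd h0.le).eq_of_mem hT hσ hs ht hft⟩
    · refine Or.inr ⟨h0, ?_⟩
      have := IsShapeRegular.isEdgeFrame (b := b') (c := d) hσ hT hS hs hh (by rw [hb0]; exact hd)
        (by rw [hb1, inner_neg_left]; linarith)
      rwa [hb0] at this
  set m := a + (h * (1 / 2)) • b 0 with hm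
  have hmseg : m ∈ openSegment ℝ a (a + h • b 0) := by
    rw [openSegment_eq_image']
    refine ⟨1 / 2, ⟨by norm_num, by norm_num⟩, ?_⟩
    simp only [add_sub_cancel_left, smul_smul, hm, mul_comm]
  -- The neighbour is found by stepping from the midpoint of the edge away from `t`. For small `y`
  -- the new point is still in the open set Ω, hence covered by the mesh; the mesh being finite, a
  -- triangle covering it also contains the midpoint.
  obtain ⟨y, hy0, hyΩ, hyC⟩ : ∃ y : ℝ, 0 < y ∧ m - y • b 1 ∈ Ω ∧
      ∀ s ∈ 𝒯, m ∉ hull s → m - y • b 1 ∉ hull s := by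
    have ht0 : Tendsto (fun y : ℝ => m - y • b 1) (𝓝[>] 0) (𝓝 m) := by
      have : Continuous fun y : ℝ => m - y • b 1 := by fun_prop
      simpa using (this.tendsto 0).mono_left nhdsWithin_le_nhds
    have h1 := ht0.eventually (hΩ.mem_nhds (hseg hmseg))
    have h2 : ∀ᶠ y in 𝓝[>] (0 : ℝ), ∀ s ∈ 𝒯, m ∉ hull s → m - y • b 1 ∉ hull s := by
      rw [Filter.eventually_all_finset]
      intro s _
      by_cases hms : m ∈ hull s
      · exact Eventually.of_forall fun _ h => absurd hms h
      · filter_upwards [ht0.eventually ((isCompact_hull s).isClosed.isOpen_compl.mem_nhds hms)]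
          with y hy _ using hy
    have h0 : ∀ᶠ y in 𝓝[>] (0 : ℝ), 0 < y := self_mem_nhdsWithin
    obtain ⟨y, hy, h3, h4⟩ := (h0.and (h1.and h2)).exists
    exact ⟨y, hy, h3, h4⟩
  have hxcl := subset_closure hyΩ
  rw [← hT.iUnion_eq, mem_iUnion₂] at hxcl
  obtain ⟨s, hs, hxs⟩ := hxcl
  have hms : m ∈ hull s := by
    by_contra h
    exact hyC s hs h hxs
  have hes := hT.subset_of_mem_openSegment hs ht subset_rfl haa het hmseg hms
  have hxneg : inner ℝ (b 1) (m - y • b 1 - a) < 0 := by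
    have : m - y • b 1 - a = (h * (1 / 2)) • b 0 + (-y) • b 1 := by rw [hm]; module
    rw [this, (inner_frame b _ _).2]
    linarith
  have hts : t ≠ s := by
    rintro rfl
    linarith [hft.nonneg _ hxs]
  obtain ⟨d, hd, ⟨-, h0⟩ | ⟨-, hfs⟩⟩ := hside s hs hes
  · exact absurd h0.symm hts
  refine ⟨a, b, b', h, s, hs, hts, fun r => ?_, hb0, hb1, hft, hfs, rfl, hseg⟩
  rw [adjacent, Finset.mem_filter]
  constructor
  · rintro ⟨hr, her⟩
    obtain ⟨d', hd', ⟨-, h0⟩ | ⟨-, hfr⟩⟩ := hside r hr her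
    · exact Or.inl h0
    · exact Or.inr (hfr.eq_of_mem hT hσ hr hs hfs)
  · rintro (rfl | rfl)
    · exact ⟨ht, het⟩
    · exact ⟨hs, hes⟩

/-! ### Arc length and the line sources -/

instance isFiniteMeasure_segMeasure (a b : Plane) : IsFiniteMeasure (segMeasure a b) :=
  ⟨by simp [segMeasure, edist_lt_top]⟩

/-- The unit speed parametrization is an isometry, so it carries the Hausdorff measure of the real
line, which is Lebesgue measure, to arc length. -/
theorem setIntegral_segment {a n : Plane} (hn : ‖n‖ = 1) {h : ℝ} (hh : 0 ≤ h) (f : Plane → ℝ) :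
    ∫ x, f x ∂(segMeasure a (a + h • n)) = ∫ x in Icc 0 h, f (a + x • n) := by
  have hi : Isometry fun x : ℝ => a + x • n := by
    refine Isometry.of_dist_eq fun x y => ?_
    rw [dist_add_left, dist_eq_norm, ← sub_smul, norm_smul, hn, mul_one, Real.dist_eq,
      Real.norm_eq_abs]
  have hs : segment ℝ a (a + h • n) = (fun x : ℝ => a + x • n) '' Icc 0 h := by
    rw [segment_eq_image']
    ext x
    constructor
    · rintro ⟨θ, hθ, rfl⟩
      refine ⟨θ * h, ⟨mul_nonneg hθ.1 hh, mul_le_of_le_one_left hh hθ.2⟩, ?_⟩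
      simp [smul_smul]
    · rintro ⟨θ, hθ, rfl⟩
      rcases hh.eq_or_lt with rfl | h0
      · obtain rfl : θ = 0 := le_antisymm hθ.2 hθ.1
        exact ⟨0, by simp, by simp⟩
      · refine ⟨θ / h, ⟨div_nonneg hθ.1 hh, (div_le_one h0).2 hθ.2⟩, ?_⟩
        simp [smul_smul, div_mul_cancel₀ _ h0.ne']
  have hmap := hi.map_hausdorffMeasure (d := 1) (Or.inl zero_le_one)
  have hsub : segment ℝ a (a + h • n) ⊆ range fun x : ℝ => a + x • n :=
    hs ▸ image_subset_range _ _
  have hm : MeasurableSet (segment ℝ a (a + h • n)) := by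
    rw [hs]
    exact (isCompact_Icc.image hi.continuous).measurableSet
  have e : segMeasure a (a + h • n) = (Measure.map (fun x : ℝ => a + x • n)
      (Measure.hausdorffMeasure 1)).restrict (segment ℝ a (a + h • n)) := by
    rw [hmap, Measure.restrict_restrict hm, inter_eq_self_of_subset_left hsub, segMeasure]
  rw [e, hi.isClosedEmbedding.measurableEmbedding.setIntegral_map, hs,
    preimage_image_eq _ hi.injective, hausdorffMeasure_real]

theorem edgeMeasure_eq_segMeasure {e : Finset Plane} {a b : Plane} (h : hull e = segment ℝ a b) :
    edgeMeasure e = segMeasure a b := by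
  rw [edgeMeasure, segMeasure, h]

theorem IsEdgeFrame.edgeMeasure_eq {σ : ℝ} {t e : Finset Plane} {a : Plane}
    {b : OrthonormalBasis (Fin 2) ℝ Plane} {h : ℝ} (hf : IsEdgeFrame σ t e a b h) :
    edgeMeasure e = segMeasure a (a + h • b 0) :=
  edgeMeasure_eq_segMeasure hf.hull_eq

theorem IsEdgeFrame.integral_edgeMeasure {σ : ℝ} {t e : Finset Plane} {a : Plane}
    {b : OrthonormalBasis (Fin 2) ℝ Plane} {h : ℝ} (hf : IsEdgeFrame σ t e a b h)
    (f : Plane → ℝ) : ∫ x, f x ∂(edgeMeasure e) = ∫ x in Icc 0 h, f (a + x • b 0) := by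
  rw [hf.edgeMeasure_eq, setIntegral_segment (b.norm_eq_one 0) hf.pos.le]

theorem IsEdgeFrame.integral_edgeMeasure_unit {σ : ℝ} {t e : Finset Plane} {a : Plane}
    {b : OrthonormalBasis (Fin 2) ℝ Plane} {h : ℝ} (hf : IsEdgeFrame σ t e a b h)
    (f : Plane → ℝ) :
    ∫ x, f x ∂(edgeMeasure e) = h * ∫ x in Icc (0 : ℝ) 1, f (a + (h * x) • b 0) := by
  have h0 := hf.pos
  have := Measure.setIntegral_comp_smul_of_pos volume (fun x : ℝ => f (a + x • b 0)) (Icc 0 1) h0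
  rw [LinearOrderedField.smul_Icc h0, mul_zero, mul_one, Module.finrank_self, pow_one] at this
  simp only [smul_eq_mul] at this
  rw [this, mul_inv_cancel_left₀ h0.ne', hf.integral_edgeMeasure]

theorem edgeMeasure_le_segMeasure {e : Finset Plane} {c d : Plane} (h : hull e ⊆ segment ℝ c d) :
    edgeMeasure e ≤ segMeasure c d :=
  Measure.restrict_mono h le_rfl

theorem measurableSet_hull (t : Finset Plane) : MeasurableSet (hull t) :=
  (isCompact_hull t).measurableSet

section Sources

variable {Ω : Set Plane} {𝒯 : Finset (Finset Plane)} {N : ℕ} {P Q : Fin N → Plane}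
  {g : Fin N → Plane → ℝ}

theorem memLp_fluxData (hg : ∀ l, MemLp (g l) 2 (segMeasure (P l) (Q l))) (e : Finset Plane) :
    MemLp (fluxData P Q g e) 2 (edgeMeasure e) := by
  classical
  unfold fluxData
  refine memLp_finsetSum _ fun l hl => (hg l).mono_measure ?_
  exact edgeMeasure_le_segMeasure (Finset.mem_filter.1 hl).2

/-- If `φ` vanishes on all edges but `e`, only the sources along `e` act on it. -/
theorem linePairing_eq_integral_edge (hconf : ConformsToFractures Ω 𝒯 P Q)
    (hg : ∀ l, MemLp (g l) 2 (segMeasure (P l) (Q l))) {e : Finset Plane} {φ : Plane → ℝ}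
    (hφ : MemLp φ 2 (edgeMeasure e))
    (h : ∀ x, φ x ≠ 0 → ∀ s ∈ 𝒯, ∀ e' ∈ edges s, x ∈ hull e' → e' = e) :
    linePairing P Q g φ = ∫ x, fluxData P Q g e x * φ x ∂(edgeMeasure e) := by
  classical
  have key : ∀ l, ∫ x, g l x * φ x ∂(segMeasure (P l) (Q l)) =
      if hull e ⊆ segment ℝ (P l) (Q l) then ∫ x, g l x * φ x ∂(edgeMeasure e) else 0 := by
    intro l
    obtain ⟨S, hS, hSU⟩ := hconf l
    -- A point of the fracture where `φ` does not vanish lies on one of the mesh edges composing the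
    -- fracture, and this edge must be `e`.
    have hx : ∀ x ∈ segment ℝ (P l) (Q l), φ x ≠ 0 → e ∈ S ∧ x ∈ hull e := by
      intro x hx hφx
      rw [hSU, mem_iUnion₂] at hx
      obtain ⟨e', he', hxe'⟩ := hx
      obtain ⟨-, s, hs, hes⟩ := hS e' he'
      obtain rfl := h x hφx s hs e' hes hxe'
      exact ⟨he', hxe'⟩
    have hm : MeasurableSet (segment ℝ (P l) (Q l)) := by
      have : hull {P l, Q l} = segment ℝ (P l) (Q l) := by
        rw [hull, Finset.coe_pair, convexHull_pair]
      exact this ▸ measurableSet_hull _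
    split_ifs with hsub
    · refine setIntegral_eq_of_subset_of_forall_sdiff_eq_zero hm hsub fun x hxd => ?_
      by_contra hne
      exact hxd.2 (hx x hxd.1 (right_ne_zero_of_mul hne)).2
    · refine setIntegral_eq_zero_of_forall_eq_zero fun x hxs => ?_
      by_contra hne
      refine hsub ?_
      rw [hSU]
      exact subset_biUnion_of_mem (u := hull) (hx x hxs (right_ne_zero_of_mul hne)).1
  rw [linePairing, Finset.sum_congr rfl fun l _ => key l, ← Finset.sum_filter]
  simp_rw [fluxData, Finset.sum_mul]
  rw [integral_finsetSum]
  intro l hl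
  exact ((hg l).mono_measure (edgeMeasure_le_segMeasure
    (Finset.mem_filter.1 hl).2)).integrable_mul hφ

theorem linePairing_eq_zero (hconf : ConformsToFractures Ω 𝒯 P Q) {φ : Plane → ℝ}
    (h : ∀ x, φ x ≠ 0 → ∀ s ∈ 𝒯, ∀ e' ∈ edges s, x ∉ hull e') : linePairing P Q g φ = 0 := by
  refine Finset.sum_eq_zero fun l _ => setIntegral_eq_zero_of_forall_eq_zero fun x hx => ?_
  by_contra hne
  obtain ⟨S, hS, hSU⟩ := hconf l
  rw [hSU, mem_iUnion₂] at hx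
  obtain ⟨e', he', hxe'⟩ := hx
  obtain ⟨-, s, hs, hes⟩ := hS e' he'
  exact h x (right_ne_zero_of_mul hne) s hs e' hes hxe'

end Sources

/-! ### Piecewise polynomials -/

theorem volume_hull_diff_interior (t : Finset Plane) :
    (volume : Measure Plane) (hull t \ interior (hull t)) = 0 := by
  have h := (convex_convexHull ℝ (t : Set Plane)).addHaar_frontier (volume : Measure Plane)
  refine measure_mono_null ?_ h
  exact fun x hx => ⟨subset_closure hx.1, hx.2⟩

theorem hull_ae_eq_interior (t : Finset Plane) :
    (hull t : Set Plane) =ᵐ[volume] interior (hull t) :=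
  (ae_le_set.2 (volume_hull_diff_interior t)).antisymm interior_subset.eventuallyLE

theorem laplacian_eqOn_of_eqOn {v p : Plane → ℝ} {U : Set Plane} (hU : IsOpen U)
    (h : EqOn v p U) : EqOn (Laplacian.laplacian v) (Laplacian.laplacian p) U := by
  intro x hx
  exact (InnerProductSpace.laplacian_congr_nhds (h.eventuallyEq_of_mem (hU.mem_nhds hx))).eq_of_nhds

theorem gradient_eqOn_of_eqOn {v p : Plane → ℝ} {U : Set Plane} (hU : IsOpen U)
    (h : EqOn v p U) : EqOn (gradient v) (gradient p) U := by
  intro x hx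
  unfold gradient
  rw [(h.eventuallyEq_of_mem (hU.mem_nhds hx)).fderiv_eq]

/-- Every point of a convex set with nonempty interior is a limit of interior points, so the filter
in `gradTrace` is nontrivial; the limit along it is given by the continuous gradient of `p`. -/
theorem gradTrace_eq {v p : Plane → ℝ} {s : Finset Plane} (hne : (interior (hull s)).Nonempty)
    (hp : ContDiff ℝ 1 p) (h : EqOn v p (interior (hull s))) {x : Plane} (hx : x ∈ hull s) :
    gradTrace v s x = gradient p x := by
  have hcl : x ∈ closure (interior (hull s)) := by
    have hc : Convex ℝ (hull s) := convex_convexHull ℝ _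
    rw [hc.closure_interior_eq_closure_of_nonempty_interior hne]
    exact subset_closure hx
  have : (𝓝[interior (hull s)] x).NeBot := mem_closure_iff_nhdsWithin_neBot.1 hcl
  refine Tendsto.limUnder_eq ?_
  refine (((continuous_gradient hp).tendsto x).mono_left nhdsWithin_le_nhds).congr' ?_
  filter_upwards [self_mem_nhdsWithin] with y hy
  exact (gradient_eqOn_of_eqOn isOpen_interior h hy).symm

/-! ### The residual -/

theorem integrable_inner_of_memLp {μ : Measure Plane} {f g : Plane → Plane} (hf : MemLp f 2 μ)
    (hg : MemLp g 2 μ) : Integrable (fun x => inner ℝ (f x) (g x)) μ := by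
  refine (L2.integrable_inner (𝕜 := ℝ) (hf.toLp f) (hg.toLp g)).congr ?_
  filter_upwards [hf.coeFn_toLp, hg.coeFn_toLp] with x h1 h2
  rw [h1, h2]

theorem memLp_gradient {v : Plane → ℝ} (hv : ContDiff ℝ 1 v) (hc : HasCompactSupport v)
    (μ : Measure Plane) [IsFiniteMeasureOnCompacts μ] : MemLp (gradient v) 2 μ :=
  (continuous_gradient hv).memLp_of_hasCompactSupport (hasCompactSupport_gradient hc)

theorem l2Norm_restrict_sq_le {F : Type*} [NormedAddCommGroup F] {f : Plane → F}
    (hf : MemLp f 2 volume) (S : Set Plane) :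
    l2Norm (volume.restrict S) f ^ 2 ≤ ∫ x, ‖f x‖ ^ 2 := by
  rw [l2Norm_sq]
  exact setIntegral_le_integral hf.norm.integrable_sq (ae_of_all _ fun _ => by positivity)

/-- The standing assumptions: a conforming shape-regular mesh, the weak solution `u` and a finite
element function `uh`. -/
structure IsMeshSetting (σ : ℝ) (k : ℕ) (Ω : Set Plane) (𝒯 : Finset (Finset Plane)) {N : ℕ}
    (P Q : Fin N → Plane) (g : Fin N → Plane → ℝ) (u uh : Plane → ℝ) : Prop where
  one_le : 1 ≤ σ
  isOpen : IsOpen Ω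
  tri : IsTriangulation Ω 𝒯
  shape : IsShapeRegular σ 𝒯
  conf : ConformsToFractures Ω 𝒯 P Q
  data : ∀ l, MemLp (g l) 2 (segMeasure (P l) (Q l))
  weak : IsWeakSolution Ω P Q g u
  lagrange : MemLagrange Ω 𝒯 k uh

namespace IsMeshSetting

variable {σ : ℝ} {k : ℕ} {Ω : Set Plane} {𝒯 : Finset (Finset Plane)} {N : ℕ}
  {P Q : Fin N → Plane} {g : Fin N → Plane → ℝ} {u uh : Plane → ℝ}

theorem exists_poly (S : IsMeshSetting σ k Ω 𝒯 P Q g u uh) {t : Finset Plane} (ht : t ∈ 𝒯) :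
    ∃ p : MvPolynomial (Fin 2) ℝ, p.totalDegree ≤ k ∧ EqOn uh (polyEval p) (interior (hull t)) := by
  obtain ⟨p, hp, h⟩ := S.lagrange.2.2 t ht
  exact ⟨p, hp, fun x hx => h x ⟨interior_subset hx, S.tri.interior_subset t ht hx⟩⟩

theorem memLp_error (S : IsMeshSetting σ k Ω 𝒯 P Q g u uh) :
    MemLp (weakGrad Ω fun x => u x - uh x) 2 (volume.restrict Ω) :=
  (memLp_congr_ae (weakGrad_sub_ae S.isOpen S.weak.1.1 S.lagrange.2.1.1)).2
    ((S.weak.1.1.memLp_weakGrad S.isOpen).sub (S.lagrange.2.1.1.memLp_weakGrad S.isOpen))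

/-- A closed triangle may touch the boundary of Ω, so it lies in Ω only up to its own boundary, a
null set. -/
theorem hull_ae_le (S : IsMeshSetting σ k Ω 𝒯 P Q g u uh) {t : Finset Plane} (ht : t ∈ 𝒯) :
    (hull t : Set Plane) ≤ᵐ[volume] Ω :=
  (hull_ae_eq_interior t).le.trans (S.tri.interior_subset t ht).eventuallyLE

theorem patch_ae_le (S : IsMeshSetting σ k Ω 𝒯 P Q g u uh) {t : Finset Plane} (ht : t ∈ 𝒯) :
    patch Ω 𝒯 t ≤ᵐ[volume] Ω := by
  classical
  rw [ae_le_set]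
  have h : ∀ s ∈ 𝒯, (volume : Measure Plane) (hull s \ Ω) = 0 := fun s hs =>
    ae_le_set.1 (S.hull_ae_le hs)
  refine measure_mono_null (t := ⋃ s ∈ 𝒯, hull s \ Ω) ?_
    ((measure_biUnion_null_iff 𝒯.countable_toSet).2 h)
  rintro x ⟨hx | hx, hxΩ⟩
  · exact mem_biUnion (Finset.mem_coe.2 ht) ⟨hx, hxΩ⟩
  · simp only [mem_iUnion] at hx
    obtain ⟨e, -, s, hs, hx⟩ := hx
    exact mem_biUnion (Finset.mem_coe.2 (Finset.mem_filter.1 hs).1) ⟨hx, hxΩ⟩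

theorem memLp_error_hull (S : IsMeshSetting σ k Ω 𝒯 P Q g u uh) {t : Finset Plane} (ht : t ∈ 𝒯) :
    MemLp (weakGrad Ω fun x => u x - uh x) 2 (volume.restrict (hull t)) :=
  S.memLp_error.mono_measure (Measure.restrict_mono_ae (S.hull_ae_le ht))

theorem memLp_error_patch (S : IsMeshSetting σ k Ω 𝒯 P Q g u uh) {t : Finset Plane}
    (ht : t ∈ 𝒯) : MemLp (weakGrad Ω fun x => u x - uh x) 2 (volume.restrict (patch Ω 𝒯 t)) :=
  S.memLp_error.mono_measure (Measure.restrict_mono_ae (S.patch_ae_le ht))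

theorem residual (S : IsMeshSetting σ k Ω 𝒯 P Q g u uh) {φ : Plane → ℝ}
    (hφ : IsTestFunction Ω φ) :
    ∫ x in Ω, inner ℝ (weakGrad Ω (fun x => u x - uh x) x) (gradient φ x) =
      linePairing P Q g φ - ∫ x in Ω, inner ℝ (weakGrad Ω uh x) (gradient φ x) := by
  have hG := memLp_gradient (hφ.1.of_le (by simp)) hφ.2.1 (volume.restrict Ω)
  rw [← S.weak.2 φ hφ, ← integral_sub
    (integrable_inner_of_memLp (S.weak.1.1.memLp_weakGrad S.isOpen) hG)
    (integrable_inner_of_memLp (S.lagrange.2.1.1.memLp_weakGrad S.isOpen) hG)]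
  refine integral_congr_ae ?_
  filter_upwards [weakGrad_sub_ae S.isOpen S.weak.1.1 S.lagrange.2.1.1] with x hx
  rw [hx, inner_sub_left]

/-- On a triangle, the weak gradient of the finite element function is the classical one. -/
theorem setIntegral_interior_inner (S : IsMeshSetting σ k Ω 𝒯 P Q g u uh) {t : Finset Plane}
    (ht : t ∈ 𝒯) {p : MvPolynomial (Fin 2) ℝ} (hp : EqOn uh (polyEval p) (interior (hull t)))
    (v : Plane → ℝ) :
    ∫ x in interior (hull t), inner ℝ (weakGrad Ω uh x) (gradient v x) =
      ∫ x in interior (hull t), inner ℝ (gradient (polyEval p) x) (gradient v x) := by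
  refine integral_congr_ae ?_
  filter_upwards [weakGrad_ae_eq_gradient isOpen_interior (S.tri.interior_subset t ht)
    S.lagrange.2.1.1 (contDiff_polyEval p) hp] with x hx
  rw [hx]

theorem l2Norm_laplacian_sq (_S : IsMeshSetting σ k Ω 𝒯 P Q g u uh) {t : Finset Plane}
    {p : MvPolynomial (Fin 2) ℝ} (hp : EqOn uh (polyEval p) (interior (hull t))) :
    l2Norm (volume.restrict (hull t)) (Laplacian.laplacian uh) =
      l2Norm (volume.restrict (hull t)) (Laplacian.laplacian (polyEval p)) := by
  refine l2Norm_congr_ae ?_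
  rw [Measure.restrict_congr_set (hull_ae_eq_interior t)]
  filter_upwards [ae_restrict_mem isOpen_interior.measurableSet] with x hx
  exact laplacian_eqOn_of_eqOn isOpen_interior hp hx

/-- Efficiency of the element residual. -/
theorem exists_element_bound (σ : ℝ) (k : ℕ) : ∃ C : ℝ, 0 < C ∧
    ∀ (Ω : Set Plane) (𝒯 : Finset (Finset Plane)) (N : ℕ) (P Q : Fin N → Plane)
      (g : Fin N → Plane → ℝ) (u uh : Plane → ℝ), IsMeshSetting σ k Ω 𝒯 P Q g u uh → ∀ t ∈ 𝒯,
      Metric.diam (hull t) * l2Norm (volume.restrict (hull t)) (Laplacian.laplacian uh) ≤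
        C * l2Norm (volume.restrict (hull t)) (weakGrad Ω fun x => u x - uh x) := by
  -- The ratio is σ because the ball of radius σr about the centre of the disc contains the whole
  -- triangle.
  obtain ⟨C, hC, h⟩ := exists_testFunction_disc k σ
  refine ⟨(|σ| + 1) * C, by positivity, fun Ω 𝒯 N P Q g u uh S t ht => ?_⟩
  have hσ : 0 < σ := by linarith [S.one_le]
  obtain ⟨p, hp, hpe⟩ := S.exists_poly ht
  obtain ⟨q, hq, hqp⟩ := exists_polyEval_eq_laplacian hp
  obtain ⟨c, r, hr, hcr, hd⟩ := S.shape t ht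
  obtain ⟨v, hv, hvc, hvs, h1, h2⟩ := h q hq c r hr
  set E := weakGrad Ω fun x => u x - uh x
  set M := ∫ x, v x * polyEval q x with hM
  have hsub : tsupport v ⊆ interior (hull t) :=
    hvs.trans (interior_maximal (Metric.ball_subset_closedBall.trans hcr) Metric.isOpen_ball)
  have hzero : ∀ x, x ∉ interior (hull t) → gradient v x = 0 := fun x hx =>
    gradient_eq_zero_of_notMem_tsupport fun h => hx (hsub h)
  have hφ : IsTestFunction Ω v := ⟨hv, hvc, hsub.trans (S.tri.interior_subset t ht)⟩
  have hv1 : ContDiff ℝ 1 v := hv.of_le (by simp)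
  have hres := S.residual hφ
  -- The sources live on edges, and no edge meets the interior of a triangle.
  rw [linePairing_eq_zero S.conf fun x hx s hs e he => S.tri.notMem_hull_edge_of_mem_interior hs ht
    he (hsub (subset_tsupport _ hx))] at hres
  have e1 : ∫ x in Ω, inner ℝ (weakGrad Ω uh x) (gradient v x) = -M := by
    rw [setIntegral_eq_of_subset_of_forall_sdiff_eq_zero S.isOpen.measurableSet
      (S.tri.interior_subset t ht) fun x hx => by rw [hzero x hx.2, inner_zero_right],
      S.setIntegral_interior_inner ht hpe, setIntegral_eq_integral_of_forall_compl_eq_zero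
        fun x hx => by rw [hzero x hx, inner_zero_right],
      integral_inner_gradient (contDiff_polyEval p) hv1 hvc, hM, hqp]
  have e2 : ∫ x in Ω, inner ℝ (E x) (gradient v x) =
      ∫ x in hull t, inner ℝ (E x) (gradient v x) := by
    rw [setIntegral_congr_set (hull_ae_eq_interior t)]
    exact setIntegral_eq_of_subset_of_forall_sdiff_eq_zero S.isOpen.measurableSet
      (S.tri.interior_subset t ht) fun x hx => by rw [hzero x hx.2, inner_zero_right]
  rw [e1, e2, zero_sub, neg_neg] at hres
  have hCS := abs_integral_inner_le (S.memLp_error_hull ht)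
    (memLp_gradient hv1 hvc (volume.restrict (hull t)))
  have hG := l2Norm_restrict_sq_le (memLp_gradient hv1 hvc volume) (hull t)
  set D := l2Norm (volume.restrict (hull t)) (Laplacian.laplacian uh) with hD
  have hDM : D ^ 2 ≤ C * M := by
    refine le_trans ?_ h1
    rw [hD, S.l2Norm_laplacian_sq hpe, ← hqp, l2Norm_sq]
    simp only [Real.norm_eq_abs, sq_abs]
    have hB : hull t ⊆ Metric.closedBall c (σ * r) := fun x hx =>
      (Metric.dist_le_diam_of_mem (isCompact_hull t).isBounded hx
        (hcr (Metric.mem_closedBall_self hr.le))).trans hd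
    exact setIntegral_mono_set (((contDiff_polyEval q (n := 0)).continuous.pow
      2).continuousOn.integrableOn_compact (isCompact_closedBall _ _))
      (ae_of_all _ fun x => sq_nonneg _) (LE.le.eventuallyLE hB)
  rw [hres] at hCS
  set G := l2Norm (volume.restrict (hull t)) (gradient v)
  set A := l2Norm (volume.restrict (hull t)) E
  have hA : 0 ≤ A := l2Norm_nonneg _ _
  have hG0 : 0 ≤ G := l2Norm_nonneg _ _
  have hD0 : 0 ≤ D := l2Norm_nonneg _ _
  have hM0 : 0 ≤ M := nonneg_of_mul_nonneg_right ((sq_nonneg D).trans hDM) hC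
  rw [abs_of_nonneg hM0] at hCS
  have hrG : r ^ 2 * G ^ 2 ≤ C * M := (mul_le_mul_of_nonneg_left hG (sq_nonneg r)).trans h2
  -- From M ≤ AG and r²G² ≤ CM follows r²M² ≤ A²CM; one factor M is cancelled.
  have hrM : r ^ 2 * M ≤ C * A ^ 2 := by
    rcases hM0.eq_or_lt with h0 | h0
    · rw [← h0, mul_zero]
      positivity
    · refine le_of_mul_le_mul_right ?_ h0
      calc r ^ 2 * M * M = r ^ 2 * M ^ 2 := by ring
        _ ≤ r ^ 2 * (A * G) ^ 2 := by gcongr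
        _ = A ^ 2 * (r ^ 2 * G ^ 2) := by ring
        _ ≤ A ^ 2 * (C * M) := by gcongr
        _ = _ := by ring
  have hrD : r * D ≤ C * A := by
    refine (sq_le_sq₀ (by positivity) (by positivity)).1 ?_
    calc (r * D) ^ 2 = r ^ 2 * D ^ 2 := by ring
      _ ≤ r ^ 2 * (C * M) := by gcongr
      _ = C * (r ^ 2 * M) := by ring
      _ ≤ C * (C * A ^ 2) := by gcongr
      _ = _ := by ring
  calc Metric.diam (hull t) * D ≤ σ * r * D := by gcongr
    _ = σ * (r * D) := by ring
    _ ≤ σ * (C * A) := by gcongr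
    _ ≤ (|σ| + 1) * (C * A) := by
        gcongr
        linarith [le_abs_self σ]
    _ = _ := by ring

end IsMeshSetting

/-! ### The residual across an interior edge -/

theorem IsEdgeFrame.interior_subset_halfPlane {σ : ℝ} {t e : Finset Plane} {a : Plane}
    {b : OrthonormalBasis (Fin 2) ℝ Plane} {h : ℝ} (hf : IsEdgeFrame σ t e a b h) :
    interior (hull t) ⊆ halfPlane a (b 1) := by
  intro x hx
  obtain ⟨ε, hε, hball⟩ := Metric.isOpen_iff.1 isOpen_interior x hx
  have hy : x - (ε / 2) • b 1 ∈ hull t := interior_subset (hball (by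
    rw [mem_ball_iff_norm, sub_sub_cancel_left, norm_neg, norm_smul, b.norm_eq_one, mul_one,
      Real.norm_of_nonneg (by positivity)]
    linarith))
  have h1 := hf.nonneg _ hy
  rw [sub_right_comm, inner_sub_right, real_inner_smul_right, real_inner_self_eq_norm_sq,
    b.norm_eq_one] at h1
  change 0 < inner ℝ (b 1) (x - a)
  linarith

theorem IsEdgeFrame.nonempty_interior {σ : ℝ} (hσ : 1 ≤ σ) {t e : Finset Plane} {a : Plane}
    {b : OrthonormalBasis (Fin 2) ℝ Plane} {h : ℝ} (hf : IsEdgeFrame σ t e a b h) :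
    (interior (hull t)).Nonempty :=
  ⟨_, hf.mem_interior (1 / 2) ⟨by norm_num, by norm_num⟩ (1 / (4 * σ ^ 2))
    ⟨by positivity, le_rfl⟩⟩

theorem IsEdgeFrame.volume_hull_edge {σ : ℝ} {t e : Finset Plane} {a : Plane}
    {b : OrthonormalBasis (Fin 2) ℝ Plane} {h : ℝ} (hf : IsEdgeFrame σ t e a b h) :
    (volume : Measure Plane) (hull e) = 0 := by
  have hsub : hull e ⊆ hull t \ interior (hull t) := fun x hx => ⟨?_, fun hxi => ?_⟩
  · exact measure_mono_null hsub (volume_hull_diff_interior t)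
  · exact convexHull_mono (Finset.coe_subset.2 hf.subset) hx
  · have h1 : 0 < inner ℝ (b 1) (x - a) := hf.interior_subset_halfPlane hxi
    rw [hf.hull_eq, segment_eq_image'] at hx
    obtain ⟨s, -, rfl⟩ := hx
    simp [inner_smul_right] at h1

/-- All that the edge estimate needs to know of the projection is that it is a polynomial of degree
at most `k`; the default value 0 is one as well. -/
theorem exists_l2Proj_eq (k : ℕ) (e : Finset Plane) (f : Plane → ℝ) :
    ∃ p : MvPolynomial (Fin 2) ℝ, p.totalDegree ≤ k ∧ l2Proj k e f = polyEval p := by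
  unfold l2Proj
  split_ifs with h
  · exact ⟨_, h.choose_spec.1, rfl⟩
  · exact ⟨0, by simp, by ext; simp [polyEval]⟩

namespace IsMeshSetting

variable {σ : ℝ} {k : ℕ} {Ω : Set Plane} {𝒯 : Finset (Finset Plane)} {N : ℕ}
  {P Q : Fin N → Plane} {g : Fin N → Plane → ℝ} {u uh : Plane → ℝ}

/-- Within the half-plane the support of `v` stays in the interior of the triangle. So triangle and
half-plane are interchangeable in the integrals, and Green's formula has only the line through the
edge as boundary. -/
theorem setIntegral_interior_edge (S : IsMeshSetting σ k Ω 𝒯 P Q g u uh) {t e : Finset Plane}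
    (ht : t ∈ 𝒯) {p : MvPolynomial (Fin 2) ℝ} (hp : EqOn uh (polyEval p) (interior (hull t)))
    {a : Plane} {b : OrthonormalBasis (Fin 2) ℝ Plane} {h : ℝ} (hf : IsEdgeFrame σ t e a b h)
    {v : Plane → ℝ} (hv : ContDiff ℝ 1 v) (hc : HasCompactSupport v)
    (hs : ∀ x ∈ tsupport v, x ∈ halfPlane a (b 1) → x ∈ interior (hull t)) :
    ∫ x in interior (hull t), inner ℝ (weakGrad Ω uh x) (gradient v x) =
      -(∫ x in hull t, v x * Laplacian.laplacian uh x) -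
        ∫ x : ℝ, v (a + x • b 0) * inner ℝ (b 1) (gradient (polyEval p) (a + x • b 0)) := by
  have hz : ∀ x ∈ halfPlane a (b 1) \ interior (hull t), x ∉ tsupport v := fun x hx h =>
    hx.2 (hs x h hx.1)
  rw [S.setIntegral_interior_inner ht hp,
    ← setIntegral_eq_of_subset_of_forall_sdiff_eq_zero (isOpen_halfPlane a (b 1)).measurableSet
      hf.interior_subset_halfPlane fun x hx => by
        rw [gradient_eq_zero_of_notMem_tsupport (hz x hx), inner_zero_right],
    setIntegral_halfPlane_inner_gradient (contDiff_polyEval p) hv hc a b,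
    setIntegral_eq_of_subset_of_forall_sdiff_eq_zero (isOpen_halfPlane a (b 1)).measurableSet
      hf.interior_subset_halfPlane fun x hx => by
        rw [image_eq_zero_of_notMem_tsupport (hz x hx), zero_mul],
    setIntegral_congr_set (hull_ae_eq_interior t)]
  congr 2
  exact setIntegral_congr_fun isOpen_interior.measurableSet fun x hx => by
    simp only [laplacian_eqOn_of_eqOn isOpen_interior hp hx]

/-- The normal jump in terms of the polynomials on both sides. -/
theorem normalJump_eq (S : IsMeshSetting σ k Ω 𝒯 P Q g u uh) {t s e : Finset Plane}
    {a : Plane} {b b' : OrthonormalBasis (Fin 2) ℝ Plane} {h : ℝ}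
    (hadj : ∀ r, r ∈ adjacent 𝒯 e ↔ r = t ∨ r = s) (hts : t ≠ s)
    (hft : IsEdgeFrame σ t e a b h) (hfs : IsEdgeFrame σ s e a b' h)
    {p q : MvPolynomial (Fin 2) ℝ} (hp : EqOn uh (polyEval p) (interior (hull t)))
    (hq : EqOn uh (polyEval q) (interior (hull s))) {x : Plane} (hx : x ∈ hull e) :
    normalJump 𝒯 uh e x = -inner ℝ (b 1) (gradient (polyEval p) x) -
      inner ℝ (b' 1) (gradient (polyEval q) x) := by
  classical
  have hadj' : adjacent 𝒯 e = {t, s} := by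
    ext r
    rw [hadj, Finset.mem_insert, Finset.mem_singleton]
  have hxt : x ∈ hull t := convexHull_mono (Finset.coe_subset.2 hft.subset) hx
  have hxs : x ∈ hull s := convexHull_mono (Finset.coe_subset.2 hfs.subset) hx
  rw [normalJump, hadj', Finset.sum_pair hts, hft.outwardNormal_eq S.one_le,
    hfs.outwardNormal_eq S.one_le,
    gradTrace_eq (hft.nonempty_interior S.one_le) (contDiff_polyEval p) hp hxt,
    gradTrace_eq (hfs.nonempty_interior S.one_le) (contDiff_polyEval q) hq hxs, inner_neg_left,
    inner_neg_left]
  ring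

/-- The residual tested with a function supported near the middle of an interior edge. -/
theorem residual_edge (S : IsMeshSetting σ k Ω 𝒯 P Q g u uh) {t s e : Finset Plane} (ht : t ∈ 𝒯)
    (hs : s ∈ 𝒯) {a : Plane} {b b' : OrthonormalBasis (Fin 2) ℝ Plane} {h : ℝ}
    (hadj : ∀ r, r ∈ adjacent 𝒯 e ↔ r = t ∨ r = s) (hts : t ≠ s)
    (hb0 : b' 0 = b 0) (hb1 : b' 1 = -b 1)
    (hft : IsEdgeFrame σ t e a b h) (hfs : IsEdgeFrame σ s e a b' h) (he : e = {a, a + h • b 0})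
    (heΩ : openSegment ℝ a (a + h • b 0) ⊆ Ω) {v : Plane → ℝ} (hv : ContDiff ℝ ∞ v)
    (hc : HasCompactSupport v)
    (hsupp : tsupport v ⊆
      interior (hull t) ∪ interior (hull s) ∪ openSegment ℝ a (a + h • b 0)) :
    ∫ x in Ω, inner ℝ (weakGrad Ω (fun x => u x - uh x) x) (gradient v x) =
      (∫ x, (fluxData P Q g e x - normalJump 𝒯 uh e x) * v x ∂(edgeMeasure e)) +
        (∫ x in hull t, v x * Laplacian.laplacian uh x) +
        ∫ x in hull s, v x * Laplacian.laplacian uh x := by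
  classical
  obtain ⟨p, -, hp⟩ := S.exists_poly ht
  obtain ⟨q, -, hq⟩ := S.exists_poly hs
  have hv1 : ContDiff ℝ 1 v := hv.of_le (by simp)
  have hcoord : ∀ x ∈ openSegment ℝ a (a + h • b 0), inner ℝ (b 1) (x - a) = 0 := by
    intro x hx
    rw [openSegment_eq_image'] at hx
    obtain ⟨θ, -, rfl⟩ := hx
    simp [inner_smul_right]
  have hIt := hft.interior_subset_halfPlane
  have hIs := hfs.interior_subset_halfPlane
  have hsneg : ∀ x ∈ interior (hull s), inner ℝ (b 1) (x - a) < 0 := by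
    intro x hx
    have : 0 < inner ℝ (b' 1) (x - a) := hIs hx
    rw [hb1, inner_neg_left] at this
    linarith
  -- The sign of the normal coordinate separates the three pieces of the support: positive in `t`,
  -- negative in `s`, zero on the edge.
  have htsupp : ∀ x ∈ tsupport v, x ∈ halfPlane a (b 1) → x ∈ interior (hull t) := by
    intro x hx h0
    change 0 < inner ℝ (b 1) (x - a) at h0
    rcases hsupp hx with (h1 | h1) | h1
    · exact h1
    · exact absurd h0 (hsneg x h1).not_gt
    · exact absurd (hcoord x h1) h0.ne'
  have hssupp : ∀ x ∈ tsupport v, x ∈ halfPlane a (b' 1) → x ∈ interior (hull s) := by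
    intro x hx h0
    change 0 < inner ℝ (b' 1) (x - a) at h0
    rw [hb1, inner_neg_left] at h0
    rcases hsupp hx with (h1 | h1) | h1
    · have : 0 < inner ℝ (b 1) (x - a) := hIt h1
      linarith
    · exact h1
    · rw [hcoord x h1] at h0
      linarith
  have hsegt : openSegment ℝ a (a + h • b 0) ⊆ hull e := by
    rw [hft.hull_eq]
    exact openSegment_subset_segment ℝ _ _
  have hΩ : tsupport v ⊆ Ω := hsupp.trans (union_subset (union_subset
    (S.tri.interior_subset t ht) (S.tri.interior_subset s hs)) heΩ)
  have hane : a ≠ a + h • b 0 := by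
    intro h0
    rw [left_eq_add, smul_eq_zero] at h0
    exact h0.elim hft.pos.ne' (b.orthonormal.ne_zero 0)
  have hfin : IsFiniteMeasure (edgeMeasure e) := by
    rw [hft.edgeMeasure_eq]
    infer_instance
  have hvL : MemLp v 2 (edgeMeasure e) := hv.continuous.memLp_of_hasCompactSupport hc
  have hpair : linePairing P Q g v = ∫ x, fluxData P Q g e x * v x ∂(edgeMeasure e) := by
    refine linePairing_eq_integral_edge S.conf S.data hvL fun x hx s' hs' e' he' hxe' => ?_
    obtain ⟨he1, he2⟩ := Finset.mem_powersetCard.1 he'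
    rcases hsupp (subset_tsupport _ hx) with (h1 | h1) | h1
    · exact absurd hxe' (S.tri.notMem_hull_edge_of_mem_interior hs' ht he' h1)
    · exact absurd hxe' (S.tri.notMem_hull_edge_of_mem_interior hs' hs he' h1)
    · have := S.tri.subset_of_mem_openSegment hs' ht he1 hane (he ▸ hft.subset) h1 hxe'
      rw [he]
      refine (Finset.eq_of_subset_of_card_le this ?_).symm
      rw [he2, Finset.card_pair hane]
  -- The rest of the support lies on the edge, a null set of the plane.
  have hsplit : ∫ x in Ω, inner ℝ (weakGrad Ω uh x) (gradient v x) =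
      (∫ x in interior (hull t), inner ℝ (weakGrad Ω uh x) (gradient v x)) +
        ∫ x in interior (hull s), inner ℝ (weakGrad Ω uh x) (gradient v x) := by
    have hi := integrable_inner_of_memLp (S.lagrange.2.1.1.memLp_weakGrad S.isOpen)
      (memLp_gradient hv1 hc (volume.restrict Ω))
    rw [← setIntegral_union _ isOpen_interior.measurableSet
      (IntegrableOn.mono_set hi (S.tri.interior_subset t ht))
      (IntegrableOn.mono_set hi (S.tri.interior_subset s hs))]
    · refine setIntegral_eq_of_subset_of_ae_sdiff_eq_zero S.isOpen.nullMeasurableSet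
        (union_subset (S.tri.interior_subset t ht) (S.tri.interior_subset s hs)) ?_
      have hnull : ∀ᵐ x ∂(volume : Measure Plane), x ∉ hull e :=
        measure_eq_zero_iff_ae_notMem.1 hft.volume_hull_edge
      filter_upwards [hnull] with x hx hxd
      rw [gradient_eq_zero_of_notMem_tsupport, inner_zero_right]
      intro hxv
      rcases hsupp hxv with h1 | h1
      · exact hxd.2 h1
      · exact hx (hsegt h1)
    · refine Set.disjoint_left.2 fun x h1 h2 => ?_
      have : 0 < inner ℝ (b 1) (x - a) := hIt h1
      linarith [hsneg x h2]
  set J : Plane → ℝ := fun x => -inner ℝ (b 1) (gradient (polyEval p) x) -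
      inner ℝ (b' 1) (gradient (polyEval q) x) with hJ
  have hgc : ∀ p : MvPolynomial (Fin 2) ℝ, Continuous (gradient (polyEval p)) := fun p =>
    continuous_gradient (contDiff_polyEval p)
  have hJc : Continuous J :=
    (continuous_const.inner (hgc p)).neg.sub (continuous_const.inner (hgc q))
  -- The boundary terms of the two half-planes combine to the normal jump: `b 1` and `b' 1` are the
  -- inner normals of `t` and `s`, whence the sign.
  have hline : (∫ x : ℝ, v (a + x • b 0) * inner ℝ (b 1) (gradient (polyEval p) (a + x • b 0))) +
      ∫ x : ℝ, v (a + x • b' 0) * inner ℝ (b' 1) (gradient (polyEval q) (a + x • b' 0)) =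
      -∫ x, J x * v x ∂(edgeMeasure e) := by
    have hls := hasCompactSupport_comp_line hc a (b.norm_eq_one 0)
    have hlc : Continuous fun x : ℝ => a + x • b 0 := by fun_prop
    have hint : ∀ f : Plane → ℝ, Continuous f →
        Integrable fun x : ℝ => v (a + x • b 0) * f (a + x • b 0) := fun f hf =>
      ((hv.continuous.comp hlc).mul (hf.comp hlc)).integrable_of_hasCompactSupport hls.mul_right
    rw [hb0, ← integral_add (hint _ (continuous_const.inner (hgc p)))
      (hint _ (continuous_const.inner (hgc q))), hft.integral_edgeMeasure, ← integral_neg,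
      ← setIntegral_eq_integral_of_forall_compl_eq_zero (s := Icc 0 h)]
    · refine setIntegral_congr_fun measurableSet_Icc fun x _ => ?_
      simp only [hJ]
      ring
    · intro x hx
      have : a + x • b 0 ∉ tsupport v := by
        intro hxv
        have h0 : inner ℝ (b 1) (a + x • b 0 - a) = 0 := by
          rw [add_sub_cancel_left, real_inner_smul_right, b.inner_eq_zero (by decide), mul_zero]
        rcases hsupp hxv with (h1 | h1) | h1
        · have : 0 < inner ℝ (b 1) (a + x • b 0 - a) := hIt h1
          exact this.ne' h0
        · exact (hsneg _ h1).ne h0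
        · rw [openSegment_eq_image'] at h1
          obtain ⟨θ, ⟨h2, h3⟩, h4⟩ := h1
          have h5 : (θ * h) • b 0 = x • b 0 := by
            simpa [smul_smul] using h4
          have h6 := smul_left_injective ℝ (b.orthonormal.ne_zero 0) h5
          refine hx ⟨?_, ?_⟩
          · rw [← h6]
            exact mul_nonneg h2.le hft.pos.le
          · rw [← h6]
            exact mul_le_of_le_one_left hft.pos.le h3.le
      rw [image_eq_zero_of_notMem_tsupport this, zero_mul, zero_mul, add_zero]
  have hjump : ∫ x, (fluxData P Q g e x - normalJump 𝒯 uh e x) * v x ∂(edgeMeasure e) =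
      linePairing P Q g v - ∫ x, J x * v x ∂(edgeMeasure e) := by
    have h1 : Integrable (fun x => fluxData P Q g e x * v x) (edgeMeasure e) :=
      (memLp_fluxData S.data e).integrable_mul hvL
    have h2 : Integrable (fun x => J x * v x) (edgeMeasure e) :=
      (hJc.mul hv.continuous).integrable_of_hasCompactSupport hc.mul_left
    rw [hpair, ← integral_sub h1 h2]
    refine integral_congr_ae ?_
    filter_upwards [ae_restrict_mem (measurableSet_hull e)] with x hx
    rw [S.normalJump_eq hadj hts hft hfs hp hq hx]
    simp only [hJ]
    ring
  have hgt := S.setIntegral_interior_edge ht hp hft hv1 hc htsupp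
  have hgs := S.setIntegral_interior_edge hs hq hfs hv1 hc hssupp
  rw [S.residual ⟨hv, hc, hΩ⟩, hjump, hsplit, hgt, hgs]
  linarith

end IsMeshSetting

/-! ### Efficiency of the jump residual -/

theorem memLp_restrict_hull_of_continuous {μ : Measure Plane} {t : Finset Plane}
    [IsFiniteMeasure (μ.restrict (hull t))] {f : Plane → ℝ} (hf : Continuous f) :
    MemLp f 2 (μ.restrict (hull t)) := by
  obtain ⟨B, hB⟩ := (isCompact_hull t).exists_bound_of_continuousOn hf.continuousOn
  refine MemLp.of_bound hf.aestronglyMeasurable B ?_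
  filter_upwards [ae_restrict_mem (measurableSet_hull t)] with x hx using hB x hx

/-- The arithmetic of the edge estimate. Up to powers of `h`, all norms of the test function are at
most X = √(CM); thus hM is at most X times the error and the oscillation, and squaring and
cancelling one factor M finishes. -/
theorem le_of_test_bound {h C C₁ M A O Dt Ds Vt Vs Ve G : ℝ} (hh : 0 < h) (hC : 0 < C)
    (hC₁ : 0 < C₁) (hM : 0 ≤ M) (hA : 0 ≤ A) (hO : 0 ≤ O) (hDt0 : 0 ≤ Dt) (hDs0 : 0 ≤ Ds)
    (hDt : h * Dt ≤ C₁ * A) (hDs : h * Ds ≤ C₁ * A) (hVt : Vt ^ 2 ≤ C * h ^ 2 * M)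
    (hVs : Vs ^ 2 ≤ C * h ^ 2 * M) (hVe : Ve ^ 2 ≤ h * (C * M)) (hG : G ^ 2 ≤ C * M)
    (h0 : h * M ≤ A * G + Vt * Dt + Vs * Ds + O * Ve) :
    h ^ 2 * M ≤ 2 * C * ((1 + 2 * C₁) ^ 2 * A ^ 2 + h * O ^ 2) := by
  set X := √(C * M) with hX
  have hX0 : 0 ≤ X := Real.sqrt_nonneg _
  have hX2 : X ^ 2 = C * M := Real.sq_sqrt (by positivity)
  have hr2 : √h ^ 2 = h := Real.sq_sqrt hh.le
  have hGX : G ≤ X := Real.le_sqrt_of_sq_le hG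
  have hVX : ∀ V : ℝ, V ^ 2 ≤ C * h ^ 2 * M → V ≤ h * X := fun V hV =>
    (le_abs_self V).trans (abs_le_of_sq_le_sq (by rw [mul_pow, hX2]; linarith) (by positivity))
  have hVtX := hVX Vt hVt
  have hVsX := hVX Vs hVs
  have hVeX : Ve ≤ √h * X :=
    (le_abs_self Ve).trans (abs_le_of_sq_le_sq (by rwa [mul_pow, hX2, hr2]) (by positivity))
  have h1 : h * M ≤ X * ((1 + 2 * C₁) * A + √h * O) := by
    calc h * M ≤ A * G + Vt * Dt + Vs * Ds + O * Ve := h0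
      _ ≤ A * X + h * X * Dt + h * X * Ds + O * (√h * X) := by gcongr
      _ = A * X + X * (h * Dt) + X * (h * Ds) + O * (√h * X) := by ring
      _ ≤ A * X + X * (C₁ * A) + X * (C₁ * A) + O * (√h * X) := by gcongr
      _ = _ := by ring
  rcases hM.eq_or_lt with hM0 | hM0
  · rw [← hM0, mul_zero]
    positivity
  · refine le_of_mul_le_mul_right ?_ hM0
    calc h ^ 2 * M * M = (h * M) ^ 2 := by ring
      _ ≤ (X * ((1 + 2 * C₁) * A + √h * O)) ^ 2 := by gcongr
      _ = C * M * ((1 + 2 * C₁) * A + √h * O) ^ 2 := by rw [mul_pow, hX2]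
      _ ≤ C * M * (2 * (((1 + 2 * C₁) * A) ^ 2 + (√h * O) ^ 2)) := by
          gcongr
          exact add_sq_le
      _ = _ := by
          rw [mul_pow √h, hr2]
          ring

namespace IsMeshSetting

theorem exists_edge_bound (σ : ℝ) (k : ℕ) : ∃ C : ℝ, 0 < C ∧
    ∀ (Ω : Set Plane) (𝒯 : Finset (Finset Plane)) (N : ℕ) (P Q : Fin N → Plane)
      (g : Fin N → Plane → ℝ) (u uh : Plane → ℝ), IsMeshSetting σ k Ω 𝒯 P Q g u uh → ∀ t ∈ 𝒯,
      ∀ e ∈ interiorEdges Ω t,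
      Metric.diam (hull t) *
          l2Norm (edgeMeasure e) (fun x => fluxData P Q g e x - normalJump 𝒯 uh e x) ^ 2 ≤
        C * (l2Norm (volume.restrict (patch Ω 𝒯 t)) (weakGrad Ω fun x => u x - uh x) ^ 2 +
          Metric.diam (hull e) * l2Norm (edgeMeasure e)
            (fun x => fluxData P Q g e x - l2Proj k e (fluxData P Q g e) x) ^ 2) := by
  by_cases hσ : 1 ≤ σ
  swap
  · exact ⟨1, one_pos, fun Ω 𝒯 N P Q g u uh S => absurd S.one_le hσ⟩
  obtain ⟨C₁, hC₁, hel⟩ := exists_element_bound σ k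
  -- The relative height of the box in `IsEdgeFrame`, so that the test function fits into the two
  -- triangles.
  have hδ : 0 < 1 / (4 * σ ^ 2) := by positivity
  obtain ⟨C, hC, htest⟩ := exists_testFunction_segment k hδ
  refine ⟨2 * σ * (1 + 2 * C ^ 2 * (1 + 2 * C₁) ^ 2), by positivity,
    fun Ω 𝒯 N P Q g u uh S t ht e he => ?_⟩
  obtain ⟨a, b, b', h, s, hs, hts, hadj, hb0, hb1, hft, hfs, heq, heΩ⟩ :=
    exists_edge_configuration hσ S.isOpen S.tri S.shape ht he
  obtain ⟨p, hpk, hp⟩ := S.exists_poly ht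
  obtain ⟨q, hqk, hq⟩ := S.exists_poly hs
  obtain ⟨pf, hpfk, hpf⟩ := exists_l2Proj_eq k e (fluxData P Q g e)
  obtain ⟨m₁, hm₁k, hm₁⟩ := exists_polyEval_eq_inner_gradient hpk (b 1)
  obtain ⟨m₂, hm₂k, hm₂⟩ := exists_polyEval_eq_inner_gradient hqk (b' 1)
  -- The polynomial part of the edge residual: `m₁ + m₂` is minus the normal jump, so the residual
  -- is the oscillation `f - f̄` plus `m`.
  set m := pf + m₁ + m₂ with hm
  have hmk : m.totalDegree ≤ k := (MvPolynomial.totalDegree_add _ _).trans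
    (max_le ((MvPolynomial.totalDegree_add _ _).trans (max_le hpfk hm₁k)) hm₂k)
  have hh := hft.pos
  obtain ⟨R, hRk, hR⟩ := exists_eval_eq_polyEval_line hmk a (h • b 0)
  have hR' : ∀ x : ℝ, polyEval m (a + (h * x) • b 0) = R.eval x := fun x => by
    rw [hR, smul_smul, mul_comm]
  obtain ⟨v, hv, hvc, hvs, h1, h2, h3, h4⟩ := htest R hRk a b h hh
  set M := ∫ x, v (a + (h * x) • b 0) * R.eval x with hM
  have hv1 : ContDiff ℝ 1 v := hv.of_le (by simp)
  have hM0 : 0 ≤ M :=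
    nonneg_of_mul_nonneg_right ((integral_nonneg fun _ => sq_nonneg _).trans h2) hC
  have hsupp : tsupport v ⊆
      interior (hull t) ∪ interior (hull s) ∪ openSegment ℝ a (a + h • b 0) := by
    intro x hx
    obtain ⟨θ, hθ, y, ⟨hy1, hy2⟩, rfl⟩ := hvs x hx
    rcases lt_trichotomy y 0 with h0 | h0 | h0
    · refine Or.inl (Or.inr ?_)
      have := hfs.mem_interior θ hθ (-y) ⟨by linarith, by linarith⟩
      rwa [hb0, hb1, mul_neg, neg_smul_neg] at this
    · refine Or.inr ?_
      rw [h0, mul_zero, zero_smul, add_zero, openSegment_eq_image']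
      exact ⟨θ, ⟨by linarith [hθ.1], by linarith [hθ.2]⟩, by
        simp only [add_sub_cancel_left, smul_smul, mul_comm]⟩
    · exact Or.inl (Or.inl (hft.mem_interior θ hθ y ⟨h0, hy2⟩))
  have hvline : ∀ x ∉ Icc (0 : ℝ) 1, v (a + (h * x) • b 0) = 0 := by
    intro x hx
    refine image_eq_zero_of_notMem_tsupport fun hxv => hx ?_
    obtain ⟨θ, hθ, y, -, hxy⟩ := hvs _ hxv
    have := congrArg (fun z => inner ℝ (b 0) (z - a)) hxy
    simp only [add_sub_cancel_left, real_inner_smul_right, real_inner_self_eq_norm_sq,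
      b.norm_eq_one] at this
    rw [add_assoc, add_sub_cancel_left, (inner_frame b _ _).1] at this
    have hxθ : x = θ := mul_left_cancel₀ hh.ne' (by linarith)
    rw [hxθ]
    exact ⟨by linarith [hθ.1], by linarith [hθ.2]⟩
  have hfin : IsFiniteMeasure (edgeMeasure e) := by
    rw [hft.edgeMeasure_eq]
    infer_instance
  have hfin' : IsFiniteMeasure ((Measure.hausdorffMeasure 1 : Measure Plane).restrict (hull e)) :=
    hfin
  have hvol : ∀ r : Finset Plane, IsFiniteMeasure ((volume : Measure Plane).restrict (hull r)) :=
    fun r => ⟨by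
      rw [Measure.restrict_apply_univ]
      exact (isCompact_hull r).measure_lt_top⟩
  have hpolyL : ∀ p, MemLp (polyEval p) 2 (edgeMeasure e) := fun p =>
    memLp_restrict_hull_of_continuous (contDiff_polyEval p (n := 0)).continuous
  have hvL : MemLp v 2 (edgeMeasure e) := hv.continuous.memLp_of_hasCompactSupport hvc
  have hoscL : MemLp (fun x => fluxData P Q g e x - l2Proj k e (fluxData P Q g e) x) 2
      (edgeMeasure e) := by
    rw [hpf]
    exact (memLp_fluxData S.data e).sub (hpolyL pf)
  have hjump : (fun x => fluxData P Q g e x - normalJump 𝒯 uh e x) =ᵐ[edgeMeasure e]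
      fun x => (fluxData P Q g e x - l2Proj k e (fluxData P Q g e) x) + polyEval m x := by
    filter_upwards [ae_restrict_mem (measurableSet_hull e)] with x hx
    rw [S.normalJump_eq hadj hts hft hfs hp hq hx, hpf, hm, polyEval_add, polyEval_add, hm₁, hm₂]
    ring
  set A := l2Norm (volume.restrict (patch Ω 𝒯 t)) (weakGrad Ω fun x => u x - uh x) with hA
  set O := l2Norm (edgeMeasure e)
    (fun x => fluxData P Q g e x - l2Proj k e (fluxData P Q g e) x) with hO
  have htp : hull t ⊆ patch Ω 𝒯 t := subset_union_left
  have hsp : hull s ⊆ patch Ω 𝒯 t := fun x hx => Or.inr (by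
    simp only [mem_iUnion]
    exact ⟨e, he, s, (hadj s).2 (Or.inr rfl), hx⟩)
  have hsuppP : tsupport v ⊆ patch Ω 𝒯 t := by
    refine hsupp.trans (union_subset (union_subset (interior_subset.trans htp)
      (interior_subset.trans hsp)) ?_)
    refine LE.le.trans ?_ htp
    refine (openSegment_subset_segment ℝ _ _).trans ?_
    rw [← hft.hull_eq]
    exact convexHull_mono (Finset.coe_subset.2 hft.subset)
  have hsuppΩ : tsupport v ⊆ Ω := hsupp.trans (union_subset (union_subset
    (S.tri.interior_subset t ht) (S.tri.interior_subset s hs)) heΩ)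
  -- The element estimate, applied below to both triangles at the edge, absorbs the element
  -- residuals that the edge test function picks up.
  have hdiam : ∀ r ∈ 𝒯, hull r ⊆ patch Ω 𝒯 t → h ≤ Metric.diam (hull r) →
      h * l2Norm (volume.restrict (hull r)) (Laplacian.laplacian uh) ≤ C₁ * A := by
    intro r hr hrp hhr
    calc _ ≤ Metric.diam (hull r) *
          l2Norm (volume.restrict (hull r)) (Laplacian.laplacian uh) :=
          mul_le_mul_of_nonneg_right hhr (l2Norm_nonneg _ _)
      _ ≤ C₁ * l2Norm (volume.restrict (hull r)) (weakGrad Ω fun x => u x - uh x) :=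
          hel Ω 𝒯 N P Q g u uh S r hr
      _ ≤ C₁ * A := mul_le_mul_of_nonneg_left
          (l2Norm_restrict_mono (S.memLp_error_patch ht) (LE.le.eventuallyLE hrp)) hC₁.le
  have hvL2 : MemLp v 2 volume := hv.continuous.memLp_of_hasCompactSupport hvc
  have hV : ∀ r : Finset Plane, l2Norm (volume.restrict (hull r)) v ^ 2 ≤ C * h ^ 2 * M := by
    intro r
    refine (l2Norm_restrict_sq_le hvL2 (hull r)).trans ?_
    simpa only [Real.norm_eq_abs, sq_abs] using h3
  have hVe : l2Norm (edgeMeasure e) v ^ 2 ≤ h * (C * M) := by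
    rw [l2Norm_sq, hft.integral_edgeMeasure_unit]
    refine mul_le_mul_of_nonneg_left (le_trans (le_of_eq ?_) h2) hh.le
    simp only [Real.norm_eq_abs, sq_abs]
    exact setIntegral_eq_integral_of_forall_compl_eq_zero fun x hx => by
      rw [hvline x hx, zero_pow two_ne_zero]
  have hG : l2Norm (volume.restrict (patch Ω 𝒯 t)) (gradient v) ^ 2 ≤ C * M :=
    (l2Norm_restrict_sq_le (memLp_gradient hv1 hvc volume) _).trans h4
  have hmv : ∫ x, polyEval m x * v x ∂(edgeMeasure e) = h * M := by
    rw [hft.integral_edgeMeasure_unit]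
    congr 1
    rw [hM, setIntegral_eq_integral_of_forall_compl_eq_zero fun x hx => by
      rw [hvline x hx, mul_zero]]
    simp_rw [hR', mul_comm]
  have hmm : l2Norm (edgeMeasure e) (polyEval m) ^ 2 ≤ h * (C * M) := by
    rw [l2Norm_sq, hft.integral_edgeMeasure_unit]
    refine mul_le_mul_of_nonneg_left (le_trans (le_of_eq ?_) h1) hh.le
    simp_rw [hR', Real.norm_eq_abs, sq_abs]
  have hres := S.residual_edge ht hs hadj hts hb0 hb1 hft hfs heq heΩ hv hvc hsupp
  have hresJ : ∫ x, (fluxData P Q g e x - normalJump 𝒯 uh e x) * v x ∂(edgeMeasure e) =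
      (∫ x, (fluxData P Q g e x - l2Proj k e (fluxData P Q g e) x) * v x ∂(edgeMeasure e)) +
        h * M := by
    have i1 : Integrable (fun x => (fluxData P Q g e x - l2Proj k e (fluxData P Q g e) x) * v x)
      (edgeMeasure e) := hoscL.integrable_mul hvL
    have i2 : Integrable (fun x => polyEval m x * v x) (edgeMeasure e) :=
      (hpolyL m).integrable_mul hvL
    rw [← hmv, ← integral_add i1 i2]
    refine integral_congr_ae ?_
    filter_upwards [hjump] with x hx
    rw [hx, add_mul]
  have hpatch : ∫ x in Ω, inner ℝ (weakGrad Ω (fun x => u x - uh x) x) (gradient v x) =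
      ∫ x in patch Ω 𝒯 t, inner ℝ (weakGrad Ω (fun x => u x - uh x) x) (gradient v x) := by
    rw [setIntegral_eq_integral_of_forall_compl_eq_zero,
      setIntegral_eq_integral_of_forall_compl_eq_zero]
    · intro x hx
      rw [gradient_eq_zero_of_notMem_tsupport fun h => hx (hsuppP h), inner_zero_right]
    · intro x hx
      rw [gradient_eq_zero_of_notMem_tsupport fun h => hx (hsuppΩ h), inner_zero_right]
  rw [hresJ, hpatch] at hres
  have c1 := abs_le.1 (abs_integral_inner_le (S.memLp_error_patch ht)
    (memLp_gradient hv1 hvc (volume.restrict (patch Ω 𝒯 t))))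
  have c2 := abs_le.1 (abs_integral_mul_le hoscL hvL)
  have c3 : ∀ r ∈ 𝒯, |∫ x in hull r, v x * Laplacian.laplacian uh x| ≤
      l2Norm (volume.restrict (hull r)) v *
        l2Norm (volume.restrict (hull r)) (Laplacian.laplacian uh) := by
    intro r hr
    obtain ⟨pr, -, hpr⟩ := S.exists_poly hr
    refine abs_integral_mul_le (hvL2.restrict _) ?_
    refine (memLp_congr_ae ?_).2 (memLp_restrict_hull_of_continuous
      (continuous_laplacian (contDiff_polyEval pr)))
    rw [Measure.restrict_congr_set (hull_ae_eq_interior r)]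
    filter_upwards [ae_restrict_mem isOpen_interior.measurableSet] with x hx
    exact laplacian_eqOn_of_eqOn isOpen_interior hpr hx
  have c3t := abs_le.1 (c3 t ht)
  have c3s := abs_le.1 (c3 s hs)
  -- The residual identity solved for `h * M`, the pairing of `m` with `v` on the edge, and each
  -- remaining term estimated by Cauchy–Schwarz.
  have hmain := le_of_test_bound hh hC hC₁ hM0 (l2Norm_nonneg _ _) (l2Norm_nonneg _ _)
    (l2Norm_nonneg _ _) (l2Norm_nonneg _ _) (hdiam t ht htp hft.le_diam)
    (hdiam s hs hsp hfs.le_diam) (hV t) (hV s) hVe hG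
    (O := O) (by linarith [c1.1, c1.2, c2.1, c2.2, c3t.1, c3t.2, c3s.1, c3s.2])
  have hdE : h ≤ Metric.diam (hull e) := by
    have h5 : a ∈ hull e := hft.hull_eq ▸ left_mem_segment ℝ _ _
    have h6 : a + h • b 0 ∈ hull e := hft.hull_eq ▸ right_mem_segment ℝ _ _
    have := Metric.dist_le_diam_of_mem (isCompact_hull e).isBounded h6 h5
    rwa [dist_eq_norm, add_sub_cancel_left, norm_smul, b.norm_eq_one, mul_one,
      Real.norm_of_nonneg hh.le] at this
  have hsum := l2Norm_add_sq_le hoscL (hpolyL m)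
  rw [l2Norm_congr_ae hjump]
  -- Used to enlarge the oscillation term so that error and oscillation carry the same constant.
  have hC₁' : 1 ≤ (1 + 2 * C₁) ^ 2 := by nlinarith
  calc _ ≤ σ * h * (2 * (O ^ 2 + h * (C * M))) := by
        gcongr
        · exact hft.diam_le
        · exact hsum.trans (by linarith)
    _ = 2 * σ * (h * O ^ 2 + C * (h ^ 2 * M)) := by ring
    _ ≤ 2 * σ * (h * O ^ 2 + C * (2 * C * ((1 + 2 * C₁) ^ 2 * A ^ 2 + h * O ^ 2))) := by gcongr
    _ ≤ 2 * σ * (h * O ^ 2 + C * (2 * C * ((1 + 2 * C₁) ^ 2 * A ^ 2 +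
          (1 + 2 * C₁) ^ 2 * (h * O ^ 2)))) := by
        have hO' : h * O ^ 2 ≤ (1 + 2 * C₁) ^ 2 * (h * O ^ 2) :=
          le_mul_of_one_le_left (by positivity) hC₁'
        refine mul_le_mul_of_nonneg_left (add_le_add le_rfl ?_) (by positivity)
        refine mul_le_mul_of_nonneg_left ?_ hC.le
        exact mul_le_mul_of_nonneg_left (add_le_add le_rfl hO') (by positivity)
    _ ≤ 2 * σ * ((h * O ^ 2 + A ^ 2) + C * (2 * C * ((1 + 2 * C₁) ^ 2 * A ^ 2 +
          (1 + 2 * C₁) ^ 2 * (h * O ^ 2)))) := by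
        gcongr
        exact le_add_of_nonneg_right (sq_nonneg _)
    _ = 2 * σ * (1 + 2 * C ^ 2 * (1 + 2 * C₁) ^ 2) * (A ^ 2 + h * O ^ 2) := by ring
    _ ≤ _ := by gcongr

end IsMeshSetting

/-! ### Assembly of the local estimate -/

theorem IsShapeRegular.mono {σ τ : ℝ} {𝒯 : Finset (Finset Plane)} (h : IsShapeRegular σ 𝒯)
    (hστ : σ ≤ τ) : IsShapeRegular τ 𝒯 := by
  intro t ht
  obtain ⟨c, r, hr, hsub, hd⟩ := h t ht
  exact ⟨c, r, hr, hsub, hd.trans (mul_le_mul_of_nonneg_right hστ hr.le)⟩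

theorem card_interiorEdges_le {Ω : Set Plane} {t : Finset Plane} (ht : t.card = 3) :
    (interiorEdges Ω t).card ≤ 3 := by
  classical
  refine (Finset.card_filter_le _ _).trans ?_
  rw [edges, Finset.card_powersetCard, ht]
  decide

end

/-- Efficiency of the residual estimator. -/
theorem mainTheorem2 (k : ℕ) (hk : 1 ≤ k) (σ : ℝ) :
    ∃ C : ℝ, 0 < C ∧
      ∀ (Ω : Set Plane) (N : ℕ) (P Q : Fin N → Plane) (g : Fin N → Plane → ℝ)
        (𝒯 : Finset (Finset Plane)) (u uh : Plane → ℝ),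
        IsPolygonalDomain Ω →
        (∀ l, P l ≠ Q l ∧ segment ℝ (P l) (Q l) ⊆ Ω) →
        (∀ l, MemLp (g l) 2 (segMeasure (P l) (Q l))) →
        IsTriangulation Ω 𝒯 →
        IsShapeRegular σ 𝒯 →
        ConformsToFractures Ω 𝒯 P Q →
        IsWeakSolution Ω P Q g u →
        IsFESolution Ω 𝒯 k P Q g uh →
        ∀ t ∈ 𝒯,
          localIndicator Ω 𝒯 P Q g uh t ≤
            C * (l2Norm (volume.restrict (patch Ω 𝒯 t)) (weakGrad Ω (fun x => u x - uh x)) +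
              dataOsc Ω k P Q g t) := by
  -- The edge frames need a parameter of at least 1, and enlarging σ only weakens shape regularity.
  obtain ⟨C₁, hC₁, hel⟩ := IsMeshSetting.exists_element_bound (max σ 1) k
  obtain ⟨C₂, hC₂, hed⟩ := IsMeshSetting.exists_edge_bound (max σ 1) k
  -- With at most three edges and the factor 1/2, the squared indicator is at most C₁²A² + C₂(3A² +
  -- O²)/2, where A is the error on the patch and O the oscillation; the square of this constant
  -- dominates C₁² + 2C₂.
  refine ⟨C₁ + 2 * C₂ + 1, by positivity, ?_⟩
  intro Ω N P Q g 𝒯 u uh hΩ _ hg h𝒯 hσ hconf hu huh t ht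
  have S : IsMeshSetting (max σ 1) k Ω 𝒯 P Q g u uh :=
    ⟨le_max_right _ _, hΩ.isOpen, h𝒯, hσ.mono (le_max_left _ _), hconf, hg, hu, huh.1⟩
  have hcard : ((interiorEdges Ω t).card : ℝ) ≤ 3 := by
    exact_mod_cast card_interiorEdges_le (h𝒯.card_eq t ht)
  set A := l2Norm (volume.restrict (patch Ω 𝒯 t)) (weakGrad Ω fun x => u x - uh x)
  have hA : 0 ≤ A := l2Norm_nonneg _ _
  have hO : 0 ≤ dataOsc Ω k P Q g t := Real.sqrt_nonneg _
  have hO2 := Real.sq_sqrt (Finset.sum_nonneg fun e (_ : e ∈ interiorEdges Ω t) =>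
    mul_nonneg (Metric.diam_nonneg (s := hull e)) (sq_nonneg (l2Norm (edgeMeasure e)
      fun x => fluxData P Q g e x - l2Proj k e (fluxData P Q g e) x)))
  change dataOsc Ω k P Q g t ^ 2 = _ at hO2
  have h1 : Metric.diam (hull t) ^ 2 *
      l2Norm (volume.restrict (hull t)) (Laplacian.laplacian uh) ^ 2 ≤ C₁ ^ 2 * A ^ 2 := by
    rw [← mul_pow, ← mul_pow]
    refine pow_le_pow_left₀ (mul_nonneg Metric.diam_nonneg (l2Norm_nonneg _ _))
      ((hel Ω 𝒯 N P Q g u uh S t ht).trans (mul_le_mul_of_nonneg_left ?_ hC₁.le)) 2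
    exact l2Norm_restrict_mono (S.memLp_error_patch ht)
      (LE.le.eventuallyLE (show hull t ⊆ patch Ω 𝒯 t from subset_union_left))
  have h2 := Finset.sum_le_sum (hed Ω 𝒯 N P Q g u uh S t ht)
  rw [← Finset.mul_sum _ _ C₂, Finset.sum_add_distrib, ← hO2, Finset.sum_const, nsmul_eq_mul] at h2
  have h3 : C₂ * ((interiorEdges Ω t).card * A ^ 2 + dataOsc Ω k P Q g t ^ 2) ≤
      C₂ * (3 * A ^ 2 + dataOsc Ω k P Q g t ^ 2) := by gcongr
  refine Real.sqrt_le_iff.2 ⟨by positivity, ?_⟩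
  generalize dataOsc Ω k P Q g t = O at *
  calc _ ≤ C₁ ^ 2 * A ^ 2 + 1 / 2 * (C₂ * (3 * A ^ 2 + O ^ 2)) := by
        linarith [h2.trans h3]
    _ ≤ (C₁ + 2 * C₂ + 1) ^ 2 * (A ^ 2 + O ^ 2) := by
        have h4 : C₁ ^ 2 + 2 * C₂ ≤ (C₁ + 2 * C₂ + 1) ^ 2 := by nlinarith [mul_pos hC₁ hC₂]
        have h5 := mul_le_mul_of_nonneg_right h4 (add_nonneg (sq_nonneg A) (sq_nonneg O))
        nlinarith [sq_nonneg A, sq_nonneg O, mul_nonneg hC₂.le (sq_nonneg A),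
          mul_nonneg hC₂.le (sq_nonneg O), mul_nonneg (sq_nonneg C₁) (sq_nonneg O)]
    _ ≤ (C₁ + 2 * C₂ + 1) ^ 2 * (A + O) ^ 2 := by
        gcongr
        nlinarith [mul_nonneg hA hO]
    _ = _ := by ring
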